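/- **Multicategories.** A multicategory $\mathbb M$ has a collection of objects, a set $\mathbb M_n(a_1,\dots,a_n;b)$ of $n$-ary multimaps for each finite (possibly empty) list $\bar a=a_1,\dots,a_n$ and object $b$, identities $1_a\in\mathbb M_1(a;a)$, and substitutions $(g,f)\mapsto g\circ_i f$ of a multimap $f:\bar a\to b_i$ into the $i$-th variable of $g:b_1,\dots,b_n\to c$, such that $1\circ_1 f=f=f\circ_i1$, $h\circ_i(g\circ_jf)=(h\circ_ig)\circ_{i+j-1}f$, and $(h\circ_ig)\circ_{n+j-1}f=(h\circ_jf)\circ_ig$ for $i<j$ and $g$ of arity $n$. Multifunctors preserve this structure. The unary multimaps form the underlying category. A **short multicategory** $\mathcal C$ consists of a category $C$, functors $\mathcal C_n(-;-):(C^n)^{op}\times C\to\mathrm{Set}$ for $n\le4$ with $\mathcal C_1(-;-)=C(-,-)$ (pre- and postcomposition of $n$-ary multimaps with unary ones), and substitutions $g\circ_if$, natural in all variables and dinatural in $b_i$, for $(g,f)$ of arities $(2,2)$, $(3,2)$, $(2,3)$, $(2,0)$, $(3,0)$. These satisfy, for $f$ binary, the equations $f\circ_i(g\circ_jh)=(f\circ_ig)\circ_{i+j-1}h$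 for $(g,h)$ of arities $(2,2)$ and $(2,0)$, and $(f\circ_1g)\circ_{n+1}h=(f\circ_2h)\circ_1g$, where $n$ is the arity of $g$, for $(g,h)$ of arities $(2,2)$, $(2,0)$, $(0,2)$ and $(0,0)$. Morphisms are functors together with natural maps on multimaps of arity $\le4$ (the functor action in arity $1$) that commute with all substitutions. **Representability.** A map classifier for $\bar a$ is a multimap $\theta:\bar a\to m$ for which $-\circ_1\theta$ from unary maps $m\to z$ to multimaps $\bar a\to z$ is bijective for all $z$. A short multicategory is *left representable* (resp. *representable*) if it has a nullary map classifier $u\in\mathcal C_0(-;i)$ and binary map classifiers $\theta_{a,b}\in\mathcal C_2(a,b;ab)$ for all $a,b$ such that, for $1\le n\le3$, substitution of $u$ and of $\theta_{a,b}$ into the first variable (resp. into any variable) of $n$-ary multimaps is bijective: $\mathcal C_n(\bar x,i,\bar y;z)\cong\mathcal C_{n-1}(\bar x,\bar y;z)$ and $\mathcal C_n(\bar x,ab,\bar y;z)\cong\mathcal C_{n+1}(\bar x,a,b,\bar y;z)$. A multicategory is *representable* if every finite list has a map classifier and substitution of these into any variable of any multimap is bijective. Let $\mathrm{ShMult}_{lr}$,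 $\mathrm{ShMult}_{rep}$ and $\mathrm{Mult}_{rep}$ be the full subcategories of left representable short multicategories, representable short multicategories, and representable multicategories. **Monoidal side.** A skew monoidal category is a category with a tensor product $(a,b)\mapsto ab$, a unit $i$ and natural maps $\alpha:(ab)c\to a(bc)$, $\lambda:ia\to a$, $\rho:a\to ai$ (not necessarily invertible) satisfying Mac Lane's five axioms; it is left normal if $\lambda$ is invertible. Let $\mathrm{Skew}_{ln}$ be the category of left normal skew monoidal categories and lax monoidal functors, and $J:\mathrm{Mon}\to\mathrm{Skew}_{ln}$ the inclusion of monoidal categories and lax monoidal functors (those with $\alpha$ and $\rho$ invertible). **The functors.** For a choice of nullary and binary map classifiers, $K:\mathrm{ShMult}_{lr}\to\mathrm{Skew}_{ln}$ sends $\mathcal C$ to its underlying category with tensor product $ab$ and unit $i$ the codomains of the classifiers $\theta_{a,b}$ and $u$, with $fg$ (on maps), $\alpha$, $\lambda$, $\rho$ determined by $(fg)\circ\theta=\theta\circ(f,g)$, $\alpha\circ(\theta_{ab,c}\circ_1\theta_{a,b})=\theta_{a,bc}\circ_2\theta_{b,c}$, $\lambda\circ(\theta_{i,a}\circ_1u)=1_a$,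 $\rho=\theta_{a,i}\circ_2u$; it sends a morphism $F$ to its underlying functor with the lax structure $f_2\circ\theta=F\theta$, $f_0\circ u=Fu$. Similarly, for a choice of nullary and binary map classifiers, $T_{rep}:\mathrm{Mult}_{rep}\to\mathrm{Mon}$ sends a representable multicategory to its underlying category, with the monoidal structure induced by these classifiers by the same formulas. Let $U_{rep}:\mathrm{Mult}_{rep}\to\mathrm{ShMult}_{rep}$ forget the multimaps of arity greater than $4$. **Theorem.** For any choice of classifiers, $K$ restricts to a functor $K_{rep}:\mathrm{ShMult}_{rep}\to\mathrm{Mon}$: the composite $J\circ K_{rep}$ equals $K$ restricted to $\mathrm{ShMult}_{rep}$. Moreover, a left representable short multicategory $\mathcal C$ is representable if and only if $\alpha$ and $\rho$ are invertible in $K\mathcal C$. The functors $K_{rep}$, $U_{rep}$ and $T_{rep}$ are equivalences of categories, and they form a commutative triangle: $T_{rep}=K_{rep}\circ U_{rep}$ if $T_{rep}$ and $K_{rep}$ are built from the same classifiers, and $T_{rep}\cong K_{rep}\circ U_{rep}$ for arbitrary choices. -/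

import Mathlib

open CategoryTheory

universe v u

set_option linter.checkUnivs false
set_option linter.unusedVariables false

namespace RepMult

/-! ## Multicategories -/

/-- A multicategory: objects, sets of multimaps `Hom as b` from a finite list of objects to an
object, identities, and substitution into a single position.

`circ x y hb hd g f` is `g ∘ᵢ f` with `i = |x| + 1`: the variable `b` of `g : x, b, y → c` is replaced
by `f : as → b`.  The domain of `g` and that of the composite are recorded as lists `bs`, `ds` with
equations `bs = x, b, y` and `ds = x, as, y`, so that no transport along equalities of lists occurs
in the axioms. -/
structure Multicategory where
  Obj : Type u
  Hom : List Obj → Obj → Type v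
  id (a : Obj) : Hom [a] a
  circ {bs as ds : List Obj} {b c : Obj} (x y : List Obj)
    (hb : bs = x ++ b :: y) (hd : ds = x ++ (as ++ y)) (g : Hom bs c) (f : Hom as b) : Hom ds c
  /-- `1 ∘₁ f = f` -/
  id_circ {as : List Obj} {b : Obj} (hd : as = [] ++ (as ++ [])) (f : Hom as b) :
    circ [] [] rfl hd (id b) f = f
  /-- `f ∘ᵢ 1 = f` -/
  circ_id {bs : List Obj} {b c : Obj} (x y : List Obj) (hb : bs = x ++ b :: y)
    (hd : bs = x ++ ([b] ++ y)) (f : Hom bs c) :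
    circ x y hb hd f (id b) = f
  /-- `h ∘ᵢ (g ∘ⱼ f) = (h ∘ᵢ g) ∘ᵢ₊ⱼ₋₁ f` -/
  assoc {cs bs as gs es ds : List Obj} {b c d : Obj} (x y x' y' : List Obj)
    (hc : cs = x ++ c :: y) (hb : bs = x' ++ b :: y')
    (hg : gs = x' ++ (as ++ y')) (hd : ds = x ++ (gs ++ y))
    (he : es = x ++ (bs ++ y)) (he' : es = (x ++ x') ++ b :: (y' ++ y))
    (hd' : ds = (x ++ x') ++ (as ++ (y' ++ y)))
    (h : Hom cs d) (g : Hom bs c) (f : Hom as b) :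
    circ x y hc hd h (circ x' y' hb hg g f) =
      circ (x ++ x') (y' ++ y) he' hd' (circ x y hc he h g) f
  /-- `(h ∘ᵢ g) ∘ₙ₊ⱼ₋₁ f = (h ∘ⱼ f) ∘ᵢ g` for `i < j`, where `n` is the arity of `g` -/
  comm {cs bs as es es' ds : List Obj} {b c d : Obj} (x y z : List Obj)
    (hc : cs = x ++ b :: (y ++ c :: z)) (hc' : cs = (x ++ b :: y) ++ c :: z)
    (he : es = x ++ (bs ++ (y ++ c :: z))) (he' : es = (x ++ (bs ++ y)) ++ c :: z)
    (hf : es' = (x ++ b :: y) ++ (as ++ z)) (hf' : es' = x ++ b :: (y ++ (as ++ z)))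
    (hd : ds = (x ++ (bs ++ y)) ++ (as ++ z)) (hd' : ds = x ++ (bs ++ (y ++ (as ++ z))))
    (h : Hom cs d) (g : Hom bs b) (f : Hom as c) :
    circ (x ++ (bs ++ y)) z he' hd (circ x (y ++ c :: z) hc he h g) f =
      circ x (y ++ (as ++ z)) hf' hd' (circ (x ++ b :: y) z hc' hf h f) g

namespace Multicategory

/-- The underlying category of unary multimaps. -/
instance (M : Multicategory.{v, u}) : Category.{v} M.Obj where
  Hom a b := M.Hom [a] b
  id a := M.id a
  comp f g := M.circ [] [] rfl rfl g f
  id_comp f := M.circ_id [] [] rfl rfl f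
  comp_id f := M.id_circ rfl f
  assoc f g h := M.assoc [] [] [] [] rfl rfl rfl rfl rfl rfl rfl h g f

end Multicategory

/-- Transport of an element of a family indexed by lists along an equality of lists. -/
def recast {O : Type u} {H : List O → Type v} {as as' : List O} (h : as' = as) (f : H as) :
    H as' := h ▸ f

theorem map_self {O : Type u} {as as' : List O} (h : as' = as.map fun a => a) : as' = as :=
  h.trans (List.map_id' as)

theorem map_map_eq {A B C : Type u} {F : A → B} {G : B → C} {as : List A} {bs : List B}
    {cs : List C} (h : cs = as.map fun a => G (F a)) (h' : bs = as.map F) : cs = bs.map G := by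
  simp [h, h']

/-- A multifunctor.  The domain `Fas` of `map h f`, for `f : as → b`, is recorded as a list `as'`
with an equation `h : as' = Fas`.  The cases of `map_circ` in which one of the two multimaps is unary
express functoriality on the underlying categories and naturality. -/
structure Multifunctor (M N : Multicategory.{v, u}) where
  obj : M.Obj → N.Obj
  map {as : List M.Obj} {as' : List N.Obj} {b : M.Obj} (h : as' = as.map obj) (f : M.Hom as b) :
    N.Hom as' (obj b)
  map_id (a : M.Obj) : map rfl (M.id a) = N.id (obj a)
  map_circ {bs as ds x y : List M.Obj} {bs' as' ds' x' y' : List N.Obj} {b c : M.Obj}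
    (hb : bs = x ++ b :: y) (hd : ds = x ++ (as ++ y))
    (h₁ : bs' = bs.map obj) (h₂ : as' = as.map obj) (h₃ : ds' = ds.map obj)
    (hx : x' = x.map obj) (hy : y' = y.map obj)
    (hb' : bs' = x' ++ obj b :: y') (hd' : ds' = x' ++ (as' ++ y'))
    (g : M.Hom bs c) (f : M.Hom as b) :
    map h₃ (M.circ x y hb hd g f) = N.circ x' y' hb' hd' (map h₁ g) (map h₂ f)

namespace Multifunctor

/-- The identity multifunctor. -/
def id (M : Multicategory.{v, u}) : Multifunctor M M where
  obj a := a
  map {_ _ b} h f := recast (H := fun l => M.Hom l b) (map_self h) f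
  map_id a := rfl
  map_circ hb hd h₁ h₂ h₃ hx hy hb' hd' g f := by
    obtain rfl := map_self h₁
    obtain rfl := map_self h₂
    obtain rfl := map_self h₃
    obtain rfl := map_self hx
    obtain rfl := map_self hy
    rfl

/-- Composition of multifunctors. -/
def comp {M N P : Multicategory.{v, u}} (F : Multifunctor M N) (G : Multifunctor N P) :
    Multifunctor M P where
  obj a := G.obj (F.obj a)
  map h f := G.map (map_map_eq h rfl) (F.map rfl f)
  map_id a := by
    rw [F.map_id]; exact G.map_id _
  map_circ hb hd h₁ h₂ h₃ hx hy hb' hd' g f := by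
    rw [F.map_circ hb hd rfl rfl rfl rfl rfl (by simp [hb]) (by simp [hd])]
    exact G.map_circ _ _ _ _ _ (map_map_eq hx rfl) (map_map_eq hy rfl) _ _ _ _

@[ext]
theorem ext {M N : Multicategory.{v, u}} {F G : Multifunctor M N} (h : F.obj = G.obj)
    (h' : ∀ {as : List M.Obj} {as' : List N.Obj} {b : M.Obj} (e : as' = as.map F.obj)
      (e' : as' = as.map G.obj) (f : M.Hom as b), HEq (F.map e f) (G.map e' f)) : F = G := by
  obtain ⟨Fo, Fm, _, _⟩ := F
  obtain ⟨Go, Gm, _, _⟩ := G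
  obtain rfl : Fo = Go := h
  congr
  funext as as' b e f
  exact eq_of_heq (h' e e f)

/-- The value of a multifunctor depends only on the multimap. -/
theorem map_recast {M N : Multicategory.{v, u}} (F : Multifunctor M N) {as bs : List M.Obj}
    {as' : List N.Obj} {b : M.Obj} (e : bs = as) (h : as' = bs.map F.obj) (h' : as' = as.map F.obj)
    (f : M.Hom as b) : F.map h (recast (H := fun l => M.Hom l b) e f) = F.map h' f := by
  subst e; rfl

theorem recast_map {M N : Multicategory.{v, u}} (F : Multifunctor M N) {as : List M.Obj}
    {as' bs' : List N.Obj} {b : M.Obj} (e : bs' = as') (h : as' = as.map F.obj)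
    (h' : bs' = as.map F.obj) (f : M.Hom as b) :
    recast (H := fun l => N.Hom l (F.obj b)) e (F.map h f) = F.map h' f := by
  subst e; rfl

theorem map_map {M N P : Multicategory.{v, u}} (F : Multifunctor M N) (G : Multifunctor N P)
    {as : List M.Obj} {bs cs : List N.Obj} {ds : List P.Obj} {b : M.Obj} (h : bs = as.map F.obj)
    (h' : cs = as.map F.obj) (k : ds = bs.map G.obj) (k' : ds = cs.map G.obj)
    (f : M.Hom as b) : G.map k (F.map h f) = G.map k' (F.map h' f) := by
  subst h h'; rfl

end Multifunctor

/-- The category of multicategories and multifunctors. -/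
instance : Category.{max u v} Multicategory.{v, u} where
  Hom := Multifunctor
  id := Multifunctor.id
  comp := Multifunctor.comp
  id_comp F := Multifunctor.ext rfl fun _ h f => heq_of_eq (F.map_recast (List.map_id' _) _ h f)
  comp_id F := Multifunctor.ext rfl fun _ h f => heq_of_eq (F.recast_map h _ h f)
  assoc F G H := Multifunctor.ext rfl fun _ _ f => heq_of_eq (Multifunctor.map_map G H _ _ _ _ _)

/-! ## Short multicategories -/

/-- The arities `(n, m)` for which an `m`-ary multimap can be substituted into an `n`-ary one
in a short multicategory. -/
def SubOK (n m : ℕ) : Prop :=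
  n = 1 ∨ m = 1 ∨ (n = 2 ∧ m = 2) ∨ (n = 3 ∧ m = 2) ∨ (n = 2 ∧ m = 3) ∨ (n = 2 ∧ m = 0) ∨
    (n = 3 ∧ m = 0)

/-- The arities of `h`, `g`, `f` for which `h ∘ (g ∘ f) = (h ∘ g) ∘ f` is required
in a short multicategory. -/
def AssocOK (n m k : ℕ) : Prop :=
  n = 1 ∨ m = 1 ∨ k = 1 ∨ (n = 2 ∧ m = 2 ∧ k = 2) ∨ (n = 2 ∧ m = 2 ∧ k = 0)

/-- The arities of `h`, `g`, `f` for which `(h ∘ g) ∘ f = (h ∘ f) ∘ g`, with `g` and `f` in different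
variables of `h`, is required in a short multicategory. -/
def CommOK (n m k : ℕ) : Prop :=
  m = 1 ∨ k = 1 ∨ (n = 2 ∧ m = 2 ∧ k = 2) ∨ (n = 2 ∧ m = 2 ∧ k = 0) ∨ (n = 2 ∧ m = 0 ∧ k = 2) ∨
    (n = 2 ∧ m = 0 ∧ k = 0)

/-- A short multicategory: objects and multimaps of arity at most four, with substitution of
binary multimaps into binary and ternary ones, of ternary multimaps into binary ones, and of nullary
multimaps into binary and ternary ones; unary multimaps can be substituted into everything and can
receive everything.

The unary multimaps form a category `C`.  Substitution of, and into, unary multimaps is the functor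
structure `Cₙ(-;-) : (Cⁿ)ᵒᵖ × C → Set` for `n ≤ 4`, with `C₁(-;-)` the hom-functor: functoriality
is given by the identity laws together with those cases of `assoc` and `comm` in which two of
the three multimaps are unary.  The cases of `assoc` in which `h`, `g` or `f` is unary say that
the substitutions are natural in `c`, dinatural in `bᵢ` and natural in `a₁, …, aₘ`, and the cases
of `comm` in which `g` or `f` is unary say that they are natural in `bⱼ` for `j ≠ i`.  The remaining
cases are the associativity and commutativity equations for `h` binary and `(g, f)` of
arities `(2,2)`, `(2,0)` (associativity), and `(2,2)`, `(2,0)`, `(0,2)`, `(0,0)` (commutativity). -/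
structure ShortMulticategory where
  Obj : Type u
  Hom (as : List Obj) (h : as.length ≤ 4) (b : Obj) : Type v
  id (a : Obj) : Hom [a] (by simp) a
  circ {bs as ds : List Obj} {b c : Obj} {lb : bs.length ≤ 4} {la : as.length ≤ 4}
    {ld : ds.length ≤ 4} (x y : List Obj) (hb : bs = x ++ b :: y) (hd : ds = x ++ (as ++ y))
    (ok : SubOK bs.length as.length) (g : Hom bs lb c) (f : Hom as la b) : Hom ds ld c
  id_circ {as : List Obj} {b : Obj} {la : as.length ≤ 4} (hd : as = [] ++ (as ++ []))
    (ok : SubOK 1 as.length) (f : Hom as la b) :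
    circ [] [] rfl hd ok (id b) f = f
  circ_id {bs : List Obj} {b c : Obj} {lb : bs.length ≤ 4} (x y : List Obj)
    (hb : bs = x ++ b :: y) (hd : bs = x ++ ([b] ++ y)) (ok : SubOK bs.length 1)
    (f : Hom bs lb c) :
    circ x y hb hd ok f (id b) = f
  assoc {cs bs as gs es ds : List Obj} {b c d : Obj}
    {lc : cs.length ≤ 4} {lb : bs.length ≤ 4} {la : as.length ≤ 4}
    {lg : gs.length ≤ 4} {le : es.length ≤ 4} {ld : ds.length ≤ 4} (x y x' y' : List Obj)
    (hc : cs = x ++ c :: y) (hb : bs = x' ++ b :: y')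
    (hg : gs = x' ++ (as ++ y')) (hd : ds = x ++ (gs ++ y))
    (he : es = x ++ (bs ++ y)) (he' : es = (x ++ x') ++ b :: (y' ++ y))
    (hd' : ds = (x ++ x') ++ (as ++ (y' ++ y)))
    (ok : AssocOK cs.length bs.length as.length)
    (ok₁ : SubOK cs.length gs.length) (ok₂ : SubOK bs.length as.length)
    (ok₃ : SubOK es.length as.length) (ok₄ : SubOK cs.length bs.length)
    (h : Hom cs lc d) (g : Hom bs lb c) (f : Hom as la b) :
    circ (ld := ld) x y hc hd ok₁ h (circ (ld := lg) x' y' hb hg ok₂ g f) =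
      circ (x ++ x') (y' ++ y) he' hd' ok₃ (circ (ld := le) x y hc he ok₄ h g) f
  comm {cs bs as es es' ds : List Obj} {b c d : Obj}
    {lc : cs.length ≤ 4} {lb : bs.length ≤ 4} {la : as.length ≤ 4}
    {le : es.length ≤ 4} {le' : es'.length ≤ 4} {ld : ds.length ≤ 4} (x y z : List Obj)
    (hc : cs = x ++ b :: (y ++ c :: z)) (hc' : cs = (x ++ b :: y) ++ c :: z)
    (he : es = x ++ (bs ++ (y ++ c :: z))) (he' : es = (x ++ (bs ++ y)) ++ c :: z)
    (hf : es' = (x ++ b :: y) ++ (as ++ z)) (hf' : es' = x ++ b :: (y ++ (as ++ z)))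
    (hd : ds = (x ++ (bs ++ y)) ++ (as ++ z)) (hd' : ds = x ++ (bs ++ (y ++ (as ++ z))))
    (ok : CommOK cs.length bs.length as.length)
    (ok₁ : SubOK es.length as.length) (ok₂ : SubOK cs.length bs.length)
    (ok₃ : SubOK es'.length bs.length) (ok₄ : SubOK cs.length as.length)
    (h : Hom cs lc d) (g : Hom bs lb b) (f : Hom as la c) :
    circ (ld := ld) (x ++ (bs ++ y)) z he' hd ok₁
        (circ (ld := le) x (y ++ c :: z) hc he ok₂ h g) f =
      circ x (y ++ (as ++ z)) hf' hd' ok₃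
        (circ (ld := le') (x ++ b :: y) z hc' hf ok₄ h f) g

namespace ShortMulticategory

/-- The underlying category of unary multimaps. -/
instance (C : ShortMulticategory.{v, u}) : Category.{v} C.Obj where
  Hom a b := C.Hom [a] (by simp) b
  id a := C.id a
  comp f g := C.circ [] [] rfl rfl (Or.inl rfl) g f
  id_comp f := C.circ_id [] [] rfl rfl (Or.inl rfl) f
  comp_id f := C.id_circ rfl (Or.inl rfl) f
  assoc f g h := C.assoc [] [] [] [] rfl rfl rfl rfl rfl rfl rfl (Or.inl rfl) (Or.inl rfl)
    (Or.inl rfl) (Or.inl rfl) (Or.inl rfl) h g f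

end ShortMulticategory

/-- A morphism of short multicategories. -/
structure ShortMultifunctor (C D : ShortMulticategory.{v, u}) where
  obj : C.Obj → D.Obj
  map {as : List C.Obj} {as' : List D.Obj} {b : C.Obj} {la : as.length ≤ 4} {la' : as'.length ≤ 4}
    (h : as' = as.map obj) (f : C.Hom as la b) : D.Hom as' la' (obj b)
  map_id (a : C.Obj) : map rfl (C.id a) = D.id (obj a)
  map_circ {bs as ds x y : List C.Obj} {bs' as' ds' x' y' : List D.Obj} {b c : C.Obj}
    {lb : bs.length ≤ 4} {la : as.length ≤ 4} {ld : ds.length ≤ 4}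
    {lb' : bs'.length ≤ 4} {la' : as'.length ≤ 4} {ld' : ds'.length ≤ 4}
    (hb : bs = x ++ b :: y) (hd : ds = x ++ (as ++ y))
    (ok : SubOK bs.length as.length) (ok' : SubOK bs'.length as'.length)
    (h₁ : bs' = bs.map obj) (h₂ : as' = as.map obj) (h₃ : ds' = ds.map obj)
    (hx : x' = x.map obj) (hy : y' = y.map obj)
    (hb' : bs' = x' ++ obj b :: y') (hd' : ds' = x' ++ (as' ++ y'))
    (g : C.Hom bs lb c) (f : C.Hom as la b) :
    map (la' := ld') h₃ (C.circ (ld := ld) x y hb hd ok g f) =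
      D.circ x' y' hb' hd' ok' (map (la' := lb') h₁ g) (map (la' := la') h₂ f)

namespace ShortMultifunctor

/-- Transport of a multimap along an equality of domains. -/
def recast {C : ShortMulticategory.{v, u}} {as as' : List C.Obj} {b : C.Obj}
    {la : as.length ≤ 4} {la' : as'.length ≤ 4} (h : as' = as) (f : C.Hom as la b) :
    C.Hom as' la' b := by
  subst h; exact f

/-- The identity morphism. -/
def id (C : ShortMulticategory.{v, u}) : ShortMultifunctor C C where
  obj a := a
  map h f := recast (map_self h) f
  map_id a := rfl
  map_circ hb hd ok ok' h₁ h₂ h₃ hx hy hb' hd' g f := by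
    obtain rfl := map_self h₁
    obtain rfl := map_self h₂
    obtain rfl := map_self h₃
    obtain rfl := map_self hx
    obtain rfl := map_self hy
    rfl

theorem map_map_length {A B : Type u} {F : A → B} {as : List A} (h : as.length ≤ 4) :
    (as.map F).length ≤ 4 := by simpa using h

/-- Composition of morphisms. -/
def comp {C D E : ShortMulticategory.{v, u}} (F : ShortMultifunctor C D)
    (G : ShortMultifunctor D E) : ShortMultifunctor C E where
  obj a := G.obj (F.obj a)
  map {_ _ _ la _} h f := G.map (map_map_eq h rfl) (F.map (la' := map_map_length la) rfl f)
  map_id a := by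
    rw [F.map_id]; exact G.map_id _
  map_circ hb hd ok ok' h₁ h₂ h₃ hx hy hb' hd' g f := by
    rw [F.map_circ hb hd ok (by simpa using ok) rfl rfl rfl rfl rfl (by simp [hb]) (by simp [hd])]
    exact G.map_circ _ _ _ _ _ _ _ (map_map_eq hx rfl) (map_map_eq hy rfl) _ _ _ _

@[ext]
theorem ext {C D : ShortMulticategory.{v, u}} {F G : ShortMultifunctor C D} (h : F.obj = G.obj)
    (h' : ∀ {as : List C.Obj} {as' : List D.Obj} {b : C.Obj} {la : as.length ≤ 4}
      {la' : as'.length ≤ 4} (e : as' = as.map F.obj) (e' : as' = as.map G.obj)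
      (f : C.Hom as la b), HEq (F.map (la' := la') e f) (G.map (la' := la') e' f)) : F = G := by
  obtain ⟨Fo, Fm, _, _⟩ := F
  obtain ⟨Go, Gm, _, _⟩ := G
  obtain rfl : Fo = Go := h
  congr
  funext as as' b la la' e f
  exact eq_of_heq (h' e e f)

theorem map_recast {C D : ShortMulticategory.{v, u}} (F : ShortMultifunctor C D)
    {as bs : List C.Obj} {as' : List D.Obj} {b : C.Obj} {la : as.length ≤ 4} {lb : bs.length ≤ 4}
    {la' : as'.length ≤ 4} (e : bs = as) (h : as' = bs.map F.obj) (h' : as' = as.map F.obj)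
    (f : C.Hom as la b) :
    F.map (la' := la') h (recast (la' := lb) e f) = F.map (la' := la') h' f := by
  subst e; rfl

theorem recast_map {C D : ShortMulticategory.{v, u}} (F : ShortMultifunctor C D)
    {as : List C.Obj} {as' bs' : List D.Obj} {b : C.Obj} {la : as.length ≤ 4}
    {la' : as'.length ≤ 4} {lb' : bs'.length ≤ 4} (e : bs' = as') (h : as' = as.map F.obj)
    (h' : bs' = as.map F.obj) (f : C.Hom as la b) :
    recast (la' := lb') e (F.map (la' := la') h f) = F.map (la' := lb') h' f := by
  subst e; rfl

theorem map_map {C D E : ShortMulticategory.{v, u}} (F : ShortMultifunctor C D)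
    (G : ShortMultifunctor D E) {as : List C.Obj} {bs cs : List D.Obj} {ds : List E.Obj}
    {b : C.Obj} {la : as.length ≤ 4} {lb : bs.length ≤ 4} {lc : cs.length ≤ 4}
    {ld : ds.length ≤ 4} (h : bs = as.map F.obj)
    (h' : cs = as.map F.obj) (k : ds = bs.map G.obj) (k' : ds = cs.map G.obj)
    (f : C.Hom as la b) :
    G.map (la' := ld) k (F.map (la' := lb) h f) = G.map (la' := ld) k' (F.map (la' := lc) h' f) := by
  subst h h'; rfl

end ShortMultifunctor

/-- The category of short multicategories. -/
instance : Category.{max u v} ShortMulticategory.{v, u} where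
  Hom := ShortMultifunctor
  id := ShortMultifunctor.id
  comp := ShortMultifunctor.comp
  id_comp F := ShortMultifunctor.ext rfl fun _ h f => heq_of_eq (F.map_recast (List.map_id' _) _ h f)
  comp_id F := ShortMultifunctor.ext rfl fun _ h f => heq_of_eq (F.recast_map h _ h f)
  assoc F G H := ShortMultifunctor.ext rfl
    fun _ _ f => heq_of_eq (ShortMultifunctor.map_map G H _ _ _ _ _)

/-- The forgetful functor from multicategories to short multicategories. -/
def forgetShort : Multicategory.{v, u} ⥤ ShortMulticategory.{v, u} where
  obj M :=
    { Obj := M.Obj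
      Hom := fun as _ b => M.Hom as b
      id := M.id
      circ := fun x y hb hd _ g f => M.circ x y hb hd g f
      id_circ := fun hd _ f => M.id_circ hd f
      circ_id := fun x y hb hd _ f => M.circ_id x y hb hd f
      assoc := fun x y x' y' hc hb hg hd he he' hd' _ _ _ _ _ h g f =>
        M.assoc x y x' y' hc hb hg hd he he' hd' h g f
      comm := fun x y z hc hc' he he' hf hf' hd hd' _ _ _ _ _ h g f =>
        M.comm x y z hc hc' he he' hf hf' hd hd' h g f }
  map {M N} F :=
    { obj := Multifunctor.obj F
      map := fun h f => Multifunctor.map F h f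
      map_id := Multifunctor.map_id F
      map_circ := fun hb hd _ _ h₁ h₂ h₃ hx hy hb' hd' g f =>
        Multifunctor.map_circ F hb hd h₁ h₂ h₃ hx hy hb' hd' g f }
  map_id M := ShortMultifunctor.ext rfl fun e _ f => by
    obtain rfl := map_self e
    rfl
  map_comp F G := rfl

/-! ## Skew monoidal categories and monoidal categories -/

/-- A (left) skew monoidal category. -/
structure SkewMonoidalCategory where
  Obj : Type u
  [category : Category.{v} Obj]
  tensorObj : Obj → Obj → Obj
  tensorHom {a b c d : Obj} (f : a ⟶ b) (g : c ⟶ d) : tensorObj a c ⟶ tensorObj b d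
  tensor_id (a b : Obj) : tensorHom (𝟙 a) (𝟙 b) = 𝟙 (tensorObj a b)
  tensor_comp {a b c a' b' c' : Obj} (f : a ⟶ b) (g : b ⟶ c) (f' : a' ⟶ b') (g' : b' ⟶ c') :
    tensorHom (f ≫ g) (f' ≫ g') = tensorHom f f' ≫ tensorHom g g'
  unit : Obj
  α (a b c : Obj) : tensorObj (tensorObj a b) c ⟶ tensorObj a (tensorObj b c)
  lam (a : Obj) : tensorObj unit a ⟶ a
  rho (a : Obj) : a ⟶ tensorObj a unit
  α_naturality {a b c a' b' c' : Obj} (f : a ⟶ a') (g : b ⟶ b') (h : c ⟶ c') :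
    tensorHom (tensorHom f g) h ≫ α a' b' c' = α a b c ≫ tensorHom f (tensorHom g h)
  lam_naturality {a b : Obj} (f : a ⟶ b) : tensorHom (𝟙 unit) f ≫ lam b = lam a ≫ f
  rho_naturality {a b : Obj} (f : a ⟶ b) : f ≫ rho b = rho a ≫ tensorHom f (𝟙 unit)
  pentagon (a b c d : Obj) :
    tensorHom (α a b c) (𝟙 d) ≫ α a (tensorObj b c) d ≫ tensorHom (𝟙 a) (α b c d) =
      α (tensorObj a b) c d ≫ α a b (tensorObj c d)
  lam_tensor (a b : Obj) : α unit a b ≫ lam (tensorObj a b) = tensorHom (lam a) (𝟙 b)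
  rho_tensor (a b : Obj) : rho (tensorObj a b) ≫ α a b unit = tensorHom (𝟙 a) (rho b)
  triangle (a b : Obj) :
    tensorHom (rho a) (𝟙 b) ≫ α a unit b ≫ tensorHom (𝟙 a) (lam b) = 𝟙 (tensorObj a b)
  rho_lam : rho unit ≫ lam unit = 𝟙 unit

attribute [instance] SkewMonoidalCategory.category

/-- A lax monoidal functor between skew monoidal categories. -/
structure SkewLaxFunctor (C D : SkewMonoidalCategory.{v, u}) where
  functor : C.Obj ⥤ D.Obj
  f₀ : D.unit ⟶ functor.obj C.unit
  f₂ (a b : C.Obj) :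
    D.tensorObj (functor.obj a) (functor.obj b) ⟶ functor.obj (C.tensorObj a b)
  f₂_naturality {a b a' b' : C.Obj} (f : a ⟶ a') (g : b ⟶ b') :
    D.tensorHom (functor.map f) (functor.map g) ≫ f₂ a' b' =
      f₂ a b ≫ functor.map (C.tensorHom f g)
  associativity (a b c : C.Obj) :
    D.tensorHom (f₂ a b) (𝟙 (functor.obj c)) ≫ f₂ (C.tensorObj a b) c ≫ functor.map (C.α a b c) =
      D.α (functor.obj a) (functor.obj b) (functor.obj c) ≫
        D.tensorHom (𝟙 (functor.obj a)) (f₂ b c) ≫ f₂ a (C.tensorObj b c)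
  left_unitality (a : C.Obj) :
    D.tensorHom f₀ (𝟙 (functor.obj a)) ≫ f₂ C.unit a ≫ functor.map (C.lam a) =
      D.lam (functor.obj a)
  right_unitality (a : C.Obj) :
    D.rho (functor.obj a) ≫ D.tensorHom (𝟙 (functor.obj a)) f₀ ≫ f₂ a C.unit =
      functor.map (C.rho a)

namespace SkewLaxFunctor

@[ext]
theorem ext {C D : SkewMonoidalCategory.{v, u}} {F G : SkewLaxFunctor C D}
    (h : F.functor = G.functor) (h₀ : HEq F.f₀ G.f₀) (h₂ : HEq F.f₂ G.f₂) : F = G := by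
  cases F; cases G
  subst h
  obtain rfl := eq_of_heq h₀
  obtain rfl := eq_of_heq h₂
  rfl

/-- The identity lax monoidal functor. -/
def id (C : SkewMonoidalCategory.{v, u}) : SkewLaxFunctor C C where
  functor := 𝟭 C.Obj
  f₀ := 𝟙 _
  f₂ _ _ := 𝟙 _
  f₂_naturality f g := by simp
  associativity a b c := by simp [C.tensor_id]
  left_unitality a := by simp [C.tensor_id]
  right_unitality a := by simp [C.tensor_id]

/-- Composition of lax monoidal functors. -/
def comp {C D E : SkewMonoidalCategory.{v, u}} (F : SkewLaxFunctor C D) (G : SkewLaxFunctor D E) :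
    SkewLaxFunctor C E where
  functor := F.functor ⋙ G.functor
  f₀ := G.f₀ ≫ G.functor.map F.f₀
  f₂ a b := G.f₂ (F.functor.obj a) (F.functor.obj b) ≫ G.functor.map (F.f₂ a b)
  f₂_naturality f g := by
    simp only [Functor.comp_map]
    rw [← Category.assoc, G.f₂_naturality, Category.assoc, Category.assoc, ← G.functor.map_comp,
      F.f₂_naturality, G.functor.map_comp]
  associativity a b c := by
    have nl : E.tensorHom (G.functor.map (F.f₂ a b)) (𝟙 (G.functor.obj (F.functor.obj c))) ≫
        G.f₂ _ _ = G.f₂ _ _ ≫ G.functor.map (D.tensorHom (F.f₂ a b) (𝟙 _)) := by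
      rw [← G.f₂_naturality, G.functor.map_id]
    have nr : E.tensorHom (𝟙 (G.functor.obj (F.functor.obj a))) (G.functor.map (F.f₂ b c)) ≫
        G.f₂ _ _ = G.f₂ _ _ ≫ G.functor.map (D.tensorHom (𝟙 _) (F.f₂ b c)) := by
      rw [← G.f₂_naturality, G.functor.map_id]
    simp only [Functor.comp_map, Functor.comp_obj]
    rw [← Category.id_comp (𝟙 (G.functor.obj (F.functor.obj c))), E.tensor_comp,
      ← Category.id_comp (𝟙 (G.functor.obj (F.functor.obj a))), E.tensor_comp]
    simp only [Category.assoc]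
    rw [reassoc_of% nl, reassoc_of% nr]
    simp only [← G.functor.map_comp]
    rw [F.associativity]
    simp only [G.functor.map_comp]
    rw [reassoc_of% (G.associativity (F.functor.obj a) (F.functor.obj b) (F.functor.obj c))]
  left_unitality a := by
    have nl : E.tensorHom (G.functor.map F.f₀) (𝟙 (G.functor.obj (F.functor.obj a))) ≫
        G.f₂ _ _ = G.f₂ _ _ ≫ G.functor.map (D.tensorHom F.f₀ (𝟙 _)) := by
      rw [← G.f₂_naturality, G.functor.map_id]
    simp only [Functor.comp_map, Functor.comp_obj]
    rw [← Category.id_comp (𝟙 (G.functor.obj (F.functor.obj a))), E.tensor_comp]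
    simp only [Category.assoc]
    rw [reassoc_of% nl]
    simp only [← G.functor.map_comp]
    rw [F.left_unitality, G.left_unitality]
  right_unitality a := by
    have nr : E.tensorHom (𝟙 (G.functor.obj (F.functor.obj a))) (G.functor.map F.f₀) ≫
        G.f₂ _ _ = G.f₂ _ _ ≫ G.functor.map (D.tensorHom (𝟙 _) F.f₀) := by
      rw [← G.f₂_naturality, G.functor.map_id]
    simp only [Functor.comp_map, Functor.comp_obj]
    rw [← Category.id_comp (𝟙 (G.functor.obj (F.functor.obj a))), E.tensor_comp]
    simp only [Category.assoc]
    rw [reassoc_of% nr, ← F.right_unitality, G.functor.map_comp, G.functor.map_comp,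
      ← G.right_unitality]
    simp only [Category.assoc]

end SkewLaxFunctor

/-- The category of skew monoidal categories and lax monoidal functors. -/
instance : Category.{max u v} SkewMonoidalCategory.{v, u} where
  Hom := SkewLaxFunctor
  id := SkewLaxFunctor.id
  comp := SkewLaxFunctor.comp
  id_comp F := by
    refine SkewLaxFunctor.ext rfl (heq_of_eq ?_) (heq_of_eq ?_)
    · simp [SkewLaxFunctor.comp, SkewLaxFunctor.id]
    · funext a b; simp [SkewLaxFunctor.comp, SkewLaxFunctor.id]
  comp_id F := by
    refine SkewLaxFunctor.ext rfl (heq_of_eq ?_) (heq_of_eq ?_)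
    · simp [SkewLaxFunctor.comp, SkewLaxFunctor.id]
    · funext a b; simp [SkewLaxFunctor.comp, SkewLaxFunctor.id]
  assoc F G H := by
    refine SkewLaxFunctor.ext rfl (heq_of_eq ?_) (heq_of_eq ?_)
    · simp [SkewLaxFunctor.comp]
    · funext a b; simp [SkewLaxFunctor.comp]

/-- A skew monoidal category is left normal if its left unit map is invertible. -/
def leftNormal : ObjectProperty SkewMonoidalCategory.{v, u} := fun C => ∀ a, IsIso (C.lam a)

/-- The category of left normal skew monoidal categories and lax monoidal functors. -/
abbrev SkewMonLN := (leftNormal.{v, u}).FullSubcategory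

open MonoidalCategory

/-- A (bundled) monoidal category. -/
structure MonoidalCat where
  Obj : Type u
  [category : Category.{v} Obj]
  [monoidal : MonoidalCategory Obj]

attribute [instance] MonoidalCat.category MonoidalCat.monoidal

open Functor.LaxMonoidal

theorem laxMonoidalFunctor_ext {C D : Type u} [Category.{v} C] [Category.{v} D]
    [MonoidalCategory C] [MonoidalCategory D] {F G : LaxMonoidalFunctor C D}
    (h : F.toFunctor = G.toFunctor) (h₀ : HEq (ε F.toFunctor) (ε G.toFunctor))
    (h₂ : HEq (μ F.toFunctor) (μ G.toFunctor)) : F = G := by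
  obtain ⟨F, hF⟩ := F
  obtain ⟨G, hG⟩ := G
  obtain rfl : F = G := h
  congr
  cases hF; cases hG
  obtain rfl := eq_of_heq h₀
  obtain rfl := eq_of_heq h₂
  rfl

/-- The category of monoidal categories and lax monoidal functors. -/
instance : Category.{max u v} MonoidalCat.{v, u} where
  Hom C D := LaxMonoidalFunctor C.Obj D.Obj
  id C := LaxMonoidalFunctor.of (𝟭 C.Obj)
  comp F G := LaxMonoidalFunctor.of (F.toFunctor ⋙ G.toFunctor)
  id_comp {C D} F := by
    refine laxMonoidalFunctor_ext rfl (heq_of_eq ?_) (heq_of_eq ?_)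
    · change ε (𝟭 C.Obj ⋙ F.toFunctor) = _
      rw [comp_ε, id_ε, F.toFunctor.map_id]; exact Category.comp_id _
    · funext a b
      change μ (𝟭 C.Obj ⋙ F.toFunctor) a b = _
      rw [comp_μ, id_μ, F.toFunctor.map_id]; exact Category.comp_id _
  comp_id {C D} F := by
    refine laxMonoidalFunctor_ext rfl (heq_of_eq ?_) (heq_of_eq ?_)
    · change ε (F.toFunctor ⋙ 𝟭 D.Obj) = _
      rw [comp_ε, id_ε]; exact Category.id_comp _
    · funext a b
      change μ (F.toFunctor ⋙ 𝟭 D.Obj) a b = _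
      rw [comp_μ, id_μ]; exact Category.id_comp _
  assoc F G H := by
    refine laxMonoidalFunctor_ext rfl (heq_of_eq ?_) (heq_of_eq ?_)
    · change ε ((F.toFunctor ⋙ G.toFunctor) ⋙ H.toFunctor) =
        ε (F.toFunctor ⋙ (G.toFunctor ⋙ H.toFunctor))
      simp only [comp_ε, Functor.map_comp, Category.assoc, Functor.comp_map]
    · funext a b
      change μ ((F.toFunctor ⋙ G.toFunctor) ⋙ H.toFunctor) a b =
        μ (F.toFunctor ⋙ (G.toFunctor ⋙ H.toFunctor)) a b
      simp only [comp_μ, Functor.map_comp, Category.assoc, Functor.comp_map, Functor.comp_obj]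

/-- A monoidal category, as a left normal skew monoidal category. -/
def MonoidalCat.toSkew (C : MonoidalCat.{v, u}) : SkewMonoidalCategory.{v, u} where
  Obj := C.Obj
  tensorObj a b := a ⊗ b
  tensorHom f g := f ⊗ₘ g
  tensor_id a b := by simp
  tensor_comp f g f' g' := by simp
  unit := 𝟙_ C.Obj
  α a b c := (α_ a b c).hom
  lam a := (λ_ a).hom
  rho a := (ρ_ a).inv
  α_naturality f g h := MonoidalCategory.associator_naturality f g h
  lam_naturality f := by simp
  rho_naturality f := by simp
  pentagon a b c d := by simp
  lam_tensor a b := by simp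
  rho_tensor a b := by simp
  triangle a b := by simp
  rho_lam := by simp [MonoidalCategory.unitors_equal]

/-- A lax monoidal functor between monoidal categories, as one between skew monoidal categories. -/
def laxToSkew {C D : MonoidalCat.{v, u}} (F : LaxMonoidalFunctor C.Obj D.Obj) :
    SkewLaxFunctor C.toSkew D.toSkew where
  functor := F.toFunctor
  f₀ := ε F.toFunctor
  f₂ := μ F.toFunctor
  f₂_naturality f g := μ_natural (C := C.Obj) (D := D.Obj) F.toFunctor f g
  associativity a b c := by
    have := associativity F.toFunctor a b c
    rw [← MonoidalCategory.tensorHom_id, ← MonoidalCategory.id_tensorHom] at this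
    exact this
  left_unitality a := by
    have := (left_unitality F.toFunctor a).symm
    rw [← MonoidalCategory.tensorHom_id] at this
    exact this
  right_unitality a := by
    have := right_unitality_inv F.toFunctor a
    rw [← MonoidalCategory.id_tensorHom] at this
    exact this

/-- The inclusion of monoidal categories into left normal skew monoidal categories. -/
def monoidalInclusion : MonoidalCat.{v, u} ⥤ SkewMonLN.{v, u} where
  obj C := ⟨C.toSkew, fun a => (leftUnitor (C := C.Obj) a).isIso_hom⟩
  map F := ObjectProperty.homMk (laxToSkew F)
  map_id C := rfl
  map_comp F G := rfl

/-- A skew monoidal category with invertible `α`, `λ` and `ρ` is a monoidal category. -/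
noncomputable abbrev SkewMonoidalCategory.toMonoidal (C : SkewMonoidalCategory.{v, u})
    (hα : ∀ a b c, IsIso (C.α a b c)) (hl : ∀ a, IsIso (C.lam a)) (hr : ∀ a, IsIso (C.rho a)) :
    MonoidalCategory C.Obj where
  tensorObj := C.tensorObj
  tensorHom := C.tensorHom
  whiskerLeft a _ _ f := C.tensorHom (𝟙 a) f
  whiskerRight f a := C.tensorHom f (𝟙 a)
  tensorUnit := C.unit
  associator a b c := asIso (C.α a b c)
  leftUnitor a := asIso (C.lam a)
  rightUnitor a := (asIso (C.rho a)).symm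
  tensorHom_def f g := by rw [← C.tensor_comp]; simp
  id_tensorHom_id := C.tensor_id
  tensorHom_comp_tensorHom f g f' g' := (C.tensor_comp _ _ _ _).symm
  whiskerLeft_id := C.tensor_id
  id_whiskerRight := C.tensor_id
  associator_naturality := C.α_naturality
  leftUnitor_naturality := C.lam_naturality
  rightUnitor_naturality {a b} f := by
    change C.tensorHom f (𝟙 C.unit) ≫ inv (C.rho b) = inv (C.rho a) ≫ f
    rw [IsIso.comp_inv_eq, Category.assoc, IsIso.eq_inv_comp, C.rho_naturality]
  pentagon := C.pentagon
  triangle a b := by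
    change C.α a C.unit b ≫ C.tensorHom (𝟙 a) (C.lam b) = C.tensorHom (inv (C.rho a)) (𝟙 b)
    have h : C.tensorHom (inv (C.rho a)) (𝟙 b) ≫ C.tensorHom (C.rho a) (𝟙 b) = 𝟙 _ := by
      rw [← C.tensor_comp]; simp [C.tensor_id]
    rw [← Category.comp_id (C.tensorHom (inv (C.rho a)) (𝟙 b)), ← C.triangle a b,
      ← Category.assoc, h, Category.id_comp]

namespace SkewLaxFunctor

variable {C D : SkewMonoidalCategory.{v, u}} (F : SkewLaxFunctor C D)

theorem naturality_left {a b : C.Obj} (f : a ⟶ b) (c : C.Obj) :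
    D.tensorHom (F.functor.map f) (𝟙 (F.functor.obj c)) ≫ F.f₂ b c =
      F.f₂ a c ≫ F.functor.map (C.tensorHom f (𝟙 c)) := by
  rw [← F.f₂_naturality, F.functor.map_id]

theorem naturality_right (c : C.Obj) {a b : C.Obj} (f : a ⟶ b) :
    D.tensorHom (𝟙 (F.functor.obj c)) (F.functor.map f) ≫ F.f₂ c b =
      F.f₂ c a ≫ F.functor.map (C.tensorHom (𝟙 c) f) := by
  rw [← F.f₂_naturality, F.functor.map_id]

theorem right_unitality_inv (hr : ∀ a, IsIso (C.rho a)) (kr : ∀ a, IsIso (D.rho a)) (a : C.Obj) :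
    inv (D.rho (F.functor.obj a)) = D.tensorHom (𝟙 _) F.f₀ ≫ F.f₂ a C.unit ≫
      F.functor.map (inv (C.rho a)) := by
  rw [← Category.assoc, Functor.map_inv, IsIso.eq_comp_inv, IsIso.inv_comp_eq, F.right_unitality]

/-- A lax monoidal functor between skew monoidal categories with invertible `α`, `λ` and `ρ` is
a lax monoidal functor between monoidal categories. -/
noncomputable def toMonoidal
    (hα : ∀ a b c, IsIso (C.α a b c)) (hl : ∀ a, IsIso (C.lam a)) (hr : ∀ a, IsIso (C.rho a))
    (kα : ∀ a b c, IsIso (D.α a b c)) (kl : ∀ a, IsIso (D.lam a)) (kr : ∀ a, IsIso (D.rho a)) :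
    letI := C.toMonoidal hα hl hr
    letI := D.toMonoidal kα kl kr
    LaxMonoidalFunctor C.Obj D.Obj :=
  letI := C.toMonoidal hα hl hr
  letI := D.toMonoidal kα kl kr
  { toFunctor := F.functor
    laxMonoidal :=
      { ε := F.f₀
        μ := F.f₂
        μ_natural_left := F.naturality_left
        μ_natural_right := fun c f => F.naturality_right c f
        associativity := F.associativity
        left_unitality := fun a => (F.left_unitality a).symm
        right_unitality := F.right_unitality_inv hr kr } }

end SkewLaxFunctor

/-! ## Substitution into, and of, multimaps of given arity in a short multicategory -/

namespace ShortMulticategory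

theorem length_append_le {A : Type u} {x y as : List A} (h : x.length + y.length ≤ 2)
    (h' : as.length ≤ 2) : (x ++ (as ++ y)).length ≤ 4 := by
  simp only [List.length_append]; omega

theorem length_cons_le {A : Type u} {x y : List A} (h : x.length + y.length ≤ 2) (m : A) :
    (x ++ m :: y).length ≤ 4 := by
  simp only [List.length_append, List.length_cons]; omega

theorem subOK_two {A : Type u} {x y : List A} (h : x.length + y.length ≤ 2) (m : A) :
    SubOK (x ++ m :: y).length 2 := by
  unfold SubOK
  rw [List.length_append, List.length_cons]
  omega

theorem subOK_zero {A : Type u} {x y : List A} (h : x.length + y.length ≤ 2) (m : A) :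
    SubOK (x ++ m :: y).length 0 := by
  unfold SubOK
  rw [List.length_append, List.length_cons]
  omega

variable (C : ShortMulticategory.{v, u})

/-- Nullary multimaps. -/
abbrev H₀ (z : C.Obj) := C.Hom [] (by simp) z

/-- Binary multimaps. -/
abbrev H₂ (a b z : C.Obj) := C.Hom [a, b] (by simp) z

/-- Ternary multimaps. -/
abbrev H₃ (a b c z : C.Obj) := C.Hom [a, b, c] (by simp) z

/-- Multimaps of arity four. -/
abbrev H₄ (a b c d z : C.Obj) := C.Hom [a, b, c, d] (by simp) z

variable {C}

/-- `q ∘ f` for unary `q`. -/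
def post {as : List C.Obj} {la : as.length ≤ 4} {y z : C.Obj} (q : y ⟶ z) (f : C.Hom as la y) :
    C.Hom as la z :=
  C.circ [] [] rfl (List.append_nil as).symm (Or.inl rfl) q f

/-- `f ∘₁ p` for `f` binary and `p` unary. -/
def p21 {a a' b z : C.Obj} (f : C.H₂ a b z) (p : a' ⟶ a) : C.H₂ a' b z :=
  C.circ [] [b] rfl rfl (Or.inr (Or.inl rfl)) f p

/-- `f ∘₂ p` for `f` binary and `p` unary. -/
def p22 {a b b' z : C.Obj} (f : C.H₂ a b z) (p : b' ⟶ b) : C.H₂ a b' z :=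
  C.circ [a] [] rfl rfl (Or.inr (Or.inl rfl)) f p

/-- `f ∘₁ p` for `f` ternary and `p` unary. -/
def p31 {a a' b c z : C.Obj} (f : C.H₃ a b c z) (p : a' ⟶ a) : C.H₃ a' b c z :=
  C.circ [] [b, c] rfl rfl (Or.inr (Or.inl rfl)) f p

/-- `f ∘₂ p` for `f` ternary and `p` unary. -/
def p32 {a b b' c z : C.Obj} (f : C.H₃ a b c z) (p : b' ⟶ b) : C.H₃ a b' c z :=
  C.circ [a] [c] rfl rfl (Or.inr (Or.inl rfl)) f p

/-- `f ∘₃ p` for `f` ternary and `p` unary. -/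
def p33 {a b c c' z : C.Obj} (f : C.H₃ a b c z) (p : c' ⟶ c) : C.H₃ a b c' z :=
  C.circ [a, b] [] rfl rfl (Or.inr (Or.inl rfl)) f p

/-- `f ∘₁ g` for `f` and `g` binary. -/
def b21 {a₁ a₂ m b z : C.Obj} (f : C.H₂ m b z) (g : C.H₂ a₁ a₂ m) : C.H₃ a₁ a₂ b z :=
  C.circ [] [b] rfl rfl (by simp [SubOK]) f g

/-- `f ∘₂ g` for `f` and `g` binary. -/
def b22 {a b₁ b₂ m z : C.Obj} (f : C.H₂ a m z) (g : C.H₂ b₁ b₂ m) : C.H₃ a b₁ b₂ z :=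
  C.circ [a] [] rfl rfl (by simp [SubOK]) f g

/-- `f ∘₁ g` for `f` ternary and `g` binary. -/
def b31 {a₁ a₂ m b c z : C.Obj} (f : C.H₃ m b c z) (g : C.H₂ a₁ a₂ m) : C.H₄ a₁ a₂ b c z :=
  C.circ [] [b, c] rfl rfl (by simp [SubOK]) f g

/-- `f ∘₂ g` for `f` ternary and `g` binary. -/
def b32 {a b₁ b₂ m c z : C.Obj} (f : C.H₃ a m c z) (g : C.H₂ b₁ b₂ m) : C.H₄ a b₁ b₂ c z :=
  C.circ [a] [c] rfl rfl (by simp [SubOK]) f g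

/-- `f ∘₃ g` for `f` ternary and `g` binary. -/
def b33 {a b c₁ c₂ m z : C.Obj} (f : C.H₃ a b m z) (g : C.H₂ c₁ c₂ m) : C.H₄ a b c₁ c₂ z :=
  C.circ [a, b] [] rfl rfl (by simp [SubOK]) f g

/-- `f ∘₁ g` for `f` binary and `g` ternary. -/
def t21 {a₁ a₂ a₃ m b z : C.Obj} (f : C.H₂ m b z) (g : C.H₃ a₁ a₂ a₃ m) : C.H₄ a₁ a₂ a₃ b z :=
  C.circ [] [b] rfl rfl (by simp [SubOK]) f g

/-- `f ∘₂ g` for `f` binary and `g` ternary. -/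
def t22 {a b₁ b₂ b₃ m z : C.Obj} (f : C.H₂ a m z) (g : C.H₃ b₁ b₂ b₃ m) : C.H₄ a b₁ b₂ b₃ z :=
  C.circ [a] [] rfl rfl (by simp [SubOK]) f g

/-- `f ∘₁ w` for `f` binary and `w` nullary. -/
def n21 {m b z : C.Obj} (f : C.H₂ m b z) (w : C.H₀ m) : b ⟶ z :=
  C.circ [] [b] rfl rfl (by simp [SubOK]) f w

/-- `f ∘₂ w` for `f` binary and `w` nullary. -/
def n22 {a m z : C.Obj} (f : C.H₂ a m z) (w : C.H₀ m) : a ⟶ z :=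
  C.circ [a] [] rfl rfl (by simp [SubOK]) f w

/-- `f ∘₁ w` for `f` ternary and `w` nullary. -/
def n31 {m b c z : C.Obj} (f : C.H₃ m b c z) (w : C.H₀ m) : C.H₂ b c z :=
  C.circ [] [b, c] rfl rfl (by simp [SubOK]) f w

/-- `f ∘₂ w` for `f` ternary and `w` nullary. -/
def n32 {a m c z : C.Obj} (f : C.H₃ a m c z) (w : C.H₀ m) : C.H₂ a c z :=
  C.circ [a] [c] rfl rfl (by simp [SubOK]) f w

/-- `f ∘₃ w` for `f` ternary and `w` nullary. -/
def n33 {a b m z : C.Obj} (f : C.H₃ a b m z) (w : C.H₀ m) : C.H₂ a b z :=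
  C.circ [a, b] [] rfl rfl (by simp [SubOK]) f w

theorem post_id {as : List C.Obj} {la : as.length ≤ 4} {y : C.Obj} (f : C.Hom as la y) :
    post (𝟙 y) f = f :=
  C.id_circ _ _ f

theorem post_comp {as : List C.Obj} {la : as.length ≤ 4} {x y z : C.Obj} (q : x ⟶ y) (r : y ⟶ z)
    (f : C.Hom as la x) : post (q ≫ r) f = post r (post q f) :=
  (C.assoc [] [] [] [] rfl rfl (by simp) (by simp) rfl rfl (by simp) (Or.inl rfl) (Or.inl rfl)
    (Or.inl rfl) (Or.inl rfl) (Or.inl rfl) r q f).symm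

section laws

variable {a a' a₁ a₂ b b' b₁ b₂ c c' d m m' n x z z' : C.Obj}

theorem p21_id (f : C.H₂ a b z) : p21 f (𝟙 a) = f := C.circ_id [] [b] rfl rfl _ f
theorem p22_id (f : C.H₂ a b z) : p22 f (𝟙 b) = f := C.circ_id [a] [] rfl rfl _ f

local notation "A₁" => Or.inl rfl
local notation "A₂" => Or.inr (Or.inl rfl)
local notation "A₃" => Or.inr (Or.inr (Or.inl rfl))

theorem p21_comp (f : C.H₂ a b z) (p : a' ⟶ a) (p' : a₁ ⟶ a') :
    p21 f (p' ≫ p) = p21 (p21 f p) p' :=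
  C.assoc [] [b] [] [] rfl rfl rfl rfl rfl rfl rfl A₂ A₂ A₁ A₂ A₂ f p p'

theorem p22_comp (f : C.H₂ a b z) (p : b' ⟶ b) (p' : b₁ ⟶ b') :
    p22 f (p' ≫ p) = p22 (p22 f p) p' :=
  C.assoc [a] [] [] [] rfl rfl rfl rfl rfl rfl rfl A₂ A₂ A₁ A₂ A₂ f p p'

theorem p22_p21 (f : C.H₂ a b z) (p : a' ⟶ a) (q : b' ⟶ b) :
    p22 (p21 f p) q = p21 (p22 f q) p :=
  C.comm [] [] [] rfl rfl rfl rfl rfl rfl rfl rfl A₁ A₂ A₂ A₂ A₂ f p q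

theorem post_p21 (q : z ⟶ z') (f : C.H₂ a b z) (p : a' ⟶ a) :
    post q (p21 f p) = p21 (post q f) p :=
  C.assoc [] [] [] [b] rfl rfl rfl rfl rfl rfl rfl A₁ A₁ A₂ A₂ A₁ q f p

theorem post_p22 (q : z ⟶ z') (f : C.H₂ a b z) (p : b' ⟶ b) :
    post q (p22 f p) = p22 (post q f) p :=
  C.assoc [] [] [a] [] rfl rfl rfl rfl rfl rfl rfl A₁ A₁ A₂ A₂ A₁ q f p

theorem post_b21 (q : z ⟶ z') (f : C.H₂ m b z) (g : C.H₂ a₁ a₂ m) :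
    post q (b21 f g) = b21 (post q f) g :=
  C.assoc [] [] [] [b] rfl rfl rfl rfl rfl rfl rfl A₁ A₁ _ _ A₁ q f g

theorem post_b22 (q : z ⟶ z') (f : C.H₂ a m z) (g : C.H₂ b₁ b₂ m) :
    post q (b22 f g) = b22 (post q f) g :=
  C.assoc [] [] [a] [] rfl rfl rfl rfl rfl rfl rfl A₁ A₁ _ _ A₁ q f g

theorem b21_p21 (f : C.H₂ m b z) (p : m' ⟶ m) (g : C.H₂ a₁ a₂ m') :
    b21 (p21 f p) g = b21 f (post p g) :=
  (C.assoc [] [b] [] [] rfl rfl rfl rfl rfl rfl rfl A₂ (by simp [SubOK]) A₁ (by simp [SubOK])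
    A₂ f p g).symm

theorem b22_p22 (f : C.H₂ a m z) (p : m' ⟶ m) (g : C.H₂ b₁ b₂ m') :
    b22 (p22 f p) g = b22 f (post p g) :=
  (C.assoc [a] [] [] [] rfl rfl rfl rfl rfl rfl rfl A₂ (by simp [SubOK]) A₁ (by simp [SubOK])
    A₂ f p g).symm

theorem b21_p22 (f : C.H₂ m b z) (p : b' ⟶ b) (g : C.H₂ a₁ a₂ m) :
    b21 (p22 f p) g = p33 (b21 f g) p :=
  (C.comm [] [] [] rfl rfl rfl rfl rfl rfl rfl rfl A₂ A₂ (by simp [SubOK]) (by simp [SubOK])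
    A₂ f g p).symm

theorem b22_p21 (f : C.H₂ a m z) (p : a' ⟶ a) (g : C.H₂ b₁ b₂ m) :
    b22 (p21 f p) g = p31 (b22 f g) p :=
  C.comm [] [] [] rfl rfl rfl rfl rfl rfl rfl rfl A₁ (by simp [SubOK]) A₂ A₂
    (by simp [SubOK]) f p g

theorem b21_of_p21 (f : C.H₂ m b z) (g : C.H₂ a₁ a₂ m) (p : a ⟶ a₁) :
    b21 f (p21 g p) = p31 (b21 f g) p :=
  C.assoc [] [b] [] [a₂] rfl rfl rfl rfl rfl rfl rfl A₃ (by simp [SubOK]) A₂ A₂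
    (by simp [SubOK]) f g p

theorem b21_of_p22 (f : C.H₂ m b z) (g : C.H₂ a₁ a₂ m) (p : a ⟶ a₂) :
    b21 f (p22 g p) = p32 (b21 f g) p :=
  C.assoc [] [b] [a₁] [] rfl rfl rfl rfl rfl rfl rfl A₃ (by simp [SubOK]) A₂ A₂
    (by simp [SubOK]) f g p

theorem b22_of_p21 (f : C.H₂ a m z) (g : C.H₂ b₁ b₂ m) (p : b ⟶ b₁) :
    b22 f (p21 g p) = p32 (b22 f g) p :=
  C.assoc [a] [] [] [b₂] rfl rfl rfl rfl rfl rfl rfl A₃ (by simp [SubOK]) A₂ A₂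
    (by simp [SubOK]) f g p

theorem b22_of_p22 (f : C.H₂ a m z) (g : C.H₂ b₁ b₂ m) (p : b ⟶ b₂) :
    b22 f (p22 g p) = p33 (b22 f g) p :=
  C.assoc [a] [] [b₁] [] rfl rfl rfl rfl rfl rfl rfl A₃ (by simp [SubOK]) A₂ A₂
    (by simp [SubOK]) f g p

theorem n21_post (q : z ⟶ z') (f : C.H₂ m b z) (w : C.H₀ m) :
    n21 (post q f) w = n21 f w ≫ q :=
  (C.assoc [] [] [] [b] rfl rfl rfl rfl rfl rfl rfl A₁ A₁ (by simp [SubOK]) (by simp [SubOK]) A₁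
    q f w).symm

theorem n22_comp (q : z ⟶ z') (f : C.H₂ a m z) (w : C.H₀ m) :
    n22 f w ≫ q = n22 (post q f) w :=
  C.assoc [] [] [a] [] rfl rfl rfl rfl rfl rfl rfl A₁ A₁ (by simp [SubOK]) (by simp [SubOK]) A₁
    q f w

theorem n21_p21 (f : C.H₂ m b z) (p : m' ⟶ m) (w : C.H₀ m') :
    n21 (p21 f p) w = n21 f (post p w) :=
  (C.assoc [] [b] [] [] rfl rfl rfl rfl rfl rfl rfl A₂ (by simp [SubOK]) A₁ (by simp [SubOK])
    A₂ f p w).symm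

theorem n22_p22 (f : C.H₂ a m z) (p : m' ⟶ m) (w : C.H₀ m') :
    n22 (p22 f p) w = n22 f (post p w) :=
  (C.assoc [a] [] [] [] rfl rfl rfl rfl rfl rfl rfl A₂ (by simp [SubOK]) A₁ (by simp [SubOK])
    A₂ f p w).symm

theorem n21_p22 (f : C.H₂ m b z) (p : b' ⟶ b) (w : C.H₀ m) :
    n21 (p22 f p) w = p ≫ n21 f w :=
  (C.comm [] [] [] rfl rfl rfl rfl rfl rfl rfl rfl A₂ A₁ (by simp [SubOK]) (by simp [SubOK])
    A₂ f w p).symm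

theorem n22_p21 (f : C.H₂ a m z) (p : a' ⟶ a) (w : C.H₀ m) :
    n22 (p21 f p) w = p ≫ n22 f w :=
  C.comm [] [] [] rfl rfl rfl rfl rfl rfl rfl rfl A₁ (by simp [SubOK]) A₂ A₁
    (by simp [SubOK]) f p w

theorem b31_b21 (f : C.H₂ n d z) (g : C.H₂ m c n) (h : C.H₂ a b m) :
    b31 (b21 f g) h = t21 f (b21 g h) :=
  (C.assoc [] [d] [] [c] rfl rfl rfl rfl rfl rfl rfl (by simp [AssocOK]) (by simp [SubOK])
    (by simp [SubOK]) (by simp [SubOK]) (by simp [SubOK]) f g h).symm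

theorem t21_b22 (f : C.H₂ n d z) (g : C.H₂ a m n) (h : C.H₂ b c m) :
    t21 f (b22 g h) = b32 (b21 f g) h :=
  C.assoc [] [d] [a] [] rfl rfl rfl rfl rfl rfl rfl (by simp [AssocOK]) (by simp [SubOK])
    (by simp [SubOK]) (by simp [SubOK]) (by simp [SubOK]) f g h

theorem b32_b22 (f : C.H₂ a n z) (g : C.H₂ m d n) (h : C.H₂ b c m) :
    b32 (b22 f g) h = t22 f (b21 g h) :=
  (C.assoc [a] [] [] [d] rfl rfl rfl rfl rfl rfl rfl (by simp [AssocOK]) (by simp [SubOK])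
    (by simp [SubOK]) (by simp [SubOK]) (by simp [SubOK]) f g h).symm

theorem t22_b22 (f : C.H₂ a n z) (g : C.H₂ b m n) (h : C.H₂ c d m) :
    t22 f (b22 g h) = b33 (b22 f g) h :=
  C.assoc [a] [] [b] [] rfl rfl rfl rfl rfl rfl rfl (by simp [AssocOK]) (by simp [SubOK])
    (by simp [SubOK]) (by simp [SubOK]) (by simp [SubOK]) f g h

theorem b31_b22 (f : C.H₂ m n z) (g : C.H₂ c d n) (h : C.H₂ a b m) :
    b31 (b22 f g) h = b33 (b21 f h) g :=
  (C.comm [] [] [] rfl rfl rfl rfl rfl rfl rfl rfl (by simp [CommOK]) (by simp [SubOK])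
    (by simp [SubOK]) (by simp [SubOK]) (by simp [SubOK]) f h g).symm

theorem n31_b21 (f : C.H₂ n d z) (g : C.H₂ m c n) (w : C.H₀ m) :
    n31 (b21 f g) w = p21 f (n21 g w) :=
  (C.assoc [] [d] [] [c] rfl rfl rfl rfl rfl rfl rfl (by simp [AssocOK]) (by simp [SubOK])
    (by simp [SubOK]) (by simp [SubOK]) (by simp [SubOK]) f g w).symm

theorem n32_b21 (f : C.H₂ n d z) (g : C.H₂ a m n) (w : C.H₀ m) :
    n32 (b21 f g) w = p21 f (n22 g w) :=
  (C.assoc [] [d] [a] [] rfl rfl rfl rfl rfl rfl rfl (by simp [AssocOK]) (by simp [SubOK])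
    (by simp [SubOK]) (by simp [SubOK]) (by simp [SubOK]) f g w).symm

theorem n32_b22 (f : C.H₂ a n z) (g : C.H₂ m d n) (w : C.H₀ m) :
    n32 (b22 f g) w = p22 f (n21 g w) :=
  (C.assoc [a] [] [] [d] rfl rfl rfl rfl rfl rfl rfl (by simp [AssocOK]) (by simp [SubOK])
    (by simp [SubOK]) (by simp [SubOK]) (by simp [SubOK]) f g w).symm

theorem n33_b22 (f : C.H₂ a n z) (g : C.H₂ b m n) (w : C.H₀ m) :
    n33 (b22 f g) w = p22 f (n22 g w) :=
  (C.assoc [a] [] [b] [] rfl rfl rfl rfl rfl rfl rfl (by simp [AssocOK]) (by simp [SubOK])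
    (by simp [SubOK]) (by simp [SubOK]) (by simp [SubOK]) f g w).symm

theorem post_n22 (f : C.H₂ n m z) (g : C.H₂ a b n) (w : C.H₀ m) :
    post (n22 f w) g = n33 (b21 f g) w :=
  (C.comm [] [] [] rfl rfl rfl rfl rfl rfl rfl rfl (by simp [CommOK]) (by simp [SubOK])
    (by simp [SubOK]) (by simp [SubOK]) (by simp [SubOK]) f g w).symm

theorem n31_b22 (f : C.H₂ m n z) (g : C.H₂ a b n) (w : C.H₀ m) :
    n31 (b22 f g) w = post (n21 f w) g :=
  (C.comm [] [] [] rfl rfl rfl rfl rfl rfl rfl rfl (by simp [CommOK]) (by simp [SubOK])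
    (by simp [SubOK]) (by simp [SubOK]) (by simp [SubOK]) f w g).symm

theorem post_n22_null (f : C.H₂ m n z) (w : C.H₀ m) (w' : C.H₀ n) :
    post (n22 f w') w = post (n21 f w) w' :=
  (C.comm [] [] [] rfl rfl rfl rfl rfl rfl rfl rfl (by simp [CommOK]) (by simp [SubOK])
    (by simp [SubOK]) (by simp [SubOK]) (by simp [SubOK]) f w w').symm

end laws

end ShortMulticategory

/-! ## Representability -/

namespace ShortMulticategory

variable (C : ShortMulticategory.{v, u})

/-- A multimap `θ : as → m` is a map classifier if `- ∘₁ θ : C₁(m; z) → Cₙ(as; z)` is a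
bijection for all `z`. -/
def IsClassifier {C : ShortMulticategory.{v, u}} {as : List C.Obj} {la : as.length ≤ 4} {m : C.Obj}
    (θ : C.Hom as la m) : Prop :=
  ∀ z : C.Obj, Function.Bijective fun f : m ⟶ z => post f θ

/-- A choice of binary and nullary map classifiers. -/
structure Classifiers where
  tensor : C.Obj → C.Obj → C.Obj
  θ (a b : C.Obj) : C.H₂ a b (tensor a b)
  isClassifier_θ (a b : C.Obj) : IsClassifier (θ a b)
  unit : C.Obj
  u : C.H₀ unit
  isClassifier_u : IsClassifier u

variable {C}

/-- The map `- ∘ⱼ θ : Cₙ(x, m, y; z) → Cₙ₊₁(x, a, b, y; z)` for `θ : a, b → m`, where `n ≤ 3`. -/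
def substBinary {a b m : C.Obj} (θ : C.H₂ a b m) (x y : List C.Obj)
    (h : x.length + y.length ≤ 2) (z : C.Obj) (f : C.Hom (x ++ m :: y) (length_cons_le h m) z) :
    C.Hom (x ++ ([a, b] ++ y)) (length_append_le h (by simp)) z :=
  C.circ x y rfl rfl (subOK_two h m) f θ

/-- The map `- ∘ⱼ u : Cₙ(x, m, y; z) → Cₙ₋₁(x, y; z)` for `u` nullary with codomain `m`, where
`n ≤ 3`. -/
def substNullary {m : C.Obj} (u : C.H₀ m) (x y : List C.Obj)
    (h : x.length + y.length ≤ 2) (z : C.Obj) (f : C.Hom (x ++ m :: y) (length_cons_le h m) z) :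
    C.Hom (x ++ ([] ++ y)) (length_append_le h (by simp)) z :=
  C.circ x y rfl rfl (subOK_zero h m) f u

namespace Classifiers

/-- The classifiers are left universal. -/
def LeftUniversal (cl : C.Classifiers) : Prop :=
  (∀ (a b : C.Obj) (y : List C.Obj) (h : ([] : List C.Obj).length + y.length ≤ 2) (z : C.Obj),
    Function.Bijective (substBinary (cl.θ a b) [] y h z)) ∧
  (∀ (y : List C.Obj) (h : ([] : List C.Obj).length + y.length ≤ 2) (z : C.Obj),
    Function.Bijective (substNullary cl.u [] y h z))

/-- The classifiers are universal in every variable. -/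
def Universal (cl : C.Classifiers) : Prop :=
  (∀ (a b : C.Obj) (x y : List C.Obj) (h : x.length + y.length ≤ 2) (z : C.Obj),
    Function.Bijective (substBinary (cl.θ a b) x y h z)) ∧
  (∀ (x y : List C.Obj) (h : x.length + y.length ≤ 2) (z : C.Obj),
    Function.Bijective (substNullary cl.u x y h z))

end Classifiers

end ShortMulticategory

open ShortMulticategory

/-- A short multicategory is left representable if it admits left universal nullary and binary map
classifiers. -/
def leftRepresentable : ObjectProperty ShortMulticategory.{v, u} :=
  fun C => ∃ cl : C.Classifiers, cl.LeftUniversal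

/-- A short multicategory is representable if it admits nullary and binary map classifiers
that are universal in every variable. -/
def representable : ObjectProperty ShortMulticategory.{v, u} :=
  fun C => ∃ cl : C.Classifiers, cl.Universal

/-- The category of left representable short multicategories. -/
abbrev ShortMultiLR := (leftRepresentable.{v, u}).FullSubcategory

/-- The category of representable short multicategories. -/
abbrev ShortMultiRep := (representable.{v, u}).FullSubcategory

theorem representable_le_leftRepresentable : representable.{v, u} ≤ leftRepresentable.{v, u} :=
  fun _ ⟨cl, h⟩ => ⟨cl, fun a b => h.1 a b [], h.2 []⟩

namespace Multicategory

variable (M : Multicategory.{v, u})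

/-- A multimap `θ : as → m` is a map classifier (or universal multimap) if
`- ∘₁ θ : M₁(m; z) → Mₙ(as; z)` is a bijection for all `z`. -/
def IsClassifier {M : Multicategory.{v, u}} {as : List M.Obj} {m : M.Obj} (θ : M.Hom as m) : Prop :=
  ∀ z : M.Obj, Function.Bijective
    fun f : M.Hom [m] z => M.circ (ds := as) [] [] rfl (List.append_nil as).symm f θ

/-- Substitution of `θ` into every position of a multimap induces a bijection. -/
def IsUniversal {M : Multicategory.{v, u}} {as : List M.Obj} {m : M.Obj} (θ : M.Hom as m) : Prop :=
  ∀ (x y : List M.Obj) (z : M.Obj), Function.Bijective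
    fun f : M.Hom (x ++ m :: y) z => M.circ (ds := x ++ (as ++ y)) x y rfl rfl f θ

/-- A choice of binary and nullary map classifiers. -/
structure Classifiers where
  tensor : M.Obj → M.Obj → M.Obj
  θ (a b : M.Obj) : M.Hom [a, b] (tensor a b)
  isClassifier_θ (a b : M.Obj) : IsClassifier (θ a b)
  unit : M.Obj
  u : M.Hom [] unit
  isClassifier_u : IsClassifier u

variable {M}

/-- Classifiers in a multicategory are the same as classifiers in its underlying short
multicategory. -/
def Classifiers.ofShort (cl : (forgetShort.obj M).Classifiers) : M.Classifiers where
  tensor := cl.tensor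
  θ := cl.θ
  isClassifier_θ := cl.isClassifier_θ
  unit := cl.unit
  u := cl.u
  isClassifier_u := cl.isClassifier_u

/-- Classifiers in a multicategory are the same as classifiers in its underlying short
multicategory. -/
def Classifiers.toShort (cl : M.Classifiers) : (forgetShort.obj M).Classifiers where
  tensor := cl.tensor
  θ := cl.θ
  isClassifier_θ := cl.isClassifier_θ
  unit := cl.unit
  u := cl.u
  isClassifier_u := cl.isClassifier_u

end Multicategory

/-- A multicategory is representable if every list of objects has a map classifier, and
substitution of the map classifiers into every position induces bijections. -/
def multiRepresentable : ObjectProperty Multicategory.{v, u} :=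
  fun M => ∀ as : List M.Obj, ∃ (m : M.Obj) (θ : M.Hom as m),
    Multicategory.IsClassifier θ ∧ Multicategory.IsUniversal θ

/-- The category of representable multicategories. -/
abbrev MultiRep := (multiRepresentable.{v, u}).FullSubcategory

theorem representable_forgetShort (M : Multicategory.{v, u}) (h : multiRepresentable M) :
    representable (forgetShort.obj M) := by
  choose m θ hθ using h
  exact ⟨{ tensor := fun a b => m [a, b]
           θ := fun a b => θ [a, b]
           isClassifier_θ := fun a b => (hθ [a, b]).1
           unit := m []
           u := θ []
           isClassifier_u := (hθ []).1 },
    fun a b x y _ z => (hθ [a, b]).2 x y z, fun x y _ z => (hθ []).2 x y z⟩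

/-- The forgetful functor from representable multicategories to representable short
multicategories. -/
def forgetRep : MultiRep.{v, u} ⥤ ShortMultiRep.{v, u} :=
  representable.lift (multiRepresentable.ι ⋙ forgetShort)
    fun M => representable_forgetShort M.obj M.property

namespace ShortMulticategory

variable {C : ShortMulticategory.{v, u}}

theorem circ_congr {bs as ds x x' y y' : List C.Obj} {b c : C.Obj} {lb : bs.length ≤ 4}
    {la : as.length ≤ 4} {ld : ds.length ≤ 4} (ex : x = x') (ey : y = y')
    (hb : bs = x ++ b :: y) (hd : ds = x ++ (as ++ y)) (hb' : bs = x' ++ b :: y')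
    (hd' : ds = x' ++ (as ++ y')) (ok : SubOK bs.length as.length)
    (g : C.Hom bs lb c) (f : C.Hom as la b) :
    C.circ (ld := ld) x y hb hd ok g f = C.circ (ld := ld) x' y' hb' hd' ok g f := by
  subst ex ey; rfl

/-- The action of a unary map on the variable `m`. -/
def pre {m m' z : C.Obj} (x y : List C.Obj) (h : x.length + y.length ≤ 2)
    (f : C.Hom (x ++ m :: y) (length_cons_le h m) z) (p : m' ⟶ m) :
    C.Hom (x ++ m' :: y) (length_cons_le h m') z :=
  C.circ x y rfl rfl (Or.inr (Or.inl rfl)) f p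

theorem pre_id {m z : C.Obj} (x y : List C.Obj) (h : x.length + y.length ≤ 2)
    (f : C.Hom (x ++ m :: y) (length_cons_le h m) z) : pre x y h f (𝟙 m) = f :=
  C.circ_id x y rfl rfl _ f

theorem pre_comp {m m' n z : C.Obj} (x y : List C.Obj) (h : x.length + y.length ≤ 2)
    (f : C.Hom (x ++ m :: y) (length_cons_le h m) z) (p : m' ⟶ m) (q : n ⟶ m') :
    pre x y h f (q ≫ p) = pre x y h (pre x y h f p) q := by
  have := C.assoc (lg := by simp) (es := x ++ m' :: y) (ds := x ++ n :: y) (ld := length_cons_le h n)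
    (le := length_cons_le h m') x y [] [] rfl rfl rfl rfl rfl
    (by simp) (by simp) (Or.inr (Or.inl rfl)) (Or.inr (Or.inl rfl)) (Or.inl rfl)
    (Or.inr (Or.inl rfl)) (Or.inr (Or.inl rfl)) f p q
  refine this.trans ?_
  exact circ_congr (List.append_nil x) rfl _ _ _ _ _ _ _

theorem pre_bijective {m m' z : C.Obj} (x y : List C.Obj) (h : x.length + y.length ≤ 2)
    (p : m' ≅ m) : Function.Bijective
      fun f : C.Hom (x ++ m :: y) (length_cons_le h m) z => pre x y h f p.hom := by
  refine Function.bijective_iff_has_inverse.2 ⟨fun f => pre x y h f p.inv, fun f => ?_, fun f => ?_⟩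
  · simp only [← pre_comp, Iso.inv_hom_id, pre_id]
  · simp only [← pre_comp, Iso.hom_inv_id, pre_id]

theorem circ_post {as : List C.Obj} {la : as.length ≤ 4} {m m' z : C.Obj} (x y : List C.Obj)
    (h : x.length + y.length ≤ 2) (ld : (x ++ (as ++ y)).length ≤ 4)
    (ok : SubOK (x ++ m :: y).length as.length) (ok' : SubOK (x ++ m' :: y).length as.length)
    (f : C.Hom (x ++ m :: y) (length_cons_le h m) z) (p : m' ⟶ m) (θ : C.Hom as la m') :
    C.circ (ld := ld) x y rfl rfl ok f (post p θ) =
      C.circ (ld := ld) x y rfl rfl ok' (pre x y h f p) θ := by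
  have := C.assoc (lg := la) (es := x ++ m' :: y) (gs := as) (ds := x ++ (as ++ y)) (ld := ld)
    (le := length_cons_le h m') x y [] [] rfl rfl (List.append_nil as).symm rfl rfl
    (by simp) (by simp) (Or.inr (Or.inl rfl)) ok (Or.inl rfl)
    ok' (Or.inr (Or.inl rfl)) f p θ
  refine this.trans ?_
  exact circ_congr (List.append_nil x) rfl _ _ _ _ _ _ _

/-- Two classifiers of the same list are isomorphic. -/
theorem exists_iso {as : List C.Obj} {la : as.length ≤ 4} {m m' : C.Obj} {θ : C.Hom as la m}
    {θ' : C.Hom as la m'} (h : IsClassifier θ) (h' : IsClassifier θ') :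
    ∃ p : m ≅ m', post p.hom θ = θ' := by
  obtain ⟨p, hp⟩ := (h m').2 θ'
  obtain ⟨q, hq⟩ := (h' m).2 θ
  refine ⟨⟨p, q, (h m).1 ?_, (h' m').1 ?_⟩, hp⟩ <;> simp only at hp hq ⊢
  · rw [post_comp, hp, hq, post_id]
  · rw [post_comp, hq, hp, post_id]

theorem substBinary_bijective {a b m m' : C.Obj} {θ : C.H₂ a b m} {θ' : C.H₂ a b m'}
    (hθ : IsClassifier θ) (hθ' : IsClassifier θ') (x y : List C.Obj)
    (h : x.length + y.length ≤ 2) (z : C.Obj) (hb : Function.Bijective (substBinary θ x y h z)) :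
    Function.Bijective (substBinary θ' x y h z) := by
  obtain ⟨p, rfl⟩ := exists_iso hθ hθ'
  have : substBinary (post p.hom θ) x y h z = substBinary θ x y h z ∘ fun f => pre x y h f p.hom :=
    funext fun f => circ_post x y h _ _ _ f p.hom θ
  rw [this]
  exact hb.comp (pre_bijective x y h p)

theorem substNullary_bijective {m m' : C.Obj} {θ : C.H₀ m} {θ' : C.H₀ m'}
    (hθ : IsClassifier θ) (hθ' : IsClassifier θ') (x y : List C.Obj)
    (h : x.length + y.length ≤ 2) (z : C.Obj) (hb : Function.Bijective (substNullary θ x y h z)) :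
    Function.Bijective (substNullary θ' x y h z) := by
  obtain ⟨p, rfl⟩ := exists_iso hθ hθ'
  have : substNullary (post p.hom θ) x y h z =
      substNullary θ x y h z ∘ fun f => pre x y h f p.hom :=
    funext fun f => circ_post x y h _ _ _ f p.hom θ
  rw [this]
  exact hb.comp (pre_bijective x y h p)

namespace Classifiers

variable (cl : C.Classifiers)

theorem leftUniversal (h : leftRepresentable C) : cl.LeftUniversal := by
  obtain ⟨cl', h₁, h₂⟩ := h
  exact ⟨fun a b y h z => substBinary_bijective (cl'.isClassifier_θ a b) (cl.isClassifier_θ a b)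
    [] y h z (h₁ a b y h z), fun y h z => substNullary_bijective cl'.isClassifier_u
    cl.isClassifier_u [] y h z (h₂ y h z)⟩

theorem universal (h : representable C) : cl.Universal := by
  obtain ⟨cl', h₁, h₂⟩ := h
  exact ⟨fun a b x y h z => substBinary_bijective (cl'.isClassifier_θ a b)
    (cl.isClassifier_θ a b) x y h z (h₁ a b x y h z), fun x y h z =>
    substNullary_bijective cl'.isClassifier_u cl.isClassifier_u x y h z (h₂ x y h z)⟩

/-- The unary map `ab → z` corresponding to a binary multimap `a, b → z`. -/
noncomputable def desc {a b z : C.Obj} (f : C.H₂ a b z) : cl.tensor a b ⟶ z :=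
  (Equiv.ofBijective _ (cl.isClassifier_θ a b z)).symm f

/-- The unary map `i → z` corresponding to a nullary multimap. -/
noncomputable def desc₀ {z : C.Obj} (f : C.H₀ z) : cl.unit ⟶ z :=
  (Equiv.ofBijective _ (cl.isClassifier_u z)).symm f

theorem post_desc {a b z : C.Obj} (f : C.H₂ a b z) : post (cl.desc f) (cl.θ a b) = f :=
  (Equiv.ofBijective _ (cl.isClassifier_θ a b z)).apply_symm_apply f

theorem post_desc₀ {z : C.Obj} (f : C.H₀ z) : post (cl.desc₀ f) cl.u = f :=
  (Equiv.ofBijective _ (cl.isClassifier_u z)).apply_symm_apply f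

theorem ext₂ {a b z : C.Obj} {f g : cl.tensor a b ⟶ z}
    (h : post f (cl.θ a b) = post g (cl.θ a b)) : f = g :=
  (cl.isClassifier_θ a b z).1 h

theorem ext₀ {z : C.Obj} {f g : cl.unit ⟶ z} (h : post f cl.u = post g cl.u) : f = g :=
  (cl.isClassifier_u z).1 h

variable {cl}

theorem ext₂₁ (hl : cl.LeftUniversal) {a b c z : C.Obj} {f g : C.H₂ (cl.tensor a b) c z}
    (h : b21 f (cl.θ a b) = b21 g (cl.θ a b)) : f = g :=
  (hl.1 a b [c] (by simp) z).1 h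

theorem ext₃₁ (hl : cl.LeftUniversal) {a b c d z : C.Obj} {f g : C.H₃ (cl.tensor a b) c d z}
    (h : b31 f (cl.θ a b) = b31 g (cl.θ a b)) : f = g :=
  (hl.1 a b [c, d] (by simp) z).1 h

theorem extu₂ (hl : cl.LeftUniversal) {a z : C.Obj} {f g : C.H₂ cl.unit a z}
    (h : n21 f cl.u = n21 g cl.u) : f = g :=
  (hl.2 [a] (by simp) z).1 h

theorem extu₃ (hl : cl.LeftUniversal) {a b z : C.Obj} {f g : C.H₃ cl.unit a b z}
    (h : n31 f cl.u = n31 g cl.u) : f = g :=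
  (hl.2 [a, b] (by simp) z).1 h

/-- The ternary map classifier `θ_{ab,c} ∘₁ θ_{a,b}`. -/
def θ₃ (cl : C.Classifiers) (a b c : C.Obj) : C.H₃ a b c (cl.tensor (cl.tensor a b) c) :=
  b21 (cl.θ (cl.tensor a b) c) (cl.θ a b)

theorem isClassifier_θ₃ (hl : cl.LeftUniversal) (a b c : C.Obj) : IsClassifier (cl.θ₃ a b c) := by
  intro z
  have : (fun f : cl.tensor (cl.tensor a b) c ⟶ z => post f (cl.θ₃ a b c)) =
      (fun f : C.H₂ (cl.tensor a b) c z => b21 f (cl.θ a b)) ∘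
        fun f => post f (cl.θ (cl.tensor a b) c) :=
    funext fun f => post_b21 f _ _
  rw [this]
  exact (hl.1 a b [c] (by simp) z).comp (cl.isClassifier_θ _ _ z)

theorem isClassifier_θu (hl : cl.LeftUniversal) (a : C.Obj) :
    IsClassifier (as := [a]) (n21 (cl.θ cl.unit a) cl.u) := by
  intro z
  have : (fun f : cl.tensor cl.unit a ⟶ z => post (as := [a]) f (n21 (cl.θ cl.unit a) cl.u)) =
      (fun f : C.H₂ cl.unit a z => n21 f cl.u) ∘ fun f => post f (cl.θ cl.unit a) :=
    funext fun f => (n21_post f _ _).symm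
  rw [this]
  exact (hl.2 [a] (by simp) z).comp (cl.isClassifier_θ _ _ z)

variable (cl)

/-- The tensor product of unary maps: `(fg) ∘ θ = θ ∘ (f, g)`. -/
noncomputable def tensorHom {a b c d : C.Obj} (f : a ⟶ b) (g : c ⟶ d) :
    cl.tensor a c ⟶ cl.tensor b d :=
  cl.desc (p22 (p21 (cl.θ b d) f) g)

theorem post_tensorHom {a b c d : C.Obj} (f : a ⟶ b) (g : c ⟶ d) :
    post (cl.tensorHom f g) (cl.θ a c) = p22 (p21 (cl.θ b d) f) g :=
  cl.post_desc _

variable {cl}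

/-- The associator: `α ∘ (θ_{ab,c} ∘₁ θ_{a,b}) = θ_{a,bc} ∘₂ θ_{b,c}`. -/
noncomputable def assoc (hl : cl.LeftUniversal) (a b c : C.Obj) :
    cl.tensor (cl.tensor a b) c ⟶ cl.tensor a (cl.tensor b c) :=
  (Equiv.ofBijective _ (isClassifier_θ₃ hl a b c _)).symm
    (b22 (cl.θ a (cl.tensor b c)) (cl.θ b c))

/-- The left unit map: `λ ∘ (θ_{i,a} ∘₁ u) = 1`. -/
noncomputable def lam (hl : cl.LeftUniversal) (a : C.Obj) : cl.tensor cl.unit a ⟶ a :=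
  (Equiv.ofBijective _ (isClassifier_θu hl a a)).symm (𝟙 a)

variable (cl) in
/-- The right unit map `θ_{a,i} ∘₂ u`. -/
def rho (a : C.Obj) : a ⟶ cl.tensor a cl.unit := n22 (cl.θ a cl.unit) cl.u

theorem post_assoc (hl : cl.LeftUniversal) (a b c : C.Obj) :
    b21 (post (cl.assoc hl a b c) (cl.θ (cl.tensor a b) c)) (cl.θ a b) =
      b22 (cl.θ a (cl.tensor b c)) (cl.θ b c) :=
  (post_b21 _ _ _).symm.trans
    ((Equiv.ofBijective _ (isClassifier_θ₃ hl a b c _)).apply_symm_apply _)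

theorem post_assoc' (hl : cl.LeftUniversal) {a b c z : C.Obj}
    (F : cl.tensor a (cl.tensor b c) ⟶ z) :
    b21 (post F (post (cl.assoc hl a b c) (cl.θ (cl.tensor a b) c))) (cl.θ a b) =
      b22 (post F (cl.θ a (cl.tensor b c))) (cl.θ b c) := by
  rw [← post_b21, post_assoc, post_b22]

theorem n21_lam (hl : cl.LeftUniversal) (a : C.Obj) :
    n21 (cl.θ cl.unit a) cl.u ≫ cl.lam hl a = 𝟙 a :=
  (Equiv.ofBijective _ (isClassifier_θu hl a a)).apply_symm_apply _

/-- The skew monoidal category associated with a left representable short multicategory. -/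
noncomputable def toSkew (cl : C.Classifiers) (hl : cl.LeftUniversal) :
    SkewMonoidalCategory.{v, u} where
  Obj := C.Obj
  tensorObj := cl.tensor
  tensorHom := cl.tensorHom
  tensor_id a b := cl.ext₂ (by rw [post_tensorHom, p21_id, p22_id, post_id])
  tensor_comp f g f' g' := cl.ext₂ (by
    simp only [post_tensorHom, post_comp, p21_comp, p22_comp, post_p22, post_p21, p22_p21])
  unit := cl.unit
  α := assoc hl
  lam := lam hl
  rho := cl.rho
  α_naturality f g h := cl.ext₂ (ext₂₁ hl (by
    simp only [post_comp, post_tensorHom, post_p22, post_p21, b21_p22, b21_p21, b21_of_p21,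
      b21_of_p22, post_assoc, post_assoc', b22_p21, b22_p22, b22_of_p21, b22_of_p22]))
  lam_naturality f := cl.ext₂ (extu₂ hl (by
    simp only [post_comp, post_tensorHom, n21_post, p21_id, n21_p22, Category.assoc, n21_lam,
      Category.id_comp, Category.comp_id]))
  rho_naturality f := by
    simp only [rho, n22_comp, post_tensorHom, p22_id, n22_p21]
  pentagon a b c d := cl.ext₂ (ext₂₁ hl (ext₃₁ hl (by
    simp only [post_comp, post_tensorHom, p22_id, p21_id, post_p21, b21_p21, b31_b21,
      post_assoc, post_assoc', t21_b22, b22_p22, b32_b22, t22_b22, b31_b22])))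
  lam_tensor a b := cl.ext₂ (ext₂₁ hl (extu₃ hl (by
    simp only [post_comp, post_tensorHom, p22_id, n31_b21, post_assoc', n31_b22,
      n21_post, n21_lam, post_id, b21_p21, p21_id])))
  rho_tensor a b := cl.ext₂ (by
    simp only [rho, n22_comp, post_tensorHom, post_n22, post_assoc, n33_b22, p21_id])
  triangle a b := cl.ext₂ (by
    simp only [post_comp, post_tensorHom, post_p21, rho, p22_id]
    simp only [← n32_b21, post_assoc', post_tensorHom, p21_id, b22_p22, n32_b22, n21_post, n21_lam,
      p22_id, post_id])
  rho_lam := cl.ext₀ (by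
    simp only [rho, n22_comp, post_n22_null, n21_post, n21_lam])

/-- The canonical map `f₂ : Fa Fb → F(ab)`, with `f₂ ∘ θ = F θ`, of a morphism of short
multicategories. -/
noncomputable def f₂ {C D : ShortMulticategory.{v, u}} (F : ShortMultifunctor C D)
    (cl : C.Classifiers) (dl : D.Classifiers) (a b : C.Obj) :
    dl.tensor (F.obj a) (F.obj b) ⟶ F.obj (cl.tensor a b) :=
  dl.desc (F.map rfl (cl.θ a b))

/-- The canonical map `f₀ : i → Fi`, with `f₀ ∘ u = F u`, of a morphism of short multicategories. -/
noncomputable def f₀ {C D : ShortMulticategory.{v, u}} (F : ShortMultifunctor C D)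
    (cl : C.Classifiers) (dl : D.Classifiers) : dl.unit ⟶ F.obj cl.unit :=
  dl.desc₀ (F.map rfl cl.u)

end Classifiers

/-- The action on unary maps. -/
def _root_.RepMult.ShortMultifunctor.map₁ {C D : ShortMulticategory.{v, u}}
    (F : ShortMultifunctor C D) {a b : C.Obj} (f : a ⟶ b) : F.obj a ⟶ F.obj b :=
  F.map (as' := [F.obj a]) rfl f

/-- The functor on underlying categories. -/
def _root_.RepMult.ShortMultifunctor.functor {C D : ShortMulticategory.{v, u}}
    (F : ShortMultifunctor C D) : C.Obj ⥤ D.Obj where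
  obj := F.obj
  map f := F.map₁ f
  map_id a := F.map_id a
  map_comp f g := F.map_circ (x := []) (y := []) rfl rfl (Or.inl rfl) (Or.inl rfl) rfl rfl rfl rfl rfl rfl rfl g f

section map

variable {C D : ShortMulticategory.{v, u}} (F : ShortMultifunctor C D)

theorem map_post₀ {y z : C.Obj} (q : y ⟶ z) (f : C.H₀ y) :
    F.map (as' := []) (la' := by simp) rfl (post q f) =
      post (F.map₁ q) (F.map (as' := []) (la' := by simp) rfl f) :=
  F.map_circ (x := []) (y := []) rfl rfl (Or.inl rfl) (Or.inl rfl) rfl rfl rfl rfl rfl rfl rfl q f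

theorem map_post₂ {a b y z : C.Obj} (q : y ⟶ z) (f : C.H₂ a b y) :
    F.map (as' := [F.obj a, F.obj b]) (la' := by simp) rfl (post q f) =
      post (F.map₁ q) (F.map (as' := [F.obj a, F.obj b]) (la' := by simp) rfl f) :=
  F.map_circ (x := []) (y := []) rfl rfl (Or.inl rfl) (Or.inl rfl) rfl rfl rfl rfl rfl rfl rfl q f

theorem map_p21 {a a' b z : C.Obj} (f : C.H₂ a b z) (p : a' ⟶ a) :
    F.map (as' := [F.obj a', F.obj b]) (la' := by simp) rfl (p21 f p) =
      p21 (F.map (as' := [F.obj a, F.obj b]) (la' := by simp) rfl f) (F.map₁ p) :=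
  F.map_circ (x := []) (y := [b]) rfl rfl _ (Or.inr (Or.inl rfl)) rfl rfl rfl rfl rfl rfl rfl f p

theorem map_p22 {a b b' z : C.Obj} (f : C.H₂ a b z) (p : b' ⟶ b) :
    F.map (as' := [F.obj a, F.obj b']) (la' := by simp) rfl (p22 f p) =
      p22 (F.map (as' := [F.obj a, F.obj b]) (la' := by simp) rfl f) (F.map₁ p) :=
  F.map_circ (x := [a]) (y := []) rfl rfl _ (Or.inr (Or.inl rfl)) rfl rfl rfl rfl rfl rfl rfl f p

theorem map_b21 {a₁ a₂ m b z : C.Obj} (f : C.H₂ m b z) (g : C.H₂ a₁ a₂ m) :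
    F.map (as' := [F.obj a₁, F.obj a₂, F.obj b]) (la' := by simp) rfl (b21 f g) =
      b21 (F.map (as' := [F.obj m, F.obj b]) (la' := by simp) rfl f)
        (F.map (as' := [F.obj a₁, F.obj a₂]) (la' := by simp) rfl g) :=
  F.map_circ (x := []) (y := [b]) rfl rfl _ (by simp [SubOK]) rfl rfl rfl rfl rfl rfl rfl f g

theorem map_b22 {a b₁ b₂ m z : C.Obj} (f : C.H₂ a m z) (g : C.H₂ b₁ b₂ m) :
    F.map (as' := [F.obj a, F.obj b₁, F.obj b₂]) (la' := by simp) rfl (b22 f g) =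
      b22 (F.map (as' := [F.obj a, F.obj m]) (la' := by simp) rfl f)
        (F.map (as' := [F.obj b₁, F.obj b₂]) (la' := by simp) rfl g) :=
  F.map_circ (x := [a]) (y := []) rfl rfl _ (by simp [SubOK]) rfl rfl rfl rfl rfl rfl rfl f g

theorem map_n21 {m b z : C.Obj} (f : C.H₂ m b z) (w : C.H₀ m) :
    F.map₁ (n21 f w) =
      n21 (F.map (as' := [F.obj m, F.obj b]) (la' := by simp) rfl f)
        (F.map (as' := []) (la' := by simp) rfl w) :=
  F.map_circ (x := []) (y := [b]) rfl rfl _ (by simp [SubOK]) rfl rfl rfl rfl rfl rfl rfl f w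

theorem map_n22 {a m z : C.Obj} (f : C.H₂ a m z) (w : C.H₀ m) :
    F.map₁ (n22 f w) =
      n22 (F.map (as' := [F.obj a, F.obj m]) (la' := by simp) rfl f)
        (F.map (as' := []) (la' := by simp) rfl w) :=
  F.map_circ (x := [a]) (y := []) rfl rfl _ (by simp [SubOK]) rfl rfl rfl rfl rfl rfl rfl f w

variable (cl : C.Classifiers) (dl : D.Classifiers)

theorem post_f₂ (a b : C.Obj) : post (Classifiers.f₂ F cl dl a b) (dl.θ (F.obj a) (F.obj b)) =
    F.map (as' := [F.obj a, F.obj b]) (la' := by simp) rfl (cl.θ a b) :=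
  dl.post_desc _

theorem post_f₀ : post (Classifiers.f₀ F cl dl) dl.u =
    F.map (as' := []) (la' := by simp) rfl cl.u :=
  dl.post_desc₀ _

variable {cl dl}

theorem f₂_naturality {a b a' b' : C.Obj} (f : a ⟶ a') (g : b ⟶ b') :
    dl.tensorHom (F.map₁ f) (F.map₁ g) ≫ Classifiers.f₂ F cl dl a' b' =
      Classifiers.f₂ F cl dl a b ≫ F.map₁ (cl.tensorHom f g) := dl.ext₂ (by
  rw [post_comp, Classifiers.post_tensorHom, post_p22, post_p21, post_f₂, post_comp, post_f₂,
    ← map_post₂, Classifiers.post_tensorHom, map_p22, map_p21])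

theorem f₂_associativity (hc : cl.LeftUniversal) (hd : dl.LeftUniversal) (a b c : C.Obj) :
    dl.tensorHom (Classifiers.f₂ F cl dl a b) (𝟙 (F.obj c)) ≫
        Classifiers.f₂ F cl dl (cl.tensor a b) c ≫ F.map₁ (Classifiers.assoc hc a b c) =
      Classifiers.assoc hd (F.obj a) (F.obj b) (F.obj c) ≫
        dl.tensorHom (𝟙 (F.obj a)) (Classifiers.f₂ F cl dl b c) ≫
          Classifiers.f₂ F cl dl a (cl.tensor b c) := dl.ext₂ (Classifiers.ext₂₁ hd (by
  rw [post_comp, post_comp _ (_ ≫ _), Classifiers.post_assoc', Classifiers.post_tensorHom,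
    p22_id, post_p21, b21_p21, post_f₂, post_comp, post_f₂, ← map_post₂, ← map_b21,
    Classifiers.post_assoc, map_b22, post_comp, Classifiers.post_tensorHom, p21_id, post_p22,
    b22_p22, post_f₂, post_f₂]))

theorem f₂_left_unitality (hc : cl.LeftUniversal) (hd : dl.LeftUniversal) (a : C.Obj) :
    dl.tensorHom (Classifiers.f₀ F cl dl) (𝟙 (F.obj a)) ≫
      Classifiers.f₂ F cl dl cl.unit a ≫ F.map₁ (Classifiers.lam hc a) =
        Classifiers.lam hd (F.obj a) := dl.ext₂ (Classifiers.extu₂ hd (by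
  rw [post_comp, Classifiers.post_tensorHom, p22_id, post_p21, n21_p21, post_f₀, post_comp,
    post_f₂, ← map_post₂, ← map_n21, n21_post, n21_post, Classifiers.n21_lam,
    Classifiers.n21_lam]
  exact F.map_id a))

theorem f₂_right_unitality (a : C.Obj) :
    dl.rho (F.obj a) ≫ dl.tensorHom (𝟙 (F.obj a)) (Classifiers.f₀ F cl dl) ≫
      Classifiers.f₂ F cl dl a cl.unit = F.map₁ (cl.rho a) := by
  unfold Classifiers.rho
  rw [n22_comp, post_comp, Classifiers.post_tensorHom, p21_id, post_p22, n22_p22, post_f₀,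
    post_f₂, map_n22]

/-- The lax monoidal functor associated with a morphism of left representable short
multicategories. -/
noncomputable def toLax (hc : cl.LeftUniversal) (hd : dl.LeftUniversal) :
    SkewLaxFunctor (cl.toSkew hc) (dl.toSkew hd) where
  functor := F.functor
  f₀ := Classifiers.f₀ F cl dl
  f₂ := Classifiers.f₂ F cl dl
  f₂_naturality := f₂_naturality F
  associativity := f₂_associativity F hc hd
  left_unitality := f₂_left_unitality F hc hd
  right_unitality := f₂_right_unitality F

theorem toLax_id (hc : cl.LeftUniversal) : toLax (𝟙 C : C ⟶ C) hc hc = 𝟙 (cl.toSkew hc) :=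
  SkewLaxFunctor.ext rfl
    (heq_of_eq (cl.ext₀ ((cl.post_desc₀ _).trans (post_id cl.u).symm)))
    (heq_of_eq (funext fun a => funext fun b =>
      cl.ext₂ ((cl.post_desc _).trans (post_id (cl.θ a b)).symm)))

theorem toLax_comp_aux {E : ShortMulticategory.{v, u}} {el : E.Classifiers}
    (G : ShortMultifunctor D E) (a b : C.Obj) :
    post (Classifiers.f₂ (F.comp G) cl el a b) (el.θ (G.obj (F.obj a)) (G.obj (F.obj b))) =
      post (Classifiers.f₂ G dl el (F.obj a) (F.obj b) ≫ G.map₁ (Classifiers.f₂ F cl dl a b))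
        (el.θ (G.obj (F.obj a)) (G.obj (F.obj b))) := by
  rw [post_comp, post_f₂ G, ← map_post₂, post_f₂ F]
  exact el.post_desc _

theorem toLax_comp {E : ShortMulticategory.{v, u}} {el : E.Classifiers} (G : ShortMultifunctor D E)
    (hc : cl.LeftUniversal) (hd : dl.LeftUniversal) (he : el.LeftUniversal) :
    toLax (F.comp G) hc he = SkewLaxFunctor.comp (toLax F hc hd) (toLax G hd he) := by
  refine SkewLaxFunctor.ext rfl (heq_of_eq (el.ext₀ ?_))
    (heq_of_eq (funext fun a => funext fun b => el.ext₂ ?_))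
  · refine (el.post_desc₀ _).trans ?_
    refine Eq.trans ?_ (post_comp (Classifiers.f₀ G dl el) (G.map₁ (Classifiers.f₀ F cl dl))
      el.u).symm
    rw [post_f₀, ← map_post₀, post_f₀]
    rfl
  · exact toLax_comp_aux F G a b

theorem Classifiers.isIso_lam (hc : cl.LeftUniversal) (a : C.Obj) : IsIso (Classifiers.lam hc a) := by
  refine ⟨n21 (cl.θ cl.unit a) cl.u, cl.ext₂ (Classifiers.extu₂ hc ?_), Classifiers.n21_lam hc a⟩
  rw [post_comp, n21_post, n21_post, Classifiers.n21_lam, post_id, Category.id_comp]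

theorem Classifiers.isIso_rho (hc : cl.Universal) (a : C.Obj) : IsIso (cl.rho a) := by
  obtain ⟨f, hf⟩ := (hc.2 [a] [] (by simp) a).2 (𝟙 a)
  have hf' : n22 f cl.u = 𝟙 a := hf
  have e : cl.rho a ≫ cl.desc f = 𝟙 a := by
    rw [Classifiers.rho.eq_def, n22_comp, Classifiers.post_desc, hf']
  refine ⟨cl.desc f, e, cl.ext₂ ((hc.2 [a] [] (by simp) _).1 ?_)⟩
  change n22 (post (cl.desc f ≫ cl.rho a) (cl.θ a cl.unit)) cl.u =
    n22 (post (𝟙 _) (cl.θ a cl.unit)) cl.u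
  rw [← n22_comp, ← n22_comp, Category.comp_id, ← Category.assoc]
  change (cl.rho a ≫ cl.desc f) ≫ cl.rho a = cl.rho a
  rw [e, Category.id_comp]

theorem Classifiers.Universal.left (hc : cl.Universal) : cl.LeftUniversal :=
  ⟨fun a b => hc.1 a b [], hc.2 []⟩

theorem Classifiers.isIso_assoc (hc : cl.Universal) (a b c : C.Obj) :
    IsIso (Classifiers.assoc hc.left a b c) := by
  obtain ⟨f, hf⟩ := (hc.1 b c [a] [] (by simp) _).2 (cl.θ₃ a b c)
  have hf' : b22 f (cl.θ b c) = cl.θ₃ a b c := hf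
  have e : Classifiers.assoc hc.left a b c ≫ cl.desc f = 𝟙 _ := by
    refine cl.ext₂ (Classifiers.ext₂₁ hc.left ?_)
    rw [post_comp, Classifiers.post_assoc', Classifiers.post_desc, hf', post_id]
    rfl
  refine ⟨cl.desc f, e, cl.ext₂ ((hc.1 b c [a] [] (by simp) _).1 ?_)⟩
  change b22 (post (cl.desc f ≫ Classifiers.assoc hc.left a b c) (cl.θ a (cl.tensor b c)))
    (cl.θ b c) = b22 (post (𝟙 _) (cl.θ a (cl.tensor b c))) (cl.θ b c)
  rw [← Classifiers.post_assoc' hc.left, ← Classifiers.post_assoc' hc.left, ← post_comp,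
    ← post_comp, Category.comp_id, ← Category.assoc, e, Category.id_comp]

end map

end ShortMulticategory

/-- The functor `K` from left representable short multicategories to left normal skew monoidal
categories, for a choice `χ` of nullary and binary map classifiers.  (By `Classifiers.leftUniversal`,
any map classifiers in a left representable short multicategory are left universal.) -/
noncomputable def functorK (χ : ∀ C : ShortMultiLR.{v, u}, C.obj.Classifiers) :
    ShortMultiLR.{v, u} ⥤ SkewMonLN.{v, u} where
  obj C := ⟨(χ C).toSkew ((χ C).leftUniversal C.property),
    Classifiers.isIso_lam ((χ C).leftUniversal C.property)⟩
  map {C D} F := ObjectProperty.homMk (toLax F.hom ((χ C).leftUniversal C.property)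
    ((χ D).leftUniversal D.property))
  map_id C := ObjectProperty.hom_ext _ (toLax_id ((χ C).leftUniversal C.property))
  map_comp {C D E} F G := ObjectProperty.hom_ext _ (toLax_comp F.hom G.hom
    ((χ C).leftUniversal C.property) ((χ D).leftUniversal D.property)
    ((χ E).leftUniversal E.property))

/-- The inclusion of representable into left representable short multicategories. -/
abbrev repInclusion : ShortMultiRep.{v, u} ⥤ ShortMultiLR.{v, u} :=
  ObjectProperty.ιOfLE representable_le_leftRepresentable

/-- The monoidal category associated with a representable short multicategory. -/
noncomputable def ShortMulticategory.Classifiers.toMonoidalCat {C : ShortMulticategory.{v, u}}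
    (cl : C.Classifiers) (h : cl.Universal) : MonoidalCat.{v, u} where
  Obj := C.Obj
  monoidal := (cl.toSkew h.left).toMonoidal (Classifiers.isIso_assoc h)
    (Classifiers.isIso_lam h.left) (Classifiers.isIso_rho h)

theorem SkewLaxFunctor.toMonoidal_id (C : SkewMonoidalCategory.{v, u})
    (hα : ∀ a b c, IsIso (C.α a b c)) (hl : ∀ a, IsIso (C.lam a)) (hr : ∀ a, IsIso (C.rho a)) :
    letI := C.toMonoidal hα hl hr
    SkewLaxFunctor.toMonoidal (𝟙 C : C ⟶ C) hα hl hr hα hl hr = LaxMonoidalFunctor.of (𝟭 C.Obj) :=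
  rfl

/-- The restriction `K_rep` of `K` to representable short multicategories, with values in
monoidal categories. -/
noncomputable def functorKRep (χ : ∀ C : ShortMultiLR.{v, u}, C.obj.Classifiers) :
    ShortMultiRep.{v, u} ⥤ MonoidalCat.{v, u} where
  obj C := (χ (repInclusion.obj C)).toMonoidalCat ((χ (repInclusion.obj C)).universal C.property)
  map {C D} F := SkewLaxFunctor.toMonoidal
    (toLax F.hom ((χ (repInclusion.obj C)).universal C.property).left
      ((χ (repInclusion.obj D)).universal D.property).left) _ _ _ _ _ _
  map_id C := by
    have := toLax_id ((χ (repInclusion.obj C)).universal C.property).left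
    refine Eq.trans ?_ (SkewLaxFunctor.toMonoidal_id
      ((χ (repInclusion.obj C)).toSkew ((χ (repInclusion.obj C)).universal C.property).left) _ _ _)
    exact congrArg (fun G => SkewLaxFunctor.toMonoidal G _ _ _ _ _ _) this
  map_comp {C D E} F G := by
    have := toLax_comp F.hom G.hom ((χ (repInclusion.obj C)).universal C.property).left
      ((χ (repInclusion.obj D)).universal D.property).left
      ((χ (repInclusion.obj E)).universal E.property).left
    exact congrArg (fun G => SkewLaxFunctor.toMonoidal G _ _ _ _ _ _) this

/-! ## The monoidal category of a representable multicategory -/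

namespace Multicategory

variable {M : Multicategory.{v, u}}

namespace Classifiers

theorem universal (cl : M.Classifiers) (h : multiRepresentable M) : cl.toShort.Universal :=
  cl.toShort.universal (representable_forgetShort M h)

variable (cl : M.Classifiers)

/-- The unary map `ab → z` corresponding to a binary multimap `a, b → z`. -/
noncomputable def desc {a b z : M.Obj} (f : M.Hom [a, b] z) : cl.tensor a b ⟶ z :=
  (Equiv.ofBijective _ (cl.isClassifier_θ a b z)).symm f

/-- The unary map `i → z` corresponding to a nullary multimap. -/
noncomputable def desc₀ {z : M.Obj} (f : M.Hom [] z) : cl.unit ⟶ z :=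
  (Equiv.ofBijective _ (cl.isClassifier_u z)).symm f

/-- The tensor product of unary maps, with `(fg) ∘ θ = θ ∘ (f, g)`. -/
noncomputable def tensorHom {a b c d : M.Obj} (f : a ⟶ b) (g : c ⟶ d) :
    cl.tensor a c ⟶ cl.tensor b d :=
  cl.desc (M.circ [a] [] rfl rfl (M.circ (ds := [a, d]) [] [d] rfl rfl (cl.θ b d) f) g)

/-- The ternary multimap `θ_{ab,c} ∘₁ θ_{a,b} : a, b, c → (ab)c`. -/
def leftTriple (a b c : M.Obj) : M.Hom [a, b, c] (cl.tensor (cl.tensor a b) c) :=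
  M.circ [] [c] rfl rfl (cl.θ (cl.tensor a b) c) (cl.θ a b)

/-- The ternary multimap `θ_{a,bc} ∘₂ θ_{b,c} : a, b, c → a(bc)`. -/
def rightTriple (a b c : M.Obj) : M.Hom [a, b, c] (cl.tensor a (cl.tensor b c)) :=
  M.circ [a] [] rfl rfl (cl.θ a (cl.tensor b c)) (cl.θ b c)

/-- The unary map `θ_{i,a} ∘₁ u : a → ia`. -/
def leftUnit (a : M.Obj) : a ⟶ cl.tensor cl.unit a :=
  M.circ [] [a] rfl rfl (cl.θ cl.unit a) cl.u

/-- The unary map `θ_{a,i} ∘₂ u : a → ai`. -/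
def rightUnit (a : M.Obj) : a ⟶ cl.tensor a cl.unit :=
  M.circ [a] [] rfl rfl (cl.θ a cl.unit) cl.u

variable {cl}

theorem isClassifier_leftTriple (h : multiRepresentable M) (a b c : M.Obj) :
    IsClassifier (cl.leftTriple a b c) :=
  ShortMulticategory.Classifiers.isClassifier_θ₃ (cl.universal h).left a b c

theorem isClassifier_leftUnit (h : multiRepresentable M) (a : M.Obj) :
    IsClassifier (as := [a]) (cl.leftUnit a) :=
  ShortMulticategory.Classifiers.isClassifier_θu (cl.universal h).left a

/-- The associator, comparing the ternary universal multimaps with codomains `(ab)c` and `a(bc)`. -/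
noncomputable def assoc (h : multiRepresentable M) (a b c : M.Obj) :
    cl.tensor (cl.tensor a b) c ⟶ cl.tensor a (cl.tensor b c) :=
  (Equiv.ofBijective _ (isClassifier_leftTriple h a b c _)).symm (cl.rightTriple a b c)

/-- The left unit map, comparing the unary universal multimaps `a → ia` and `1 : a → a`. -/
noncomputable def lam (h : multiRepresentable M) (a : M.Obj) : cl.tensor cl.unit a ⟶ a :=
  (Equiv.ofBijective _ (isClassifier_leftUnit h a a)).symm (𝟙 a)

theorem isIso_assoc (h : multiRepresentable M) (a b c : M.Obj) : IsIso (cl.assoc h a b c) :=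
  ShortMulticategory.Classifiers.isIso_assoc (cl.universal h) a b c

theorem isIso_lam (h : multiRepresentable M) (a : M.Obj) : IsIso (cl.lam h a) :=
  ShortMulticategory.Classifiers.isIso_lam (cl.universal h).left a

theorem isIso_rightUnit (h : multiRepresentable M) (a : M.Obj) : IsIso (cl.rightUnit a) :=
  ShortMulticategory.Classifiers.isIso_rho (cl.universal h) a

/-- The monoidal structure on the underlying category of a representable multicategory. -/
noncomputable abbrev monoidal (cl : M.Classifiers) (h : multiRepresentable M) :
    MonoidalCategory M.Obj :=
  letI K := (cl.toShort.toMonoidalCat (cl.universal h)).monoidal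
  letI := isIso_assoc (cl := cl) h
  letI := isIso_lam (cl := cl) h
  letI := isIso_rightUnit (cl := cl) h
  { tensorObj := cl.tensor
    tensorHom := cl.tensorHom
    whiskerLeft := fun a _ _ f => cl.tensorHom (𝟙 a) f
    whiskerRight := fun f a => cl.tensorHom f (𝟙 a)
    tensorUnit := cl.unit
    associator := fun a b c => asIso (cl.assoc h a b c)
    leftUnitor := fun a => asIso (cl.lam h a)
    rightUnitor := fun a => (asIso (cl.rightUnit a)).symm
    tensorHom_def := K.tensorHom_def
    id_tensorHom_id := K.id_tensorHom_id
    tensorHom_comp_tensorHom := K.tensorHom_comp_tensorHom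
    whiskerLeft_id := K.whiskerLeft_id
    id_whiskerRight := K.id_whiskerRight
    associator_naturality := K.associator_naturality
    leftUnitor_naturality := K.leftUnitor_naturality
    rightUnitor_naturality := K.rightUnitor_naturality
    pentagon := K.pentagon
    triangle := K.triangle }

/-- The monoidal category associated with a representable multicategory. -/
noncomputable def toMonoidalCat (cl : M.Classifiers) (h : multiRepresentable M) :
    MonoidalCat.{v, u} where
  Obj := M.Obj
  monoidal := cl.monoidal h

end Classifiers

/-- The functor on underlying categories. -/
def _root_.RepMult.Multifunctor.functor {M N : Multicategory.{v, u}} (F : Multifunctor M N) :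
    M.Obj ⥤ N.Obj where
  obj := F.obj
  map {a b} f := F.map (as' := [F.obj a]) rfl f
  map_id a := F.map_id a
  map_comp f g := F.map_circ (x := []) (y := []) rfl rfl rfl rfl rfl rfl rfl rfl rfl g f

/-- The lax monoidal functor associated with a multifunctor `F`: its structure maps `f₂` and `f₀`
are given by `f₂ ∘ θ = F θ` and `f₀ ∘ u = F u`. -/
noncomputable def toLax {M N : Multicategory.{v, u}} (F : Multifunctor M N)
    (cl : M.Classifiers) (dl : N.Classifiers) (h : multiRepresentable M)
    (k : multiRepresentable N) :
    letI := cl.monoidal h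
    letI := dl.monoidal k
    LaxMonoidalFunctor M.Obj N.Obj :=
  letI := cl.monoidal h
  letI := dl.monoidal k
  letI S : SkewLaxFunctor _ _ := ShortMulticategory.toLax (forgetShort.map F)
    (cl.universal h).left (dl.universal k).left
  { toFunctor := F.functor
    laxMonoidal :=
      { ε := dl.desc₀ (F.map (as' := []) rfl cl.u)
        μ := fun a b => dl.desc (F.map (as' := [F.obj a, F.obj b]) rfl (cl.θ a b))
        μ_natural_left := S.naturality_left
        μ_natural_right := fun c f => S.naturality_right c f
        associativity := S.associativity
        left_unitality := fun a => (S.left_unitality a).symm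
        right_unitality := S.right_unitality_inv
          (ShortMulticategory.Classifiers.isIso_rho (cl.universal h))
          (ShortMulticategory.Classifiers.isIso_rho (dl.universal k)) } }

end Multicategory

/-- The functor `T_rep` from representable multicategories to monoidal categories,
for a choice `τ` of nullary and binary map classifiers. -/
noncomputable def functorTRep (τ : ∀ M : MultiRep.{v, u}, M.obj.Classifiers) :
    MultiRep.{v, u} ⥤ MonoidalCat.{v, u} where
  obj M := (τ M).toMonoidalCat M.property
  map {M N} F := Multicategory.toLax F.hom (τ M) (τ N) M.property N.property
  map_id M := by
    have := ShortMulticategory.toLax_id ((τ M).universal M.property).left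
    refine Eq.trans ?_ (SkewLaxFunctor.toMonoidal_id
      ((τ M).toShort.toSkew ((τ M).universal M.property).left)
      (ShortMulticategory.Classifiers.isIso_assoc ((τ M).universal M.property))
      (ShortMulticategory.Classifiers.isIso_lam ((τ M).universal M.property).left)
      (ShortMulticategory.Classifiers.isIso_rho ((τ M).universal M.property)))
    exact congrArg (fun G => SkewLaxFunctor.toMonoidal G _ _ _ _ _ _) this
  map_comp {M N P} F G := by
    have := ShortMulticategory.toLax_comp (forgetShort.map F.hom) (forgetShort.map G.hom)
      ((τ M).universal M.property).left ((τ N).universal N.property).left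
      ((τ P).universal P.property).left
    exact congrArg (fun G => SkewLaxFunctor.toMonoidal G
      (ShortMulticategory.Classifiers.isIso_assoc ((τ M).universal M.property))
      (ShortMulticategory.Classifiers.isIso_lam ((τ M).universal M.property).left)
      (ShortMulticategory.Classifiers.isIso_rho ((τ M).universal M.property))
      (ShortMulticategory.Classifiers.isIso_assoc ((τ P).universal P.property))
      (ShortMulticategory.Classifiers.isIso_lam ((τ P).universal P.property).left)
      (ShortMulticategory.Classifiers.isIso_rho ((τ P).universal P.property))) this

end RepMult

open RepMult

namespace RepMult

/-! ## Multicategories with partially defined substitution -/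

/-- A common generalization of multicategories (`s = False`) and short multicategories (`s = True`):
if `s` holds, substitution and its laws are restricted to the arities allowed in a short
multicategory. -/
structure PartialMulticategory (s : Prop) where
  Obj : Type u
  Hom : List Obj → Obj → Type v
  id (a : Obj) : Hom [a] a
  circ {bs as ds : List Obj} {b c : Obj} (x y : List Obj)
    (hb : bs = x ++ b :: y) (hd : ds = x ++ (as ++ y)) (g : Hom bs c) (f : Hom as b)
    (ok : s → SubOK bs.length as.length) : Hom ds c
  id_circ {as : List Obj} {b : Obj} (hd : as = [] ++ (as ++ [])) (ok : s → SubOK 1 as.length)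
    (f : Hom as b) : circ [] [] rfl hd (id b) f ok = f
  circ_id {bs : List Obj} {b c : Obj} (x y : List Obj) (hb : bs = x ++ b :: y)
    (hd : bs = x ++ ([b] ++ y)) (ok : s → SubOK bs.length 1) (f : Hom bs c) :
    circ x y hb hd f (id b) ok = f
  assoc {cs bs as gs es ds : List Obj} {b c d : Obj} (x y x' y' : List Obj)
    (hc : cs = x ++ c :: y) (hb : bs = x' ++ b :: y')
    (hg : gs = x' ++ (as ++ y')) (hd : ds = x ++ (gs ++ y))
    (he : es = x ++ (bs ++ y)) (he' : es = (x ++ x') ++ b :: (y' ++ y))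
    (hd' : ds = (x ++ x') ++ (as ++ (y' ++ y)))
    (h : Hom cs d) (g : Hom bs c) (f : Hom as b)
    (ok : s → AssocOK cs.length bs.length as.length)
    (ok₁ : s → SubOK cs.length gs.length) (ok₂ : s → SubOK bs.length as.length)
    (ok₃ : s → SubOK es.length as.length) (ok₄ : s → SubOK cs.length bs.length) :
    circ x y hc hd h (circ x' y' hb hg g f ok₂) ok₁ =
      circ (x ++ x') (y' ++ y) he' hd' (circ x y hc he h g ok₄) f ok₃
  comm {cs bs as es es' ds : List Obj} {b c d : Obj} (x y z : List Obj)
    (hc : cs = x ++ b :: (y ++ c :: z)) (hc' : cs = (x ++ b :: y) ++ c :: z)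
    (he : es = x ++ (bs ++ (y ++ c :: z))) (he' : es = (x ++ (bs ++ y)) ++ c :: z)
    (hf : es' = (x ++ b :: y) ++ (as ++ z)) (hf' : es' = x ++ b :: (y ++ (as ++ z)))
    (hd : ds = (x ++ (bs ++ y)) ++ (as ++ z)) (hd' : ds = x ++ (bs ++ (y ++ (as ++ z))))
    (h : Hom cs d) (g : Hom bs b) (f : Hom as c)
    (ok : s → CommOK cs.length bs.length as.length)
    (ok₁ : s → SubOK es.length as.length) (ok₂ : s → SubOK cs.length bs.length)
    (ok₃ : s → SubOK es'.length bs.length) (ok₄ : s → SubOK cs.length as.length) :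
    circ (x ++ (bs ++ y)) z he' hd (circ x (y ++ c :: z) hc he h g ok₂) f ok₁ =
      circ x (y ++ (as ++ z)) hf' hd' (circ (x ++ b :: y) z hc' hf h f ok₄) g ok₃

namespace PartialMulticategory

variable {s : Prop}

theorem subOK_unary {n : ℕ} : s → SubOK n 1 := fun _ => Or.inr (Or.inl rfl)

theorem subOK_into_unary {n : ℕ} : s → SubOK 1 n := fun _ => Or.inl rfl

theorem subOK_binary {n : ℕ} (h : s → n + 2 ≤ 4) : s → SubOK (n + 1) 2 := by
  intro hs; have := h hs; unfold SubOK; omega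

theorem subOK_nullary {n : ℕ} (h : s → n + 2 ≤ 4) : s → SubOK (n + 1) 0 := by
  intro hs; have := h hs; unfold SubOK; omega

theorem circ_congr (C : PartialMulticategory.{v, u} s) {bs as ds x x' y y' : List C.Obj}
    {b c : C.Obj} (ex : x = x') (ey : y = y') (hb : bs = x ++ b :: y) (hd : ds = x ++ (as ++ y))
    (hb' : bs = x' ++ b :: y') (hd' : ds = x' ++ (as ++ y')) (ok : s → SubOK bs.length as.length)
    (g : C.Hom bs c) (f : C.Hom as b) :
    C.circ x y hb hd g f ok = C.circ x' y' hb' hd' g f ok := by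
  subst ex ey; rfl

/-- Associativity for substitution of composites `g ∘₁ f` into an arbitrary variable. -/
theorem assoc_first (C : PartialMulticategory.{v, u} s) {cs as es ds y' gs : List C.Obj}
    {b c d : C.Obj} (x y : List C.Obj) (hc : cs = x ++ c :: y) (hg : gs = [] ++ (as ++ y'))
    (hd : ds = x ++ (gs ++ y)) (he : es = x ++ (b :: y' ++ y)) (he' : es = x ++ b :: (y' ++ y))
    (hd' : ds = x ++ (as ++ (y' ++ y)))
    (h : C.Hom cs d) (g : C.Hom (b :: y') c) (f : C.Hom as b)
    (ok : s → AssocOK cs.length (y'.length + 1) as.length)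
    (ok₁ : s → SubOK cs.length gs.length) (ok₂ : s → SubOK (y'.length + 1) as.length)
    (ok₃ : s → SubOK es.length as.length) (ok₄ : s → SubOK cs.length (y'.length + 1)) :
    C.circ x y hc hd h (C.circ [] y' rfl hg g f ok₂) ok₁ =
      C.circ x (y' ++ y) he' hd' (C.circ x y hc he h g ok₄) f ok₃ :=
  (C.assoc x y [] y' hc rfl hg hd he (by simpa using he') (by simpa using hd')
    h g f ok ok₁ ok₂ ok₃ ok₄).trans (C.circ_congr (List.append_nil x) rfl _ _ _ _ _ _ _)

/-- If `t ∘ θ = θ' ∘ p`, then `(g ∘₁ t) ∘₁ θ = (g ∘₁ θ') ∘ p`. -/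
theorem exchange (C : PartialMulticategory.{v, u} s) {y cs es as ds x' y' fs : List C.Obj}
    {m m' b z : C.Obj} (g : C.Hom (m' :: y) z) (t : C.Hom [m] m') (θ : C.Hom cs m)
    (θ' : C.Hom es m') (p : C.Hom as b) (hcs : cs = [] ++ (cs ++ [])) (he : es = x' ++ b :: y')
    (hcs' : cs = x' ++ (as ++ y')) (hds : ds = [] ++ (cs ++ y)) (hfs : fs = [] ++ (es ++ y))
    (hfs' : fs = x' ++ b :: (y' ++ y)) (hds' : ds = x' ++ (as ++ (y' ++ y)))
    (ok : s → SubOK (y.length + 1) cs.length) (ok₁ : s → SubOK es.length as.length)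
    (ok₂ : s → SubOK (y.length + 1) es.length) (ok₃ : s → SubOK fs.length as.length)
    (ok₄ : s → AssocOK (y.length + 1) es.length as.length)
    (e : C.circ [] [] rfl hcs t θ subOK_into_unary = C.circ x' y' he hcs' θ' p ok₁) :
    C.circ [] y rfl hds (C.circ [] y rfl rfl g t subOK_unary) θ ok =
      C.circ x' (y' ++ y) hfs' hds' (C.circ [] y rfl hfs g θ' ok₂) p ok₃ := by
  have h₁ := C.assoc [] y [] [] rfl rfl hcs hds rfl rfl hds g t θ
    (fun _ => Or.inr (Or.inl rfl)) ok subOK_into_unary ok subOK_unary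
  have h₂ := C.assoc [] y x' y' rfl he hcs' hds hfs hfs' hds' g θ' p ok₄ ok ok₁ ok₃ ok₂
  exact h₁.symm.trans ((congrArg (fun k => C.circ [] y rfl hds g k ok) e).trans h₂)

/-- A functor of partial multicategories. -/
structure Map (C D : PartialMulticategory.{v, u} s) where
  obj : C.Obj → D.Obj
  map {as : List C.Obj} {b : C.Obj} (hs : s → as.length ≤ 4) (f : C.Hom as b) :
    D.Hom (as.map obj) (obj b)
  map_id (a : C.Obj) (hs : s → [a].length ≤ 4) : map hs (C.id a) = D.id (obj a)
  map_circ {bs as ds x y : List C.Obj} {b c : C.Obj}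
    (hb : bs = x ++ b :: y) (hd : ds = x ++ (as ++ y))
    (hbs : s → bs.length ≤ 4) (has : s → as.length ≤ 4) (hds : s → ds.length ≤ 4)
    (ok : s → SubOK bs.length as.length)
    (ok' : s → SubOK (bs.map obj).length (as.map obj).length)
    (hb' : bs.map obj = x.map obj ++ obj b :: y.map obj)
    (hd' : ds.map obj = x.map obj ++ (as.map obj ++ y.map obj))
    (g : C.Hom bs c) (f : C.Hom as b) :
    map hds (C.circ x y hb hd g f ok) =
      D.circ (x.map obj) (y.map obj) hb' hd' (map hbs g) (map has f) ok'

/-- A choice of binary and nullary multimaps that are universal in the first variable. -/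
structure LeftUniversal (C : PartialMulticategory.{v, u} s) where
  tensor : C.Obj → C.Obj → C.Obj
  θ (a b : C.Obj) : C.Hom [a, b] (tensor a b)
  unit : C.Obj
  u : C.Hom [] unit
  bijective_θ (a b : C.Obj) (y : List C.Obj) (z : C.Obj) (ok : s → SubOK (y.length + 1) 2) :
    Function.Bijective fun f : C.Hom (tensor a b :: y) z =>
      C.circ (ds := a :: b :: y) [] y rfl rfl f (θ a b) ok
  bijective_u (y : List C.Obj) (z : C.Obj) (ok : s → SubOK (y.length + 1) 0) :
    Function.Bijective fun f : C.Hom (unit :: y) z => C.circ (ds := y) [] y rfl rfl f u ok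

/-- The values of a functor of partial multicategories on unary maps and classifiers, with the
equations making it a lax monoidal functor. -/
structure LaxData (C D : PartialMulticategory.{v, u} s) (cl : C.LeftUniversal) where
  obj : C.Obj → D.Obj
  map {a b : C.Obj} (f : C.Hom [a] b) : D.Hom [obj a] (obj b)
  map_id (a : C.Obj) : map (C.id a) = D.id (obj a)
  map_comp {a b c : C.Obj} (g : C.Hom [b] c) (f : C.Hom [a] b) :
    map (C.circ [] [] rfl rfl g f subOK_unary) =
      D.circ [] [] rfl rfl (map g) (map f) subOK_unary
  φ (a b : C.Obj) : D.Hom [obj a, obj b] (obj (cl.tensor a b))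
  φ₀ : D.Hom [] (obj cl.unit)
  nat_left {a a' b : C.Obj} (t : C.Hom [cl.tensor a b] (cl.tensor a' b)) (p : C.Hom [a] a') :
    C.circ (ds := [a, b]) [] [] rfl rfl t (cl.θ a b) subOK_into_unary =
      C.circ [] [b] rfl rfl (cl.θ a' b) p subOK_unary →
    D.circ (ds := [obj a, obj b]) [] [] rfl rfl (map t) (φ a b) subOK_into_unary =
      D.circ [] [obj b] rfl rfl (φ a' b) (map p) subOK_unary
  nat_right {a b b' : C.Obj} (t : C.Hom [cl.tensor a b] (cl.tensor a b')) (p : C.Hom [b] b') :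
    C.circ (ds := [a, b]) [] [] rfl rfl t (cl.θ a b) subOK_into_unary =
      C.circ [a] [] rfl rfl (cl.θ a b') p subOK_unary →
    D.circ (ds := [obj a, obj b]) [] [] rfl rfl (map t) (φ a b) subOK_into_unary =
      D.circ [obj a] [] rfl rfl (φ a b') (map p) subOK_unary
  associativity {a b c : C.Obj}
    (t : C.Hom [cl.tensor (cl.tensor a b) c] (cl.tensor a (cl.tensor b c))) :
    C.circ (ds := [a, b, c]) [] [] rfl rfl t
      (C.circ (ds := [a, b, c]) [] [c] rfl rfl (cl.θ (cl.tensor a b) c) (cl.θ a b) (subOK_binary (by simp))) subOK_into_unary =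
      C.circ [a] [] rfl rfl (cl.θ a (cl.tensor b c)) (cl.θ b c) (subOK_binary (by simp)) →
    D.circ (ds := [obj a, obj b, obj c]) [] [] rfl rfl (map t)
      (D.circ (ds := [obj a, obj b, obj c]) [] [obj c] rfl rfl (φ (cl.tensor a b) c) (φ a b) (subOK_binary (by simp))) subOK_into_unary =
      D.circ [obj a] [] rfl rfl (φ a (cl.tensor b c)) (φ b c) (subOK_binary (by simp))
  left_unit (a : C.Obj) :
    map (C.circ [] [a] rfl rfl (cl.θ cl.unit a) cl.u (subOK_nullary (by simp))) =
      D.circ [] [obj a] rfl rfl (φ cl.unit a) φ₀ (subOK_nullary (by simp))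
  right_unit (a : C.Obj) :
    map (C.circ [a] [] rfl rfl (cl.θ a cl.unit) cl.u (subOK_nullary (by simp))) =
      D.circ [obj a] [] rfl rfl (φ a cl.unit) φ₀ (subOK_nullary (by simp))

section extension

variable {C D : PartialMulticategory.{v, u} s} {cl : C.LeftUniversal}

namespace LeftUniversal

variable (cl)

/-- The multimap `g` with `g ∘₁ θ = f`. -/
noncomputable def split {a b z : C.Obj} {y : List C.Obj} (ok : s → SubOK (y.length + 1) 2)
    (f : C.Hom (a :: b :: y) z) : C.Hom (cl.tensor a b :: y) z :=
  (Equiv.ofBijective _ (cl.bijective_θ a b y z ok)).symm f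

theorem circ_split {a b z : C.Obj} {y : List C.Obj} (ok : s → SubOK (y.length + 1) 2)
    (g : C.Hom (cl.tensor a b :: y) z) :
    cl.split ok (C.circ (ds := a :: b :: y) [] y rfl rfl g (cl.θ a b) ok) = g :=
  (Equiv.ofBijective _ (cl.bijective_θ a b y z ok)).symm_apply_apply g

/-- The unary map `g` with `g ∘ u = f`. -/
noncomputable def split₀ {z : C.Obj} (f : C.Hom [] z) : C.Hom [cl.unit] z :=
  (Equiv.ofBijective _ (cl.bijective_u [] z subOK_into_unary)).symm f

theorem circ_split₀ {z : C.Obj} (g : C.Hom [cl.unit] z) :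
    cl.split₀ (C.circ (ds := []) [] [] rfl rfl g cl.u subOK_into_unary) = g :=
  (Equiv.ofBijective _ (cl.bijective_u [] z subOK_into_unary)).symm_apply_apply g

end LeftUniversal

namespace LaxData

variable (L : LaxData C D cl)

/-- The extension of lax data to multimaps of positive arity. -/
noncomputable def extend : (as : List C.Obj) → (m : C.Obj) → (s → as.length + 1 ≤ 4) →
    (z : C.Obj) → C.Hom (m :: as) z → D.Hom (L.obj m :: as.map L.obj) (L.obj z)
  | [], m, _, z, f => L.map f
  | a :: as, m, h, z, f =>
    D.circ [] (as.map L.obj) rfl rfl (extend as (cl.tensor m a)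
      (fun hs => (Nat.le_succ _).trans (h hs)) z (cl.split (subOK_binary h) f)) (L.φ m a)
      (by simpa using subOK_binary h)

/-- The extension of lax data to all multimaps. -/
noncomputable def ext : {as : List C.Obj} → (h : s → as.length ≤ 4) → {z : C.Obj} →
    C.Hom as z → D.Hom (as.map L.obj) (L.obj z)
  | [], _, z, f => D.circ [] [] rfl rfl (L.map (cl.split₀ f)) L.φ₀ subOK_into_unary
  | m :: as, h, z, f => L.extend as m h z f

theorem ext_unary {a z : C.Obj} (h : s → [a].length ≤ 4) (f : C.Hom [a] z) :
    L.ext h f = L.map f := rfl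

theorem ext_u {z : C.Obj} (h : s → ([] : List C.Obj).length ≤ 4)
    (ok : s → SubOK 1 0) (f : C.Hom [cl.unit] z) :
    L.ext h (C.circ (ds := []) [] [] rfl rfl f cl.u ok) =
      D.circ [] [] rfl rfl (L.map f) L.φ₀ subOK_into_unary :=
  congrArg (fun t => D.circ [] [] rfl rfl (L.map t) L.φ₀ subOK_into_unary) (cl.circ_split₀ f)

theorem ext_θ {m a z : C.Obj} {y : List C.Obj} {y' : List D.Obj}
    (hy : y' = y.map L.obj) (h : s → (m :: a :: y).length ≤ 4)
    (h' : s → (cl.tensor m a :: y).length ≤ 4) (ok : s → SubOK (y.length + 1) 2)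
    (hb' : (cl.tensor m a :: y).map L.obj = [] ++ L.obj (cl.tensor m a) :: y')
    (hd' : (m :: a :: y).map L.obj = [] ++ ([L.obj m, L.obj a] ++ y'))
    (ok' : s → SubOK (List.map L.obj (cl.tensor m a :: y)).length 2)
    (f : C.Hom (cl.tensor m a :: y) z) :
    L.ext h (C.circ [] y rfl rfl f (cl.θ m a) ok) =
      D.circ [] y' hb' hd' (L.ext h' f) (L.φ m a) ok' := by
  subst hy
  exact congrArg (fun t => D.circ [] (y.map L.obj) rfl rfl (L.ext h' t) (L.φ m a) ok')
    (cl.circ_split (subOK_binary h) f)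

theorem ext_circ_late {m a b z : C.Obj} {x y as es : List C.Obj} {x' y' as' : List D.Obj}
    (hx : x' = x.map L.obj) (hy : y' = y.map L.obj) (has : as' = as.map L.obj)
    (he : es = x ++ (as ++ y)) (hb : m :: a :: (x ++ b :: y) = (m :: a :: x) ++ b :: y)
    (hd : m :: a :: es = (m :: a :: x) ++ (as ++ y))
    (hb' : (m :: a :: (x ++ b :: y)).map L.obj = (L.obj m :: L.obj a :: x') ++ L.obj b :: y')
    (hd' : (m :: a :: es).map L.obj = (L.obj m :: L.obj a :: x') ++ (as' ++ y'))
    (h : s → (m :: a :: (x ++ b :: y)).length ≤ 4) (h' : s → (m :: a :: es).length ≤ 4)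
    (h₁ : s → (cl.tensor m a :: (x ++ b :: y)).length ≤ 4)
    (h₃ : s → (cl.tensor m a :: es).length ≤ 4)
    (okc : s → CommOK ((x ++ b :: y).length + 1) 2 as.length)
    (ok₁ : s → SubOK ((x ++ b :: y).length + 1) 2)
    (ok : s → SubOK (m :: a :: (x ++ b :: y)).length as.length)
    (ok' : s → SubOK ((m :: a :: (x ++ b :: y)).map L.obj).length as'.length)
    (ok₂ : s → SubOK (cl.tensor m a :: (x ++ b :: y)).length as.length)
    (ok₂' : s → SubOK ((cl.tensor m a :: (x ++ b :: y)).map L.obj).length as'.length)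
    (hb₂ : cl.tensor m a :: (x ++ b :: y) = (cl.tensor m a :: x) ++ b :: y)
    (hd₂ : cl.tensor m a :: es = (cl.tensor m a :: x) ++ (as ++ y))
    (hb₂' : (cl.tensor m a :: (x ++ b :: y)).map L.obj =
      (L.obj (cl.tensor m a) :: x') ++ L.obj b :: y')
    (hd₂' : (cl.tensor m a :: es).map L.obj = (L.obj (cl.tensor m a) :: x') ++ (as' ++ y'))
    (g : C.Hom (cl.tensor m a :: (x ++ b :: y)) z) (q : C.Hom as b) (q' : D.Hom as' (L.obj b))
    (ih : L.ext h₃ (C.circ (cl.tensor m a :: x) y hb₂ hd₂ g q ok₂) =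
      D.circ (L.obj (cl.tensor m a) :: x') y' hb₂' hd₂' (L.ext h₁ g) q' ok₂') :
    L.ext h' (C.circ (m :: a :: x) y hb hd
        (C.circ [] (x ++ b :: y) rfl rfl g (cl.θ m a) ok₁) q ok) =
      D.circ (L.obj m :: L.obj a :: x') y' hb' hd'
        (L.ext h (C.circ [] (x ++ b :: y) rfl rfl g (cl.θ m a) ok₁)) q' ok' := by
  subst hx hy has he
  have ok₃ := subOK_binary h'
  have e := C.comm [] x y (bs := [m, a]) rfl rfl rfl rfl hd₂ rfl rfl rfl g (cl.θ m a) q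
    okc ok ok₁ ok₃ ok₂
  have e' := D.comm [] (x.map L.obj) (y.map L.obj) (bs := [L.obj m, L.obj a])
    (cs := L.obj (cl.tensor m a) :: (x ++ b :: y).map L.obj)
    (es' := L.obj (cl.tensor m a) :: (x ++ (as ++ y)).map L.obj) (by simp)
    hb₂' (by simp) hb' hd₂' (by simp) hd' (by simp)
    (L.ext (as := cl.tensor m a :: (x ++ b :: y)) h₁ g) (L.φ m a) q'
    (by simpa using okc) ok' (by simpa using ok₁) (by simpa using ok₃) ok₂'
  refine (congrArg (L.ext h') e).trans ((L.ext_θ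
    (y' := x.map L.obj ++ (as.map L.obj ++ y.map L.obj)) (by simp) h' h₃ ok₃ (by simp) (by simp)
    (by simpa using ok₃) _).trans ?_)
  refine Eq.trans ?_ (e'.symm.trans ?_)
  · congr 1
  · congr 1
    exact (L.ext_θ (by simp) h h₁ ok₁ _ _ (by simpa using ok₁) g).symm

theorem ext_circ_unary (as : List C.Obj) : ∀ (m : C.Obj) {x y : List C.Obj} {x' y' : List D.Obj}
    {ds : List C.Obj} {b b' z : C.Obj} (hx : x' = x.map L.obj) (hy : y' = y.map L.obj)
    (hb : m :: as = x ++ b :: y) (hd : ds = x ++ ([b'] ++ y))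
    (hb' : (m :: as).map L.obj = x' ++ L.obj b :: y')
    (hd' : ds.map L.obj = x' ++ ([L.obj b'] ++ y'))
    (h : s → (m :: as).length ≤ 4) (h' : s → ds.length ≤ 4)
    (ok : s → SubOK (m :: as).length 1) (ok' : s → SubOK ((m :: as).map L.obj).length 1)
    (f : C.Hom (m :: as) z) (p : C.Hom [b'] b),
    L.ext h' (C.circ x y hb hd f p ok) = D.circ x' y' hb' hd' (L.ext h f) (L.map p) ok' := by
  induction as with
  | nil =>
    intro m x y x' y' ds b b' z hx hy hb hd hb' hd' h h' ok ok' f p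
    rcases x with _ | ⟨c, x⟩
    · obtain ⟨rfl, rfl⟩ := List.cons.inj hb
      subst hx hy hd
      exact L.map_comp f p
    · simp at hb
  | cons a as ih =>
    intro m x y x' y' ds b b' z hx hy hb hd hb' hd' h h' ok ok' f p
    obtain ⟨g, rfl⟩ := (cl.bijective_θ m a as z (subOK_binary h)).2 f
    have h₁ : s → (cl.tensor m a :: as).length ≤ 4 := fun hs => (Nat.le_succ _).trans (h hs)
    have ok₁ : s → SubOK (as.length + 1) 2 := subOK_binary h
    have ok₁' : s → SubOK ((as.map L.obj).length + 1) 2 := by simpa using ok₁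
    have ok₂ : s → AssocOK (as.length + 1) 2 1 := fun _ => Or.inr (Or.inr (Or.inl rfl))
    have ok₂' : s → AssocOK ((as.map L.obj).length + 1) 2 1 :=
      fun _ => Or.inr (Or.inr (Or.inl rfl))
    rcases x with _ | ⟨c, _ | ⟨c', x⟩⟩
    · obtain ⟨rfl, rfl⟩ := List.cons.inj hb
      subst hx hy hd
      obtain ⟨t, ht⟩ := (cl.bijective_θ b' a [] _ subOK_into_unary).2
        (C.circ [] [a] rfl rfl (cl.θ m a) p subOK_unary)
      have e := C.exchange g t (cl.θ b' a) (cl.θ m a) p rfl rfl rfl rfl rfl rfl rfl ok₁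
        subOK_unary ok₁ subOK_unary ok₂ ht
      have e' := D.exchange (L.ext h₁ g) (L.map t) (L.φ b' a) (L.φ m a) (L.map p) rfl rfl rfl rfl
        rfl rfl rfl ok₁' subOK_unary ok₁' subOK_unary ok₂' (L.nat_left t p ht)
      refine (congrArg (L.ext h') e.symm).trans ((L.ext_θ rfl h' h₁ ok₁ rfl rfl ok₁' _).trans ?_)
      rw [ih _ rfl rfl rfl rfl rfl rfl h₁ h₁ subOK_unary subOK_unary g t]
      refine e'.trans ?_
      congr 1
      exact (L.ext_θ rfl h h₁ ok₁ rfl rfl ok₁' g).symm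
    · obtain ⟨rfl, hb₁⟩ := List.cons.inj hb
      obtain ⟨rfl, rfl⟩ := List.cons.inj hb₁
      subst hx hy hd
      obtain ⟨t, ht⟩ := (cl.bijective_θ m b' [] _ subOK_into_unary).2
        (C.circ [m] [] rfl rfl (cl.θ m a) p subOK_unary)
      have e := C.exchange g t (cl.θ m b') (cl.θ m a) p rfl rfl rfl rfl rfl rfl rfl ok₁
        subOK_unary ok₁ subOK_unary ok₂ ht
      have e' := D.exchange (L.ext h₁ g) (L.map t) (L.φ m b') (L.φ m a) (L.map p) rfl rfl rfl rfl
        rfl rfl rfl ok₁' subOK_unary ok₁' subOK_unary ok₂' (L.nat_right t p ht)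
      refine (congrArg (L.ext h') e.symm).trans ((L.ext_θ rfl h' h₁ ok₁ rfl rfl ok₁' _).trans ?_)
      rw [ih _ rfl rfl rfl rfl rfl rfl h₁ h₁ subOK_unary subOK_unary g t]
      refine e'.trans ?_
      congr 1
      exact (L.ext_θ rfl h h₁ ok₁ rfl rfl ok₁' g).symm
    · obtain ⟨rfl, hb₁⟩ := List.cons.inj hb
      obtain ⟨rfl, rfl⟩ := List.cons.inj hb₁
      subst hx hy hd
      have h₂ : s → (m :: a :: (x ++ ([b'] ++ y))).length ≤ 4 := h'
      exact L.ext_circ_late (as' := [L.obj b']) rfl rfl rfl rfl rfl rfl hb' hd' h h' h₁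
        (fun hs => (Nat.le_succ _).trans (h₂ hs)) (fun _ => Or.inr (Or.inl rfl)) ok₁ ok ok'
        subOK_unary subOK_unary rfl rfl (by simp) (by simp) g p (L.map p)
        (ih _ (x := cl.tensor m a :: x) rfl rfl rfl rfl _ _ h₁ _ subOK_unary subOK_unary g p)

theorem ext_circ_θ (as : List C.Obj) : ∀ (m : C.Obj) {x y : List C.Obj} {x' y' : List D.Obj}
    {ds : List C.Obj} {c d z : C.Obj} (hx : x' = x.map L.obj) (hy : y' = y.map L.obj)
    (hb : m :: as = x ++ cl.tensor c d :: y) (hd : ds = x ++ ([c, d] ++ y))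
    (hb' : (m :: as).map L.obj = x' ++ L.obj (cl.tensor c d) :: y')
    (hd' : ds.map L.obj = x' ++ ([L.obj c, L.obj d] ++ y'))
    (h : s → (m :: as).length ≤ 4) (h' : s → ds.length ≤ 4)
    (ok : s → SubOK (m :: as).length 2) (ok' : s → SubOK ((m :: as).map L.obj).length 2)
    (f : C.Hom (m :: as) z),
    L.ext h' (C.circ x y hb hd f (cl.θ c d) ok) =
      D.circ x' y' hb' hd' (L.ext h f) (L.φ c d) ok' := by
  induction as with
  | nil =>
    intro m x y x' y' ds c d z hx hy hb hd hb' hd' h h' ok ok' f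
    rcases x with _ | ⟨e, x⟩
    · obtain ⟨rfl, rfl⟩ := List.cons.inj hb
      subst hx hd
      exact L.ext_θ hy h' h ok _ _ ok' f
    · simp at hb
  | cons a as ih =>
    intro m x y x' y' ds c d z hx hy hb hd hb' hd' h h' ok ok' f
    rcases x with _ | ⟨e, _ | ⟨e, x⟩⟩
    · obtain ⟨rfl, rfl⟩ := List.cons.inj hb
      subst hx hd
      exact L.ext_θ hy h' h ok _ _ ok' f
    · obtain ⟨g, rfl⟩ := (cl.bijective_θ m a as z (subOK_binary h)).2 f
      obtain ⟨rfl, hb₁⟩ := List.cons.inj hb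
      obtain ⟨rfl, rfl⟩ := List.cons.inj hb₁
      subst hx hy hd
      have hl : s → as.length + 3 ≤ 4 := h'
      have h₁ : s → (cl.tensor m (cl.tensor c d) :: as).length ≤ 4 :=
        fun hs => (Nat.le_succ _).trans (h hs)
      have h₂ : s → (cl.tensor m c :: d :: as).length ≤ 4 := h
      have ok₁ : s → SubOK (as.length + 1) 2 := subOK_binary h
      have ok₁' : s → SubOK ((as.map L.obj).length + 1) 2 := by simpa using ok₁
      have ok₂ : s → AssocOK (as.length + 1) 2 2 := fun hs => by
        have := hl hs; unfold AssocOK; omega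
      have ok₂' : s → AssocOK ((as.map L.obj).length + 1) 2 2 := by simpa using ok₂
      have ok₃ : s → SubOK (as.length + 1) 3 := fun hs => by
        have := hl hs; unfold SubOK; omega
      have ok₃' : s → SubOK ((as.map L.obj).length + 1) 3 := by simpa using ok₃
      obtain ⟨r, hr⟩ := (cl.bijective_θ m c [d] _ (subOK_binary (by simp))).2
        (C.circ [m] [] rfl rfl (cl.θ m (cl.tensor c d)) (cl.θ c d) (subOK_binary (by simp)))
      obtain ⟨t, rfl⟩ := (cl.bijective_θ (cl.tensor m c) d [] _ subOK_into_unary).2 r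
      have ht := (C.assoc [] [] [] [d] rfl rfl rfl rfl rfl rfl rfl t (cl.θ (cl.tensor m c) d)
        (cl.θ m c) (fun _ => Or.inl rfl) subOK_into_unary (subOK_binary (by simp))
        (subOK_binary (by simp)) subOK_into_unary).trans hr
      have e := (C.assoc [] as [] [d] rfl rfl rfl rfl rfl rfl rfl
        (C.circ [] as rfl rfl g t subOK_unary) (cl.θ (cl.tensor m c) d)
        (cl.θ m c) ok₂ ok₃ (subOK_binary (by simp)) ok ok₁).symm.trans
        (C.exchange (cs := [m, c, d]) g t _ (cl.θ m (cl.tensor c d)) (cl.θ c d) rfl rfl rfl rfl rfl rfl rfl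
          ok₃ (subOK_binary (by simp)) ok₁ ok ok₂ ht)
      have e' := (D.assoc [] (as.map L.obj) [] [L.obj d] rfl rfl rfl rfl rfl rfl rfl
        (D.circ [] (as.map L.obj) rfl rfl (L.ext h₁ g) (L.map t) subOK_unary)
        (L.φ (cl.tensor m c) d) (L.φ m c) ok₂' ok₃' (subOK_binary (by simp)) ok' ok₁').symm.trans
        (D.exchange (cs := [L.obj m, L.obj c, L.obj d]) (L.ext h₁ g) (L.map t) _
          (L.φ m (cl.tensor c d)) (L.φ c d) rfl rfl rfl rfl
          rfl rfl rfl ok₃' (subOK_binary (by simp)) ok₁' ok' ok₂' (L.associativity t ht))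
      refine (congrArg (L.ext h') e.symm).trans
        ((L.ext_θ rfl h' h₂ ok rfl rfl ok' _).trans ?_)
      refine Eq.trans ?_ (e'.trans ?_)
      · congr 1
        refine (L.ext_θ rfl h₂ h₁ ok₁ rfl rfl ok₁' _).trans ?_
        congr 1
        exact L.ext_circ_unary as _ rfl rfl rfl rfl rfl rfl h₁ h₁ subOK_unary subOK_unary g t
      · congr 1
        exact (L.ext_θ rfl h h₁ ok₁ rfl rfl ok₁' g).symm
    · obtain ⟨g, rfl⟩ := (cl.bijective_θ m a as z (subOK_binary h)).2 f
      obtain ⟨rfl, hb₁⟩ := List.cons.inj hb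
      obtain ⟨rfl, rfl⟩ := List.cons.inj hb₁
      subst hx hy hd
      have h₂ : s → (m :: a :: (x ++ ([c, d] ++ y))).length ≤ 4 := h'
      have h₁ : s → (cl.tensor m a :: (x ++ cl.tensor c d :: y)).length ≤ 4 :=
        fun hs => (Nat.le_succ _).trans (h hs)
      have hl : s → (x ++ cl.tensor c d :: y).length + 2 ≤ 3 := fun hs => by
        have := h₂ hs
        simp only [List.length_cons, List.length_append, List.length_nil] at this ⊢
        omega
      have ok₂ : s → SubOK ((x ++ cl.tensor c d :: y).length + 1) 2 := fun hs => by
        have := hl hs; unfold SubOK; omega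
      exact L.ext_circ_late (as' := [L.obj c, L.obj d]) rfl rfl rfl rfl rfl rfl hb' hd' h h' h₁
        (fun hs => (Nat.le_succ _).trans (h₂ hs))
        (fun hs => by
          have := hl hs
          simp only [List.length_cons, List.length_append] at this
          simp [CommOK]; omega)
        (subOK_binary h) ok ok' ok₂ (by simpa using ok₂) rfl rfl (by simp) (by simp) g _ (L.φ c d)
        (ih _ (x := cl.tensor m a :: x) rfl rfl rfl rfl _ _ h₁ _ ok₂ _ g)

theorem ext_circ_u (as : List C.Obj) : ∀ (m : C.Obj) {x y : List C.Obj} {x' y' : List D.Obj}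
    {ds : List C.Obj} {z : C.Obj} (hx : x' = x.map L.obj) (hy : y' = y.map L.obj)
    (hb : m :: as = x ++ cl.unit :: y) (hd : ds = x ++ ([] ++ y))
    (hb' : (m :: as).map L.obj = x' ++ L.obj cl.unit :: y')
    (hd' : ds.map L.obj = x' ++ ([] ++ y'))
    (h : s → (m :: as).length ≤ 3) (h₀ : s → (m :: as).length ≤ 4) (h' : s → ds.length ≤ 4)
    (ok : s → SubOK (m :: as).length 0) (ok' : s → SubOK ((m :: as).map L.obj).length 0)
    (f : C.Hom (m :: as) z),
    L.ext h' (C.circ x y hb hd f cl.u ok) = D.circ x' y' hb' hd' (L.ext h₀ f) L.φ₀ ok' := by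
  induction as with
  | nil =>
    intro m x y x' y' ds z hx hy hb hd hb' hd' h h₀ h' ok ok' f
    rcases x with _ | ⟨e, x⟩
    · obtain ⟨rfl, rfl⟩ := List.cons.inj hb
      subst hx hy hd
      exact L.ext_u h' ok f
    · simp at hb
  | cons a as ih =>
    intro m x y x' y' ds z hx hy hb hd hb' hd' h h₀ h' ok ok' f
    obtain ⟨g, rfl⟩ := (cl.bijective_θ m a as z (subOK_binary h₀)).2 f
    have h₁ : s → (cl.tensor m a :: as).length ≤ 4 := fun hs => (Nat.le_succ _).trans (h₀ hs)
    have hl : s → as.length + 2 ≤ 3 := h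
    have ok₁ : s → SubOK (as.length + 1) 2 := subOK_binary h₀
    have ok₁' : s → SubOK ((as.map L.obj).length + 1) 2 := by simpa using ok₁
    have ok₂ : s → AssocOK (as.length + 1) 2 0 := fun hs => by
      have := hl hs; unfold AssocOK; omega
    have ok₂' : s → AssocOK ((as.map L.obj).length + 1) 2 0 := by simpa using ok₂
    rcases x with _ | ⟨e, _ | ⟨e, x⟩⟩
    · obtain ⟨rfl, rfl⟩ := List.cons.inj hb
      subst hx hy hd
      have e := C.assoc [] as [] [a] rfl rfl rfl rfl rfl rfl rfl g (cl.θ cl.unit a) cl.u ok₂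
        subOK_unary (subOK_nullary (by simp)) ok ok₁
      have e' := D.assoc [] (as.map L.obj) [] [L.obj a] rfl rfl rfl rfl rfl rfl rfl
        (L.ext h₁ g) (L.φ cl.unit a) L.φ₀ ok₂' subOK_unary (subOK_nullary (by simp)) ok' ok₁'
      refine (congrArg (L.ext h') e.symm).trans ((L.ext_circ_unary as _ rfl rfl rfl rfl rfl rfl
        h₁ h' subOK_unary subOK_unary g _).trans ?_)
      rw [L.left_unit]
      refine e'.trans ?_
      congr 1
      exact (L.ext_θ rfl h₀ h₁ ok₁ rfl rfl ok₁' g).symm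
    · obtain ⟨rfl, hb₁⟩ := List.cons.inj hb
      obtain ⟨rfl, rfl⟩ := List.cons.inj hb₁
      subst hx hy hd
      have e := C.assoc [] as [m] [] rfl rfl rfl rfl rfl rfl rfl g (cl.θ m cl.unit) cl.u ok₂
        subOK_unary (subOK_nullary (by simp)) ok ok₁
      have e' := D.assoc [] (as.map L.obj) [L.obj m] [] rfl rfl rfl rfl rfl rfl rfl
        (L.ext h₁ g) (L.φ m cl.unit) L.φ₀ ok₂' subOK_unary (subOK_nullary (by simp)) ok' ok₁'
      refine (congrArg (L.ext h') e.symm).trans ((L.ext_circ_unary as _ rfl rfl rfl rfl rfl rfl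
        h₁ h' subOK_unary subOK_unary g _).trans ?_)
      rw [L.right_unit]
      refine e'.trans ?_
      congr 1
      exact (L.ext_θ rfl h₀ h₁ ok₁ rfl rfl ok₁' g).symm
    · obtain ⟨rfl, hb₁⟩ := List.cons.inj hb
      obtain ⟨rfl, rfl⟩ := List.cons.inj hb₁
      subst hx hy hd
      have ok₃ : s → SubOK ((x ++ cl.unit :: y).length + 1) 0 := fun hs => by
        have : (x ++ cl.unit :: y).length + 2 ≤ 3 := hl hs
        unfold SubOK; omega
      exact L.ext_circ_late (as' := []) rfl rfl rfl rfl rfl rfl hb' hd' h₀ h' h₁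
        (fun hs => (Nat.le_succ _).trans (h' hs))
        (fun hs => by
          have : (x ++ cl.unit :: y).length + 2 ≤ 3 := hl hs
          simp only [List.length_cons, List.length_append] at this
          simp [CommOK]; omega)
        ok₁ ok ok' ok₃ (by simpa using ok₃) rfl rfl (by simp) (by simp) g _ L.φ₀
        (ih _ (x := cl.tensor m a :: x) rfl rfl rfl rfl _ _
          (fun hs => (Nat.le_succ _).trans (h hs)) h₁ _ ok₃ _ g)

theorem ext_circ {bs as ds : List C.Obj} {x y : List C.Obj} {b z : C.Obj}
    (hb : bs = x ++ b :: y) (hd : ds = x ++ (as ++ y))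
    (hb' : bs.map L.obj = x.map L.obj ++ L.obj b :: y.map L.obj)
    (hd' : ds.map L.obj = x.map L.obj ++ (as.map L.obj ++ y.map L.obj))
    (h : s → bs.length ≤ 4) (ha : s → as.length ≤ 4) (h' : s → ds.length ≤ 4)
    (ok : s → SubOK bs.length as.length)
    (ok' : s → SubOK (bs.map L.obj).length (as.map L.obj).length)
    (g : C.Hom bs z) (f : C.Hom as b) :
    L.ext h' (C.circ x y hb hd g f ok) =
      D.circ (x.map L.obj) (y.map L.obj) hb' hd' (L.ext h g) (L.ext ha f) ok' := by
  have hl : s → ds.length + 1 = bs.length + as.length := fun _ => by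
    subst hb hd; simp only [List.length_append, List.length_cons]; omega
  rcases as with _ | ⟨a, as⟩
  · obtain ⟨f, rfl⟩ := (cl.bijective_u [] b subOK_into_unary).2 f
    have he : x ++ cl.unit :: y = x ++ ([cl.unit] ++ y) := rfl
    have hl' : s → (x ++ cl.unit :: y).length ≤ 3 := fun hs => by
      have h₁ := ok hs
      have : (x ++ cl.unit :: y).length = bs.length := by subst hb; simp
      rw [this]; unfold SubOK at h₁; simp at h₁; omega
    have hl₂ : s → (x ++ cl.unit :: y).length ≤ 4 := fun hs => (hl' hs).trans (by omega)
    have ok₁ : s → SubOK (x ++ cl.unit :: y).length 0 := by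
      subst hb; simpa using ok
    have ok₁' : s → SubOK ((x ++ cl.unit :: y).map L.obj).length 0 := by
      simpa using ok₁
    have e := C.assoc_first (es := x ++ cl.unit :: y) (y' := []) x y hb rfl hd rfl rfl hd g f cl.u
      (fun _ => Or.inr (Or.inl rfl)) ok subOK_into_unary ok₁ subOK_unary
    have e' := D.assoc_first (es := (x ++ cl.unit :: y).map L.obj) (y' := []) (x.map L.obj)
      (y.map L.obj) hb' rfl hd' (by simp) (by simp) hd' (L.ext h g) (L.map f) L.φ₀
      (fun _ => Or.inr (Or.inl rfl)) ok' subOK_into_unary ok₁' subOK_unary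
    have key : ∀ (l : List C.Obj) (hl : l = x ++ cl.unit :: y) (h₃ : s → l.length ≤ 3)
        (h₄ : s → l.length ≤ 4) (okl : s → SubOK l.length 0)
        (okl' : s → SubOK (l.map L.obj).length 0) (k : C.Hom l z),
        L.ext h' (C.circ x y hl hd k cl.u okl) = D.circ (x.map L.obj) (y.map L.obj)
          (by subst hl; simp) hd' (L.ext h₄ k) L.φ₀ okl' := by
      intro l hl h₃ h₄ okl okl' k
      rcases l with _ | ⟨m, l⟩
      · simp at hl
      · exact L.ext_circ_u l m rfl rfl hl hd _ hd' h₃ h₄ h' okl okl' k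
    have key₁ : L.ext hl₂ (C.circ x y hb he g f subOK_unary) = D.circ (x.map L.obj) (y.map L.obj)
        hb' (by simp) (L.ext h g) (L.map f) subOK_unary := by
      rcases bs with _ | ⟨m, bs⟩
      · simp at hb
      · exact L.ext_circ_unary bs m rfl rfl hb he _ _ h _ _ _ g f
    refine (congrArg (L.ext h') e).trans ((key _ rfl hl' hl₂ ok₁ ok₁' _).trans ?_)
    rw [key₁]
    refine e'.symm.trans ?_
    congr 1
    exact (L.ext_u _ _ f).symm
  · have main : ∀ (as : List C.Obj) (a b z : C.Obj) (bs ds x y : List C.Obj)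
        (hb : bs = x ++ b :: y) (hd : ds = x ++ (a :: as ++ y))
        (hb' : bs.map L.obj = x.map L.obj ++ L.obj b :: y.map L.obj)
        (hd' : ds.map L.obj = x.map L.obj ++ ((a :: as).map L.obj ++ y.map L.obj))
        (h : s → bs.length ≤ 4) (ha : s → (a :: as).length ≤ 4) (h' : s → ds.length ≤ 4)
        (ok : s → SubOK bs.length (a :: as).length)
        (ok' : s → SubOK (bs.map L.obj).length ((a :: as).map L.obj).length)
        (g : C.Hom bs z) (f : C.Hom (a :: as) b),
        L.ext h' (C.circ x y hb hd g f ok) =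
          D.circ (x.map L.obj) (y.map L.obj) hb' hd' (L.ext h g) (L.ext ha f) ok' := by
      clear! as a b bs ds x y
      intro as
      induction as with
      | nil =>
        intro a b z bs ds x y hb hd hb' hd' h ha h' ok ok' g f
        rcases bs with _ | ⟨m, bs⟩
        · simp at hb
        · exact L.ext_circ_unary bs m rfl rfl hb hd _ _ h _ _ _ g f
      | cons a' as ih =>
        intro a b z bs ds x y hb hd hb' hd' h ha h' ok ok' g f
        have ha₁ : s → (cl.tensor a a' :: as).length ≤ 4 := fun hs => (Nat.le_succ _).trans (ha hs)
        have hl : s → ds.length = bs.length + as.length + 1 := fun _ => by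
          subst hb hd; simp only [List.length_append, List.length_cons]; omega
        have hk : (x ++ (cl.tensor a a' :: as ++ y)).length = bs.length + as.length := by
          subst hb; simp only [List.length_append, List.length_cons]; omega
        have okθ : s → SubOK (as.length + 1) 2 := subOK_binary ha
        have okθ' : s → SubOK ((as.map L.obj).length + 1) 2 := by simpa using okθ
        obtain ⟨k, rfl⟩ := (cl.bijective_θ a a' as b okθ).2 f
        have ok₁ : s → SubOK bs.length (as.length + 1) := fun hs => by
          have h₁ := ok hs; have h₂ := h' hs; have h₃ := hl hs
          simp only [List.length_cons] at h₁; unfold SubOK at h₁ ⊢; omega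
        have ok₁' : s → SubOK (bs.map L.obj).length ((as.map L.obj).length + 1) := by
          simpa using ok₁
        have ok₂ : s → AssocOK bs.length (as.length + 1) 2 := fun hs => by
          have h₁ := ok hs; have h₂ := h' hs; have h₃ := hl hs
          simp only [List.length_cons] at h₁; unfold SubOK at h₁; unfold AssocOK; omega
        have ok₂' : s → AssocOK (bs.map L.obj).length ((as.map L.obj).length + 1) 2 := by
          simpa using ok₂
        have hl₁ : s → (x ++ (cl.tensor a a' :: as ++ y)).length ≤ 4 := fun hs => by
          have h₂ := h' hs; have h₃ := hl hs; omega
        have ok₃ : s → SubOK (x ++ (cl.tensor a a' :: as ++ y)).length 2 := fun hs => by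
          have h₂ := h' hs; have h₃ := hl hs
          have : 0 < bs.length := by subst hb; simp
          rw [hk]; unfold SubOK; omega
        have ok₃' : s → SubOK ((x ++ (cl.tensor a a' :: as ++ y)).map L.obj).length 2 := by
          rw [List.length_map]; exact ok₃
        have e := C.assoc_first (es := x ++ (cl.tensor a a' :: as ++ y)) (y' := as) x y hb rfl hd
          rfl rfl hd g k (cl.θ a a') ok₂ ok okθ ok₃ ok₁
        have e' := D.assoc_first (es := (x ++ (cl.tensor a a' :: as ++ y)).map L.obj)
          (y' := as.map L.obj) (x.map L.obj) (y.map L.obj) hb' rfl hd' (by simp) (by simp) hd' (L.ext h g) (L.ext ha₁ k) (L.φ a a') ok₂' ok' okθ' ok₃' ok₁'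
        have key : ∀ (l : List C.Obj) (hl : l = x ++ cl.tensor a a' :: (as ++ y))
            (h₄ : s → l.length ≤ 4) (okl : s → SubOK l.length 2)
            (okl' : s → SubOK (l.map L.obj).length 2) (k : C.Hom l z),
            L.ext h' (C.circ x (as ++ y) hl hd k (cl.θ a a') okl) =
              D.circ (x.map L.obj) (as.map L.obj ++ y.map L.obj)
              (by subst hl; simp) hd' (L.ext h₄ k) (L.φ a a') okl' := by
          intro l hl h₄ okl okl' k
          rcases l with _ | ⟨m, l⟩
          · simp at hl
          · exact L.ext_circ_θ l m rfl (by simp) hl hd _ hd' h₄ h' okl okl' k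
        refine (congrArg (L.ext h') e).trans ((key _ rfl hl₁ ok₃ ok₃' _).trans ?_)
        rw [ih (cl.tensor a a') b z bs _ x y hb rfl hb' (by simp) h ha₁ hl₁ ok₁ ok₁' g k]
        refine e'.symm.trans ?_
        congr 1
        exact (L.ext_θ rfl ha ha₁ okθ rfl rfl okθ' k).symm
    exact main as a b z bs ds x y hb hd hb' hd' h ha h' ok ok' g f

theorem ext_classifier_θ {a b : C.Obj} (h : s → [a, b].length ≤ 4) :
    L.ext h (cl.θ a b) = L.φ a b := by
  have e := L.ext_θ (y := []) rfl h (fun _ => (by decide : 1 ≤ 4)) subOK_into_unary rfl rfl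
    subOK_into_unary (C.id (cl.tensor a b))
  rw [C.id_circ rfl] at e
  refine e.trans ?_
  rw [L.ext_unary, L.map_id]
  exact D.id_circ rfl _ _

theorem ext_classifier_u (h : s → ([] : List C.Obj).length ≤ 4) : L.ext h cl.u = L.φ₀ := by
  have e := L.ext_u h subOK_into_unary (C.id cl.unit)
  rw [C.id_circ rfl, L.map_id] at e
  exact e.trans (D.id_circ rfl _ _)

/-- The functor of partial multicategories determined by lax data. -/
noncomputable def toMap : Map C D where
  obj := L.obj
  map h f := L.ext h f
  map_id a _ := L.map_id a
  map_circ hb hd hbs has hds ok ok' hb' hd' g f := L.ext_circ hb hd hb' hd' hbs has hds ok ok' g f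

end LaxData

/-- Functors of partial multicategories are determined by their values on unary maps and
classifiers. -/
theorem LaxData.eq_ext (L : LaxData C D cl)
    (map : ∀ {as : List C.Obj} {b : C.Obj} (hs : s → as.length ≤ 4) (f : C.Hom as b),
      D.Hom (as.map L.obj) (L.obj b))
    (hm : ∀ {a b : C.Obj} (f : C.Hom [a] b), map (by simp) f = L.map f)
    (hθ : ∀ {a b z : C.Obj} {y : List C.Obj} (h : s → (a :: b :: y).length ≤ 4)
      (h' : s → (cl.tensor a b :: y).length ≤ 4)
      (ok : s → SubOK (y.length + 1) 2) (ok' : s → SubOK ((y.map L.obj).length + 1) 2)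
      (f : C.Hom (cl.tensor a b :: y) z),
      map h (C.circ [] y rfl rfl f (cl.θ a b) ok) =
        D.circ [] (y.map L.obj) rfl rfl (map h' f) (L.φ a b) ok')
    (hu : ∀ {z : C.Obj} (f : C.Hom [cl.unit] z),
      map (by simp) (C.circ (ds := []) [] [] rfl rfl f cl.u subOK_into_unary) =
        D.circ [] [] rfl rfl (L.map f) L.φ₀ subOK_into_unary)
    {as : List C.Obj} {b : C.Obj} (hs : s → as.length ≤ 4) (f : C.Hom as b) :
    map hs f = L.ext hs f := by
  rcases as with _ | ⟨a, as⟩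
  · obtain ⟨f, rfl⟩ := (cl.bijective_u [] b subOK_into_unary).2 f
    exact (hu f).trans (L.ext_u _ _ f).symm
  · induction as generalizing a with
    | nil => exact hm f
    | cons a' as ih =>
      have okθ : s → SubOK (as.length + 1) 2 := subOK_binary hs
      have okθ' : s → SubOK ((as.map L.obj).length + 1) 2 := by simpa using okθ
      have ha₁ : s → (cl.tensor a a' :: as).length ≤ 4 := fun h => (Nat.le_succ _).trans (hs h)
      obtain ⟨k, rfl⟩ := (cl.bijective_θ a a' as b okθ).2 f
      refine (hθ hs ha₁ okθ okθ' k).trans (Eq.trans ?_ (L.ext_θ rfl hs ha₁ okθ rfl rfl okθ' k).symm)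
      rw [ih _ ha₁ k]

end extension

end PartialMulticategory

/-! ## Morphisms of left representable short multicategories as lax monoidal functors -/

open PartialMulticategory

namespace ShortMulticategory

theorem length_le_of_subOK {A : Type u} {bs as ds x y : List A} {b : A} (hb : bs = x ++ b :: y)
    (hd : ds = x ++ (as ++ y)) (ok : SubOK bs.length as.length) (ld : ds.length ≤ 4) :
    bs.length ≤ 4 ∧ as.length ≤ 4 := by
  subst hb hd
  unfold SubOK at ok
  simp only [List.length_append, List.length_cons] at *
  omega

/-- A short multicategory as a partial multicategory. -/
def toPartial (C : ShortMulticategory.{v, u}) : PartialMulticategory.{v, u} True where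
  Obj := C.Obj
  Hom as b := ∀ h : as.length ≤ 4, C.Hom as h b
  id a := fun _ => C.id a
  circ x y hb hd g f ok := fun ld =>
    C.circ x y hb hd (ok trivial) (g (length_le_of_subOK hb hd (ok trivial) ld).1)
      (f (length_le_of_subOK hb hd (ok trivial) ld).2)
  id_circ hd ok f := funext fun _ => C.id_circ hd (ok trivial) _
  circ_id x y hb hd ok f := funext fun _ => C.circ_id x y hb hd (ok trivial) _
  assoc x y x' y' hc hb hg hd he he' hd' h g f ok ok₁ ok₂ ok₃ ok₄ := funext fun _ =>
    C.assoc x y x' y' hc hb hg hd he he' hd' (ok trivial) _ _ _ _ _ _ _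
  comm x y z hc hc' he he' hf hf' hd hd' h g f ok ok₁ ok₂ ok₃ ok₄ := funext fun _ =>
    C.comm x y z hc hc' he he' hf hf' hd hd' (ok trivial) _ _ _ _ _ _ _

theorem map_post₃ {C D : ShortMulticategory.{v, u}} (F : ShortMultifunctor C D) {a b c y z : C.Obj}
    (q : y ⟶ z) (f : C.H₃ a b c y) :
    F.map (as' := [F.obj a, F.obj b, F.obj c]) (la' := by simp) rfl (post q f) =
      post (F.map₁ q) (F.map (as' := [F.obj a, F.obj b, F.obj c]) (la' := by simp) rfl f) :=
  F.map_circ (x := []) (y := []) rfl rfl (Or.inl rfl) (Or.inl rfl) rfl rfl rfl rfl rfl rfl rfl q f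

/-- Left universal classifiers in a short multicategory. -/
def Classifiers.LeftUniversal.toPartial {C : ShortMulticategory.{v, u}} {cl : C.Classifiers}
    (hc : cl.LeftUniversal) : C.toPartial.LeftUniversal where
  tensor := cl.tensor
  θ a b := fun _ => cl.θ a b
  unit := cl.unit
  u := fun _ => cl.u
  bijective_θ a b y z ok := by
    have hy : ([] : List C.Obj).length + y.length ≤ 2 := by
      have := ok trivial; unfold SubOK at this; simp only [List.length_nil]; omega
    have hy' : y.length + 2 ≤ 4 := by simp only [List.length_nil] at hy; omega
    have hb := hc.1 a b y hy z
    refine ⟨fun f g h => funext fun _ => hb.1 (congrFun h hy'), fun k => ?_⟩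
    obtain ⟨f, hf⟩ := hb.2 (k hy')
    exact ⟨fun _ => f, funext fun _ => hf⟩
  bijective_u y z ok := by
    have hy : ([] : List C.Obj).length + y.length ≤ 2 := by
      have := ok trivial; unfold SubOK at this; simp only [List.length_nil]; omega
    have hy' : y.length ≤ 4 := by simp only [List.length_nil] at hy; omega
    have hb := hc.2 y hy z
    refine ⟨fun f g h => funext fun _ => hb.1 (congrFun h hy'), fun k => ?_⟩
    obtain ⟨f, hf⟩ := hb.2 (k hy')
    exact ⟨fun _ => f, funext fun _ => hf⟩

section

variable {C D : ShortMulticategory.{v, u}}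

/-- The morphism of short multicategories underlying a functor of partial multicategories. -/
def ofMap (F : Map C.toPartial D.toPartial) : ShortMultifunctor C D where
  obj := F.obj
  map {as as' b la la'} h f := ShortMultifunctor.recast (la := (List.length_map F.obj).le.trans la) h
    (F.map (fun _ => la) (fun _ => f) ((List.length_map F.obj).le.trans la))
  map_id a := congrFun (F.map_id a fun _ => Nat.le_add_left 1 3) (Nat.le_add_left 1 3)
  map_circ {bs as ds x y bs' as' ds' x' y' b c lb la ld lb' la' ld'}
      hb hd ok ok' h₁ h₂ h₃ hx hy hb' hd' g f := by
    subst h₁ h₂ h₃ hx hy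
    exact congrFun (F.map_circ hb hd (fun _ => lb) (fun _ => la) (fun _ => ld) (fun _ => ok)
      (fun _ => ok') hb' hd' (fun _ => g) (fun _ => f)) ld'

variable {cl : C.Classifiers} {dl : D.Classifiers}

theorem Classifiers.tensorHom_eq {a b c d : C.Obj} {f : a ⟶ b} {g : c ⟶ d}
    {t : cl.tensor a c ⟶ cl.tensor b d} (h : post t (cl.θ a c) = p22 (p21 (cl.θ b d) f) g) :
    t = cl.tensorHom f g :=
  cl.ext₂ (h.trans (cl.post_tensorHom f g).symm)

section lax

variable {Φ : C.Obj ⥤ D.Obj} {ε : dl.unit ⟶ Φ.obj cl.unit}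
  {μ : ∀ a b : C.Obj, dl.tensor (Φ.obj a) (Φ.obj b) ⟶ Φ.obj (cl.tensor a b)}

theorem lax_nat_left {a a' b : C.Obj} {t : cl.tensor a b ⟶ cl.tensor a' b} {p : a ⟶ a'}
    (e : dl.tensorHom (Φ.map p) (𝟙 (Φ.obj b)) ≫ μ a' b = μ a b ≫ Φ.map (cl.tensorHom p (𝟙 b)))
    (h : post t (cl.θ a b) = p21 (cl.θ a' b) p) :
    post (Φ.map t) (post (μ a b) (dl.θ (Φ.obj a) (Φ.obj b))) =
      p21 (post (μ a' b) (dl.θ (Φ.obj a') (Φ.obj b))) (Φ.map p) := by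
  obtain rfl : t = cl.tensorHom p (𝟙 b) := Classifiers.tensorHom_eq (by rw [h, p22_id])
  rw [← post_comp, ← e, post_comp, dl.post_tensorHom, p22_id, post_p21]

theorem lax_nat_right {a b b' : C.Obj} {t : cl.tensor a b ⟶ cl.tensor a b'} {p : b ⟶ b'}
    (e : dl.tensorHom (𝟙 (Φ.obj a)) (Φ.map p) ≫ μ a b' = μ a b ≫ Φ.map (cl.tensorHom (𝟙 a) p))
    (h : post t (cl.θ a b) = p22 (cl.θ a b') p) :
    post (Φ.map t) (post (μ a b) (dl.θ (Φ.obj a) (Φ.obj b))) =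
      p22 (post (μ a b') (dl.θ (Φ.obj a) (Φ.obj b'))) (Φ.map p) := by
  obtain rfl : t = cl.tensorHom (𝟙 a) p := Classifiers.tensorHom_eq (by rw [h, p21_id])
  rw [← post_comp, ← e, post_comp, dl.post_tensorHom, p21_id, post_p22]

theorem lax_associativity (hc : cl.LeftUniversal) (hd : dl.LeftUniversal) {a b c : C.Obj}
    {t : cl.tensor (cl.tensor a b) c ⟶ cl.tensor a (cl.tensor b c)}
    (e : dl.tensorHom (μ a b) (𝟙 (Φ.obj c)) ≫ μ (cl.tensor a b) c ≫
        Φ.map (Classifiers.assoc hc a b c) =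
      Classifiers.assoc hd (Φ.obj a) (Φ.obj b) (Φ.obj c) ≫
        dl.tensorHom (𝟙 (Φ.obj a)) (μ b c) ≫ μ a (cl.tensor b c))
    (h : post t (b21 (cl.θ (cl.tensor a b) c) (cl.θ a b)) =
      b22 (cl.θ a (cl.tensor b c)) (cl.θ b c)) :
    post (Φ.map t)
      (b21 (post (μ (cl.tensor a b) c) (dl.θ (Φ.obj (cl.tensor a b)) (Φ.obj c)))
        (post (μ a b) (dl.θ (Φ.obj a) (Φ.obj b)))) =
      b22 (post (μ a (cl.tensor b c)) (dl.θ (Φ.obj a) (Φ.obj (cl.tensor b c))))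
        (post (μ b c) (dl.θ (Φ.obj b) (Φ.obj c))) := by
  obtain rfl : t = Classifiers.assoc hc a b c := (Classifiers.isClassifier_θ₃ hc a b c _).1
    (h.trans ((post_b21 _ _ _).trans (Classifiers.post_assoc hc a b c)).symm)
  have h₁ : b21 (post (dl.tensorHom (μ a b) (𝟙 (Φ.obj c)) ≫ μ (cl.tensor a b) c ≫
      Φ.map (Classifiers.assoc hc a b c)) (dl.θ _ (Φ.obj c))) (dl.θ (Φ.obj a) (Φ.obj b)) =
      post (Φ.map (Classifiers.assoc hc a b c))
        (b21 (post (μ (cl.tensor a b) c) (dl.θ (Φ.obj (cl.tensor a b)) (Φ.obj c)))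
        (post (μ a b) (dl.θ (Φ.obj a) (Φ.obj b)))) := by
    rw [post_comp, dl.post_tensorHom, p22_id, post_p21, b21_p21, post_comp, post_b21]
  rw [← h₁, e, post_comp, Classifiers.post_assoc', post_comp, dl.post_tensorHom, p21_id,
    post_p22, b22_p22]

theorem lax_left_unit (hc : cl.LeftUniversal) (hd : dl.LeftUniversal) (a : C.Obj)
    (e : dl.tensorHom ε (𝟙 (Φ.obj a)) ≫ μ cl.unit a ≫ Φ.map (Classifiers.lam hc a) =
      Classifiers.lam hd (Φ.obj a)) :
    Φ.map (n21 (cl.θ cl.unit a) cl.u) =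
      n21 (post (μ cl.unit a) (dl.θ (Φ.obj cl.unit) (Φ.obj a))) (post ε dl.u) := by
  have := Classifiers.isIso_lam hc a
  have h₁ : n21 (post (μ cl.unit a) (dl.θ (Φ.obj cl.unit) (Φ.obj a))) (post ε dl.u) =
      n21 (dl.θ dl.unit (Φ.obj a)) dl.u ≫ dl.tensorHom ε (𝟙 (Φ.obj a)) ≫ μ cl.unit a := by
    rw [← n21_p21, ← n21_post, post_comp, dl.post_tensorHom, p22_id, post_p21]
  rw [h₁, ← cancel_mono (Φ.map (Classifiers.lam hc a)), ← Φ.map_comp, Classifiers.n21_lam,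
    Φ.map_id, Category.assoc, Category.assoc, e, Classifiers.n21_lam]

theorem lax_right_unit (a : C.Obj)
    (e : dl.rho (Φ.obj a) ≫ dl.tensorHom (𝟙 (Φ.obj a)) ε ≫ μ a cl.unit = Φ.map (cl.rho a)) :
    Φ.map (n22 (cl.θ a cl.unit) cl.u) =
      n22 (post (μ a cl.unit) (dl.θ (Φ.obj a) (Φ.obj cl.unit))) (post ε dl.u) := by
  refine e.symm.trans ?_
  rw [Classifiers.rho, ← n22_p22, n22_comp, post_comp, dl.post_tensorHom, p21_id, post_p22]

end lax

variable (hc : cl.LeftUniversal) (hd : dl.LeftUniversal)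
  (G : SkewLaxFunctor (cl.toSkew hc) (dl.toSkew hd))

/-- The lax data determined by a lax monoidal functor. -/
noncomputable def laxData : LaxData C.toPartial D.toPartial hc.toPartial where
  obj := G.functor.obj
  map {a b : C.Obj} f := fun _ => G.functor.map (f (by decide : 1 ≤ 4) : a ⟶ b)
  map_id a := funext fun _ => G.functor.map_id a
  map_comp {a b c : C.Obj} g f := funext fun _ =>
    G.functor.map_comp (f (by decide : 1 ≤ 4) : a ⟶ b) (g (by decide : 1 ≤ 4) : b ⟶ c)
  φ a b := fun _ => post (G.f₂ a b) (dl.θ (G.functor.obj a) (G.functor.obj b))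
  φ₀ := fun _ => post G.f₀ dl.u
  nat_left t p h := funext fun _ => lax_nat_left (C := C) (D := D) (Φ := G.functor) (μ := G.f₂)
    (G.naturality_left _ _) (congrFun h (by decide : 2 ≤ 4))
  nat_right t p h := funext fun _ => lax_nat_right (C := C) (D := D) (Φ := G.functor) (μ := G.f₂)
    (G.naturality_right _ _) (congrFun h (by decide : 2 ≤ 4))
  associativity t h := funext fun _ => lax_associativity (C := C) (D := D) (Φ := G.functor)
    (μ := G.f₂) hc hd (G.associativity _ _ _) (congrFun h (by decide : 3 ≤ 4))
  left_unit a := funext fun _ => lax_left_unit (C := C) (D := D) (Φ := G.functor) (μ := G.f₂)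
    hc hd a (G.left_unitality a)
  right_unit a := funext fun _ => lax_right_unit (C := C) (D := D) (Φ := G.functor) (μ := G.f₂) a
    (G.right_unitality a)

/-- The morphism of short multicategories determined by a lax monoidal functor. -/
noncomputable def ofLax : ShortMultifunctor C D := ofMap (laxData hc hd G).toMap

theorem toLax_ofLax : toLax (ofLax hc hd G) hc hd = G := by
  refine SkewLaxFunctor.ext rfl (heq_of_eq (dl.ext₀ ?_))
    (heq_of_eq (funext fun a => funext fun b => dl.ext₂ ?_))
  · refine (post_f₀ (ofLax hc hd G) cl dl).trans ?_
    exact congrFun ((laxData hc hd G).ext_classifier_u fun _ => (by decide : 0 ≤ 4)) (by decide : 0 ≤ 4)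
  · refine (post_f₂ (ofLax hc hd G) cl dl a b).trans ?_
    exact congrFun ((laxData hc hd G).ext_classifier_θ fun _ => (by decide : 2 ≤ 4)) (by decide : 2 ≤ 4)

theorem ofLax_toLax (F : ShortMultifunctor C D) : ofLax hc hd (toLax F hc hd) = F := by
  have key : ∀ {as : List C.Obj} {b : C.Obj} (la : True → as.length ≤ 4)
      (f : C.toPartial.Hom as b),
      (fun la' => F.map (la' := la') rfl (f (la trivial)) :
        D.toPartial.Hom (as.map F.obj) (F.obj b)) = (laxData hc hd (toLax F hc hd)).ext la f := by
    intro as b la f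
    refine LaxData.eq_ext (laxData hc hd (toLax F hc hd))
      (fun {as b} la f la' => F.map (la' := la') rfl (f (la trivial))) ?_ ?_ ?_ la f
    · intro a b f
      rfl
    · intro a b z y h h' ok ok' f
      funext ld
      refine (F.map_circ (bs := cl.tensor a b :: y) (as := [a, b])
        (as' := [F.obj a, F.obj b]) (x := []) (y := y)
        (lb' := (List.length_map F.obj).le.trans (h' trivial)) (la' := (by decide : 2 ≤ 4))
        rfl rfl (ok trivial) (ok' trivial) rfl rfl rfl rfl rfl rfl rfl
        (f (h' trivial)) (cl.θ a b)).trans ?_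
      exact congrArg _ (post_f₂ F cl dl a b).symm
    · intro z f
      funext ld
      refine (map_post₀ F (f (by decide : 1 ≤ 4)) cl.u).trans ?_
      exact congrArg _ (post_f₀ F cl dl).symm
  refine ShortMultifunctor.ext rfl ?_
  intro as as' b la la' e e' f
  subst e
  exact heq_of_eq (congrFun (key (fun _ => la) (fun _ => f)) la').symm

end

end ShortMulticategory

namespace Multicategory

open ShortMulticategory

/-- A multicategory as a partial multicategory. -/
def toPartial (M : Multicategory.{v, u}) : PartialMulticategory.{v, u} False where
  Obj := M.Obj
  Hom := M.Hom
  id := M.id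
  circ x y hb hd g f _ := M.circ x y hb hd g f
  id_circ hd _ f := M.id_circ hd f
  circ_id x y hb hd _ f := M.circ_id x y hb hd f
  assoc x y x' y' hc hb hg hd he he' hd' h g f _ _ _ _ _ :=
    M.assoc x y x' y' hc hb hg hd he he' hd' h g f
  comm x y z hc hc' he he' hf hf' hd hd' h g f _ _ _ _ _ :=
    M.comm x y z hc hc' he he' hf hf' hd hd' h g f

/-- A choice of universal multimaps in a representable multicategory. -/
noncomputable def leftUniversal {M : Multicategory.{v, u}} (h : multiRepresentable M) :
    M.toPartial.LeftUniversal where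
  tensor a b := (h [a, b]).choose
  θ a b := (h [a, b]).choose_spec.choose
  unit := (h []).choose
  u := (h []).choose_spec.choose
  bijective_θ a b y z _ := (h [a, b]).choose_spec.choose_spec.2 [] y z
  bijective_u y z _ := (h []).choose_spec.choose_spec.2 [] y z

section

variable {M N : Multicategory.{v, u}}

/-- The multifunctor underlying a functor of partial multicategories. -/
def ofMap (F : Map M.toPartial N.toPartial) : Multifunctor M N where
  obj := F.obj
  map h f := recast (H := fun l => N.Hom l _) h (F.map False.elim f)
  map_id a := F.map_id a False.elim
  map_circ hb hd h₁ h₂ h₃ hx hy hb' hd' g f := by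
    subst h₁ h₂ h₃ hx hy
    exact F.map_circ hb hd _ _ _ False.elim False.elim hb' hd' g f

variable (hM : multiRepresentable M) (F : ShortMultifunctor (forgetShort.obj M) (forgetShort.obj N))

/-- The lax data determined by a morphism of short multicategories. -/
noncomputable def laxData : LaxData M.toPartial N.toPartial (leftUniversal hM) where
  obj := F.obj
  map f := F.map₁ f
  map_id a := F.map_id a
  map_comp g f := F.functor.map_comp f g
  φ a b := F.map (as := [a, b]) (la := (by decide : 2 ≤ 4)) (as' := [F.obj a, F.obj b])
    (la' := (by decide : 2 ≤ 4)) rfl ((leftUniversal hM).θ a b)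
  φ₀ := F.map (as := []) (la := (by decide : 0 ≤ 4)) (as' := []) (la' := (by decide : 0 ≤ 4)) rfl
    (leftUniversal hM).u
  nat_left t p h := (map_post₂ F t _).symm.trans ((congrArg (F.map rfl) h).trans (map_p21 F _ p))
  nat_right t p h := (map_post₂ F t _).symm.trans ((congrArg (F.map rfl) h).trans (map_p22 F _ p))
  associativity t h := ((congrArg (post (F.map₁ t)) (map_b21 F _ _)).symm.trans
    (map_post₃ F t _).symm).trans ((congrArg (F.map rfl) h).trans (map_b22 F _ _))
  left_unit a := map_n21 F _ _
  right_unit a := map_n22 F _ _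

/-- The multifunctor determined by a morphism of short multicategories. -/
noncomputable def ofShort : Multifunctor M N := ofMap (laxData hM F).toMap

theorem ofShort_forget (F : Multifunctor M N) : ofShort hM (forgetShort.map F) = F := by
  refine Multifunctor.ext rfl ?_
  intro as as' b e e' f
  subst e
  refine heq_of_eq (LaxData.eq_ext (laxData hM (forgetShort.map F))
      (fun {as b} _ f => F.map rfl f) ?_ ?_ ?_ False.elim f).symm
  · intro a b f
    rfl
  · intro a b z y h h' ok ok' f
    exact F.map_circ (x := []) (y := y) rfl rfl rfl rfl rfl rfl rfl rfl rfl f _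
  · intro z f
    exact F.map_circ (x := []) (y := []) rfl rfl rfl rfl rfl rfl rfl rfl rfl f _

/-- The chosen universal multimaps, as classifiers. -/
noncomputable def classifiers (hM : multiRepresentable M) : M.Classifiers where
  tensor := (leftUniversal hM).tensor
  θ := (leftUniversal hM).θ
  isClassifier_θ a b := (hM [a, b]).choose_spec.choose_spec.1
  unit := (leftUniversal hM).unit
  u := (leftUniversal hM).u
  isClassifier_u := (hM []).choose_spec.choose_spec.1

theorem forget_ofShort (hN : multiRepresentable N) : forgetShort.map (ofShort hM F) = F := by
  have hc := ((classifiers hM).universal hM).left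
  have hd := ((classifiers hN).universal hN).left
  have e : ShortMulticategory.toLax (forgetShort.map (ofShort hM F)) hc hd =
      ShortMulticategory.toLax F hc hd := by
    refine SkewLaxFunctor.ext rfl (heq_of_eq ((classifiers hN).toShort.ext₀ ?_))
      (heq_of_eq (funext fun a => funext fun b => (classifiers hN).toShort.ext₂ ?_))
    · refine (post_f₀ _ _ _).trans (Eq.trans ?_ (post_f₀ F _ _).symm)
      exact (laxData hM F).ext_classifier_u False.elim
    · refine (post_f₂ _ _ _ a b).trans (Eq.trans ?_ (post_f₂ F _ _ a b).symm)
      exact (laxData hM F).ext_classifier_θ False.elim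
  rw [← ofLax_toLax hc hd (forgetShort.map (ofShort hM F)), e, ofLax_toLax]

end

end Multicategory

/-! ## Full faithfulness -/

section

open ShortMulticategory

instance functorK_full (χ : ∀ C : ShortMultiLR.{v, u}, C.obj.Classifiers) :
    (functorK χ).Full where
  map_surjective {C D} G :=
    ⟨ObjectProperty.homMk (ofLax ((χ C).leftUniversal C.property)
      ((χ D).leftUniversal D.property) G.hom), ObjectProperty.hom_ext _ (toLax_ofLax _ _ _)⟩

instance functorK_faithful (χ : ∀ C : ShortMultiLR.{v, u}, C.obj.Classifiers) :
    (functorK χ).Faithful where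
  map_injective {C D} F G h := ObjectProperty.hom_ext _ (by
    have e : toLax F.hom ((χ C).leftUniversal C.property) ((χ D).leftUniversal D.property) =
        toLax G.hom ((χ C).leftUniversal C.property) ((χ D).leftUniversal D.property) :=
      congrArg (fun k => k.hom) h
    rw [← ofLax_toLax ((χ C).leftUniversal C.property) ((χ D).leftUniversal D.property) F.hom, e,
      ofLax_toLax])

instance forgetRep_full : forgetRep.{v, u}.Full where
  map_surjective {M N} F :=
    ⟨ObjectProperty.homMk (Multicategory.ofShort M.property F.hom),
      ObjectProperty.hom_ext _ (Multicategory.forget_ofShort _ _ N.property)⟩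

instance forgetRep_faithful : forgetRep.{v, u}.Faithful where
  map_injective {M N} F G h := ObjectProperty.hom_ext _ (by
    have e : forgetShort.map F.hom = forgetShort.map G.hom := congrArg (fun k => k.hom) h
    rw [← Multicategory.ofShort_forget M.property F.hom, e, Multicategory.ofShort_forget])

end

theorem laxToSkew_injective {C D : MonoidalCat.{v, u}} {F G : LaxMonoidalFunctor C.Obj D.Obj}
    (h : laxToSkew F = laxToSkew G) : F = G :=
  laxMonoidalFunctor_ext (congrArg SkewLaxFunctor.functor h) (congr_arg_heq SkewLaxFunctor.f₀ h)
    (congr_arg_heq SkewLaxFunctor.f₂ h)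

open MonoidalCategory in
theorem right_unitality_of_inv {A B : Type u} [Category.{v} A] [Category.{v} B]
    [MonoidalCategory A] [MonoidalCategory B] (Φ : A ⥤ B) (ε : 𝟙_ B ⟶ Φ.obj (𝟙_ A)) (a : A)
    (μ : Φ.obj a ⊗ Φ.obj (𝟙_ A) ⟶ Φ.obj (a ⊗ 𝟙_ A))
    (h : (ρ_ (Φ.obj a)).inv ≫ (𝟙 (Φ.obj a) ⊗ₘ ε) ≫ μ = Φ.map (ρ_ a).inv) :
    (ρ_ (Φ.obj a)).hom = (𝟙 (Φ.obj a) ⊗ₘ ε) ≫ μ ≫ Φ.map (ρ_ a).hom := by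
  have h' := congrArg (· ≫ Φ.map (ρ_ a).hom) h
  simp only [Category.assoc, ← Φ.map_comp, Iso.inv_hom_id, Φ.map_id] at h'
  rw [Iso.inv_comp_eq, Category.comp_id] at h'
  exact h'.symm

/-- A lax monoidal functor between skew monoidal categories coming from monoidal categories. -/
def skewToLax {C D : MonoidalCat.{v, u}} (G : SkewLaxFunctor C.toSkew D.toSkew) :
    LaxMonoidalFunctor C.Obj D.Obj :=
  letI Φ : C.Obj ⥤ D.Obj := G.functor
  { toFunctor := Φ
    laxMonoidal := Functor.LaxMonoidal.ofTensorHom (F := Φ) G.f₀ G.f₂ G.f₂_naturality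
      G.associativity (fun a => (G.left_unitality a).symm)
      (fun a => right_unitality_of_inv Φ G.f₀ a (G.f₂ a _) (G.right_unitality a)) }

instance monoidalInclusion_faithful : monoidalInclusion.{v, u}.Faithful where
  map_injective h := laxToSkew_injective (congrArg (fun k => k.hom) h)

instance monoidalInclusion_full : monoidalInclusion.{v, u}.Full where
  map_surjective G := ⟨skewToLax G.hom, rfl⟩

theorem functorKRep_comp (χ : ∀ C : ShortMultiLR.{v, u}, C.obj.Classifiers) :
    functorKRep χ ⋙ monoidalInclusion = repInclusion ⋙ functorK χ := rfl

theorem functorTRep_eq (χ : ∀ C : ShortMultiLR.{v, u}, C.obj.Classifiers) :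
    functorTRep (fun M => .ofShort (χ (repInclusion.obj (forgetRep.obj M)))) =
      forgetRep ⋙ functorKRep χ := rfl

instance functorKRep_full (χ : ∀ C : ShortMultiLR.{v, u}, C.obj.Classifiers) :
    (functorKRep χ).Full :=
  have : (functorKRep χ ⋙ monoidalInclusion).Full :=
    inferInstanceAs (repInclusion ⋙ functorK χ).Full
  Functor.Full.of_comp_faithful (functorKRep χ) monoidalInclusion

instance functorKRep_faithful (χ : ∀ C : ShortMultiLR.{v, u}, C.obj.Classifiers) :
    (functorKRep χ).Faithful :=
  have : (functorKRep χ ⋙ monoidalInclusion).Faithful :=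
    inferInstanceAs (repInclusion ⋙ functorK χ).Faithful
  Functor.Faithful.of_comp (functorKRep χ) monoidalInclusion

/-! ## Representability in terms of associators and unit maps -/

namespace ShortMulticategory

variable {C : ShortMulticategory.{v, u}}

theorem t21_post {a₁ a₂ a₃ m m' b z : C.Obj} (f : C.H₂ m b z) (p : m' ⟶ m)
    (g : C.H₃ a₁ a₂ a₃ m') : t21 f (post p g) = t21 (p21 f p) g :=
  C.assoc [] [b] [] [] rfl rfl rfl rfl rfl rfl rfl (Or.inr (Or.inl rfl)) (by simp [SubOK])
    (Or.inl rfl) (by simp [SubOK]) (Or.inr (Or.inl rfl)) f p g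

theorem p21_bijective {a a' b z : C.Obj} (p : a' ⟶ a) [IsIso p] :
    Function.Bijective fun f : C.H₂ a b z => p21 f p :=
  pre_bijective [] [b] (by simp) (asIso p)

theorem comp_bijective {a b z : C.Obj} (p : a ⟶ b) [IsIso p] :
    Function.Bijective fun f : b ⟶ z => p ≫ f :=
  ⟨fun _ _ h => (cancel_epi p).1 h, fun f => ⟨inv p ≫ f, IsIso.hom_inv_id_assoc p f⟩⟩

namespace Classifiers

variable {cl : C.Classifiers}

theorem b21_bijective (hl : cl.LeftUniversal) (a b c z : C.Obj) :
    Function.Bijective fun f : C.H₂ (cl.tensor a b) c z => b21 f (cl.θ a b) :=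
  hl.1 a b [c] (by simp) z

theorem b31_bijective (hl : cl.LeftUniversal) (a b c d z : C.Obj) :
    Function.Bijective fun f : C.H₃ (cl.tensor a b) c d z => b31 f (cl.θ a b) :=
  hl.1 a b [c, d] (by simp) z

theorem b22_bijective (hl : cl.LeftUniversal) (a b c z : C.Obj) [IsIso (cl.assoc hl a b c)] :
    Function.Bijective fun f : C.H₂ a (cl.tensor b c) z => b22 f (cl.θ b c) := by
  rw [← Function.Bijective.of_comp_iff _ (cl.isClassifier_θ a (cl.tensor b c) z)]
  convert (isClassifier_θ₃ hl a b c z).comp (comp_bijective (cl.assoc hl a b c)) using 1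
  funext f
  change b22 (post f _) _ = post (_ ≫ f) (cl.θ₃ a b c)
  rw [← post_assoc' hl f, ← post_comp, θ₃, post_b21]

theorem b32_bijective (hl : cl.LeftUniversal) (a b c d z : C.Obj) [IsIso (cl.assoc hl a b c)] :
    Function.Bijective fun f : C.H₃ a (cl.tensor b c) d z => b32 f (cl.θ b c) := by
  rw [← Function.Bijective.of_comp_iff _ (b21_bijective hl a (cl.tensor b c) d z)]
  convert (b31_bijective hl a b c d z).comp ((b21_bijective hl (cl.tensor a b) c d z).comp
    (p21_bijective (b := d) (cl.assoc hl a b c))) using 1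
  funext g
  change b32 (b21 g _) _ = b31 (b21 (p21 g _) _) _
  rw [b31_b21, ← t21_post, post_b21, post_assoc, t21_b22]

theorem b33_bijective (hl : cl.LeftUniversal) (a b c d z : C.Obj) [IsIso (cl.assoc hl (cl.tensor a b) c d)] :
    Function.Bijective fun f : C.H₃ a b (cl.tensor c d) z => b33 f (cl.θ c d) := by
  rw [← Function.Bijective.of_comp_iff _ (b21_bijective hl a b (cl.tensor c d) z)]
  convert (b31_bijective hl a b c d z).comp (b22_bijective hl (cl.tensor a b) c d z) using 1
  funext g
  exact (b31_b22 g _ _).symm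

theorem n22_bijective (a z : C.Obj) [IsIso (cl.rho a)] :
    Function.Bijective fun f : C.H₂ a cl.unit z => n22 f cl.u := by
  rw [← Function.Bijective.of_comp_iff _ (cl.isClassifier_θ a cl.unit z)]
  convert comp_bijective (z := z) (cl.rho a) using 1
  funext f
  exact (n22_comp f _ _).symm

theorem n32_bijective (hl : cl.LeftUniversal) (a b z : C.Obj) [IsIso (cl.rho a)] :
    Function.Bijective fun f : C.H₃ a cl.unit b z => n32 f cl.u := by
  rw [← Function.Bijective.of_comp_iff _ (b21_bijective hl a cl.unit b z)]
  convert p21_bijective (b := b) (z := z) (cl.rho a) using 1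
  funext g
  exact n32_b21 g _ _

theorem n33_bijective (hl : cl.LeftUniversal) (a b z : C.Obj) [IsIso (cl.rho (cl.tensor a b))] :
    Function.Bijective fun f : C.H₃ a b cl.unit z => n33 f cl.u := by
  rw [← Function.Bijective.of_comp_iff _ (b21_bijective hl a b cl.unit z)]
  convert (cl.isClassifier_θ a b z).comp (n22_bijective (cl := cl) (cl.tensor a b) z) using 1
  funext g
  exact (post_n22 g _ _).symm

theorem universal_of_isIso (hl : cl.LeftUniversal) (hα : ∀ a b c, IsIso (cl.assoc hl a b c))
    (hρ : ∀ a, IsIso (cl.rho a)) : cl.Universal := by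
  refine ⟨fun a b x y h z => ?_, fun x y h z => ?_⟩
  · match x, y, h with
    | [], y, h => exact hl.1 a b y h z
    | [c], [], h => exact b22_bijective hl c a b z
    | [c], [d], h => exact b32_bijective hl c a b d z
    | [c, d], [], h => exact b33_bijective hl c d a b z
    | [c], _ :: _ :: _, h => simp at h; omega
    | [c, d], _ :: _, h => simp at h
    | _ :: _ :: _ :: _, _, h => simp at h; omega
  · match x, y, h with
    | [], y, h => exact hl.2 y h z
    | [c], [], h => exact n22_bijective c z
    | [c], [d], h => exact n32_bijective hl c d z
    | [c, d], [], h => exact n33_bijective hl c d z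
    | [c], _ :: _ :: _, h => simp at h; omega
    | [c, d], _ :: _, h => simp at h
    | _ :: _ :: _ :: _, _, h => simp at h; omega

end Classifiers

end ShortMulticategory

theorem representable_iff (χ : ∀ C : ShortMultiLR.{v, u}, C.obj.Classifiers) (C : ShortMultiLR.{v, u}) :
    representable C.obj ↔
      (∀ a b c, IsIso (((functorK χ).obj C).obj.α a b c)) ∧
        ∀ a, IsIso (((functorK χ).obj C).obj.rho a) := by
  refine ⟨fun h => ⟨ShortMulticategory.Classifiers.isIso_assoc ((χ C).universal h),
    ShortMulticategory.Classifiers.isIso_rho ((χ C).universal h)⟩, fun h => ⟨χ C, ?_⟩⟩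
  exact ShortMulticategory.Classifiers.universal_of_isIso ((χ C).leftUniversal C.property) h.1 h.2

/-! ## The multicategory of a monoidal category -/

section multi

open MonoidalCategory

variable {V : Type u} [Category.{v} V] [MonoidalCategory V]

/-- The iterated tensor product `a₁ ⊗ (a₂ ⊗ (⋯ ⊗ m))`. -/
@[reducible] def fold : List V → V → V
  | [], m => m
  | a :: as, m => a ⊗ fold as m

/-- Functoriality of the iterated tensor product in its last variable. -/
@[reducible] def foldMap : (as : List V) → {m n : V} → (m ⟶ n) → (fold as m ⟶ fold as n)
  | [], _, _, f => f
  | a :: as, _, _, f => a ◁ foldMap as f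

theorem fold_append (x y : List V) (m : V) : fold (x ++ y) m = fold x (fold y m) := by
  induction x with
  | nil => rfl
  | cons a x ih => exact congrArg (a ⊗ ·) ih

theorem foldMap_id (as : List V) (m : V) : foldMap as (𝟙 m) = 𝟙 _ := by
  induction as with
  | nil => rfl
  | cons a as ih => simp [foldMap, ih, fold]

theorem foldMap_comp (as : List V) {m n k : V} (f : m ⟶ n) (g : n ⟶ k) :
    foldMap as (f ≫ g) = foldMap as f ≫ foldMap as g := by
  induction as with
  | nil => rfl
  | cons a as ih => simp [foldMap, ih, fold]

theorem foldMap_eqToHom (as : List V) {m n : V} (h : m = n) :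
    foldMap as (eqToHom h) = eqToHom (congrArg (fold as) h) := by
  subst h; exact foldMap_id as m

instance foldMap_isIso (as : List V) {m n : V} (f : m ⟶ n) [IsIso f] : IsIso (foldMap as f) :=
  ⟨foldMap as (inv f), by rw [← foldMap_comp, IsIso.hom_inv_id, foldMap_id],
    by rw [← foldMap_comp, IsIso.inv_hom_id, foldMap_id]⟩

theorem foldMap_append (x y : List V) {m n : V} (f : m ⟶ n) :
    foldMap (x ++ y) f = eqToHom (fold_append x y m) ≫ foldMap x (foldMap y f) ≫
      eqToHom (fold_append x y n).symm := by
  induction x with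
  | nil => exact ((Category.id_comp _).trans (Category.comp_id _)).symm
  | cons a x ih =>
    simp only [List.cons_append, foldMap, ih, whiskerLeft_comp, whiskerLeft_eqToHom]

/-- The iterated associator. -/
@[reducible] def strength : (as : List V) → (m n : V) → (fold as (m ⊗ n) ⟶ fold as m ⊗ n)
  | [], _, _ => 𝟙 _
  | a :: as, m, n => a ◁ strength as m n ≫ (α_ a (fold as m) n).inv

instance strength_isIso (as : List V) (m n : V) : IsIso (strength as m n) := by
  induction as with
  | nil => exact inferInstanceAs (IsIso (𝟙 _))
  | cons a as ih => exact inferInstanceAs (IsIso (a ◁ strength as m n ≫ (α_ a (fold as m) n).inv))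

theorem strength_naturality (as : List V) {m m' : V} (f : m ⟶ m') (n : V) :
    foldMap as (f ▷ n) ≫ strength as m' n = strength as m n ≫ foldMap as f ▷ n := by
  induction as with
  | nil => simp [foldMap, strength, fold]
  | cons a as ih =>
    simp only [foldMap, strength, Category.assoc]
    rw [← Category.assoc, ← whiskerLeft_comp, ih]
    simp

theorem strength_naturality_right (as : List V) (m : V) {n n' : V} (f : n ⟶ n') :
    foldMap as (m ◁ f) ≫ strength as m n' = strength as m n ≫ fold as m ◁ f := by
  induction as with
  | nil => simp [foldMap, strength, fold]
  | cons a as ih =>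
    simp only [foldMap, strength, Category.assoc]
    rw [← Category.assoc, ← whiskerLeft_comp, ih]
    simp [fold]

theorem eqToHom_whisker_associator_inv (a n : V) {k k' : V} (h : k = k')
    (h₁ : a ⊗ k ⊗ n = a ⊗ k' ⊗ n) (h₂ : (a ⊗ k) ⊗ n = (a ⊗ k') ⊗ n) :
    eqToHom h₁ ≫ (α_ a k' n).inv = (α_ a k n).inv ≫ eqToHom h₂ := by
  subst h; simp

theorem strength_append (x y : List V) (m n : V) :
    strength (x ++ y) m n = eqToHom (fold_append x y (m ⊗ n)) ≫ foldMap x (strength y m n) ≫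
      strength x (fold y m) n ≫ eqToHom (fold_append x y m).symm ▷ n := by
  induction x with
  | nil => simp [foldMap, strength, fold]
  | cons a x ih =>
    simp only [List.cons_append, foldMap, strength, ih, whiskerLeft_comp, whiskerLeft_eqToHom,
      Category.assoc, eqToHom_whiskerRight]
    congr 3
    exact eqToHom_whisker_associator_inv a n (fold_append x y m).symm _ _

theorem strength_assoc (as : List V) (k m n : V) :
    foldMap as (α_ k m n).inv ≫ strength as (k ⊗ m) n ≫ strength as k m ▷ n =
      strength as k (m ⊗ n) ≫ (α_ (fold as k) m n).inv := by
  induction as with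
  | nil => simp [foldMap, strength, fold]
  | cons a as ih =>
    simp only [foldMap, strength, comp_whiskerRight, Category.assoc, whisker_assoc,
      Iso.inv_hom_id_assoc]
    rw [← whiskerLeft_comp_assoc, ← whiskerLeft_comp_assoc, Category.assoc, ih]
    simp

theorem strength_rightUnitor (as : List V) (m : V) :
    strength as m (𝟙_ V) ≫ (ρ_ (fold as m)).hom = foldMap as (ρ_ m).hom := by
  induction as with
  | nil => exact Category.id_comp _
  | cons a as ih =>
    simp only [foldMap, strength, ← ih]
    simp

/-- The natural transformation `a₁ ⊗ (a₂ ⊗ (⋯ ⊗ m)) → b ⊗ m` determined by a multimap. -/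
def hat {as : List V} {b : V} (f : fold as (𝟙_ V) ⟶ b) (m : V) : fold as m ⟶ b ⊗ m :=
  foldMap as (λ_ m).inv ≫ strength as (𝟙_ V) m ≫ f ▷ m

theorem hat_naturality {as : List V} {b : V} (f : fold as (𝟙_ V) ⟶ b) {m n : V} (g : m ⟶ n) :
    foldMap as g ≫ hat f n = hat f m ≫ b ◁ g := by
  simp only [hat, Category.assoc]
  rw [← whisker_exchange, ← reassoc_of% (strength_naturality_right as (𝟙_ V) g),
    ← Category.assoc, ← Category.assoc, ← foldMap_comp, ← Category.assoc (foldMap as _),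
    ← foldMap_comp, leftUnitor_inv_naturality, Category.assoc]

theorem hat_tensor {as : List V} {b : V} (f : fold as (𝟙_ V) ⟶ b) (m n : V) :
    strength as m n ≫ hat f m ▷ n = hat f (m ⊗ n) ≫ (α_ b m n).inv := by
  simp only [hat, Category.assoc, comp_whiskerRight]
  rw [← reassoc_of% (strength_naturality as (λ_ m).inv n), associator_inv_naturality_left,
    ← reassoc_of% (strength_assoc as (𝟙_ V) m n), ← Category.assoc (foldMap as _) (foldMap as _),
    ← foldMap_comp]
  congr 2
  simp

theorem hat_unit {as : List V} {b : V} (f : fold as (𝟙_ V) ⟶ b) :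
    hat f (𝟙_ V) ≫ (ρ_ b).hom = f := by
  simp only [hat, Category.assoc, rightUnitor_naturality]
  rw [reassoc_of% (strength_rightUnitor as (𝟙_ V)), ← Category.assoc, ← foldMap_comp,
    ← unitors_equal, Iso.inv_hom_id, foldMap_id, Category.id_comp]

theorem hat_id {b : V} (m : V) : hat (as := [b]) (ρ_ b).hom m = 𝟙 _ := by
  simp [hat, foldMap, strength, fold]

theorem hat_comp {as : List V} {b c : V} (f : fold as (𝟙_ V) ⟶ b) (g : b ⟶ c) (m : V) :
    hat (f ≫ g) m = hat f m ≫ g ▷ m := by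
  simp [hat]

instance hat_isIso {as : List V} {b : V} (f : fold as (𝟙_ V) ⟶ b) [IsIso f] (m : V) :
    IsIso (hat f m) := by
  unfold hat; infer_instance

/-- Substitution of a multimap into a multimap, before composing with the latter. -/
def substMap {bs as ds : List V} {b : V} (x y : List V) (hb : bs = x ++ b :: y)
    (hd : ds = x ++ (as ++ y)) (f : fold as (𝟙_ V) ⟶ b) (m : V) : fold ds m ⟶ fold bs m :=
  eqToHom (by rw [hd, fold_append, fold_append]) ≫ foldMap x (hat f (fold y m)) ≫
    eqToHom (by rw [hb, fold_append])

theorem substMap_nil {as : List V} {b : V} (y : List V) (f : fold as (𝟙_ V) ⟶ b) (m : V) :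
    substMap [] y rfl rfl f m = eqToHom (fold_append as y m) ≫ hat f (fold y m) :=
  congrArg _ (Category.comp_id _)

theorem substMap_cons {as : List V} {b : V} (a : V) (x y : List V) (f : fold as (𝟙_ V) ⟶ b)
    (m : V) : substMap (a :: x) y rfl rfl f m = a ◁ substMap x y rfl rfl f m := by
  simp only [substMap, foldMap, whiskerLeft_comp, whiskerLeft_eqToHom]

theorem substMap_naturality {bs as ds : List V} {b : V} (x y : List V) (hb : bs = x ++ b :: y)
    (hd : ds = x ++ (as ++ y)) (f : fold as (𝟙_ V) ⟶ b) {m n : V} (g : m ⟶ n) :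
    foldMap ds g ≫ substMap x y hb hd f n = substMap x y hb hd f m ≫ foldMap bs g := by
  subst hb hd
  induction x with
  | nil =>
    simp only [List.nil_append, substMap_nil, foldMap_append, Category.assoc, eqToHom_trans_assoc,
      eqToHom_refl, Category.id_comp, hat_naturality, foldMap]
  | cons a x ih =>
    erw [substMap_cons, substMap_cons]
    exact ((whiskerLeft_comp _ _ _).symm.trans (congrArg (a ◁ ·) ih)).trans (whiskerLeft_comp _ _ _)

theorem substMap_strength {bs as ds : List V} {b : V} (x y : List V) (hb : bs = x ++ b :: y)
    (hd : ds = x ++ (as ++ y)) (f : fold as (𝟙_ V) ⟶ b) (m n : V) :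
    strength ds m n ≫ substMap x y hb hd f m ▷ n =
      substMap x y hb hd f (m ⊗ n) ≫ strength bs m n := by
  subst hb hd
  induction x with
  | nil =>
    simp only [List.nil_append, substMap_nil, strength_append, Category.assoc, comp_whiskerRight,
      eqToHom_whiskerRight, eqToHom_trans_assoc, eqToHom_refl, Category.id_comp, hat_tensor,
      reassoc_of% (hat_naturality f (strength y m n)), strength]
  | cons a x ih =>
    erw [substMap_cons, substMap_cons]
    have := congrArg (fun k => a ◁ k ≫ (α_ a _ n).inv) ih
    simp only [whiskerLeft_comp, Category.assoc] at this
    simpa [List.cons_append, strength] using this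

theorem hat_substMap {bs as ds : List V} {b c : V} (x y : List V) (hb : bs = x ++ b :: y)
    (hd : ds = x ++ (as ++ y)) (g : fold bs (𝟙_ V) ⟶ c) (f : fold as (𝟙_ V) ⟶ b) (m : V) :
    hat (substMap x y hb hd f (𝟙_ V) ≫ g) m = substMap x y hb hd f m ≫ hat g m := by
  simp only [hat, comp_whiskerRight]
  rw [reassoc_of% (substMap_strength x y hb hd f), reassoc_of% (substMap_naturality x y hb hd f)]

theorem hat_congr {as : List V} {b : V} (f : fold as (𝟙_ V) ⟶ b) {m m' : V} (h : m = m') :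
    hat f m = eqToHom (congrArg (fold as) h) ≫ hat f m' ≫ eqToHom (congrArg (b ⊗ ·) h.symm) := by
  subst h; simp

theorem substMap_append {bs as ds bs' ds' : List V} {b : V} (x x' y y' : List V)
    (hb : bs = x' ++ b :: y') (hd : ds = x' ++ (as ++ y')) (hb' : bs' = (x ++ x') ++ b :: (y' ++ y))
    (hd' : ds' = (x ++ x') ++ (as ++ (y' ++ y))) (f : fold as (𝟙_ V) ⟶ b) (m : V)
    (e : fold ds' m = fold x (fold ds (fold y m)))
    (e' : fold x (fold bs (fold y m)) = fold bs' m) :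
    substMap (x ++ x') (y' ++ y) hb' hd' f m =
      eqToHom e ≫ foldMap x (substMap x' y' hb hd f (fold y m)) ≫ eqToHom e' := by
  simp only [substMap, hat_congr f (fold_append y' y m), foldMap_append, foldMap_comp,
    foldMap_eqToHom, Category.assoc, eqToHom_trans, eqToHom_trans_assoc]

theorem substMap_prefix {bs as ds bs' ds' : List V} {b : V} (x x' y : List V)
    (hb : bs = x' ++ b :: y) (hd : ds = x' ++ (as ++ y)) (hb' : bs' = (x ++ x') ++ b :: y)
    (hd' : ds' = (x ++ x') ++ (as ++ y)) (f : fold as (𝟙_ V) ⟶ b) (m : V)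
    (e : fold ds' m = fold x (fold ds m)) (e' : fold x (fold bs m) = fold bs' m) :
    substMap (x ++ x') y hb' hd' f m =
      eqToHom e ≫ foldMap x (substMap x' y hb hd f m) ≫ eqToHom e' := by
  simp only [substMap, foldMap_append, foldMap_comp, foldMap_eqToHom, Category.assoc,
    eqToHom_trans, eqToHom_trans_assoc]

theorem substMap_comm {cs bs as es es' ds : List V} {b c : V} (x y z : List V)
    (hc : cs = x ++ b :: (y ++ c :: z)) (hc' : cs = (x ++ b :: y) ++ c :: z)
    (he : es = x ++ (bs ++ (y ++ c :: z))) (he' : es = (x ++ (bs ++ y)) ++ c :: z)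
    (hf : es' = (x ++ b :: y) ++ (as ++ z)) (hf' : es' = x ++ b :: (y ++ (as ++ z)))
    (hd : ds = (x ++ (bs ++ y)) ++ (as ++ z)) (hd' : ds = x ++ (bs ++ (y ++ (as ++ z))))
    (g : fold bs (𝟙_ V) ⟶ b) (f : fold as (𝟙_ V) ⟶ c) (m : V) :
    substMap (x ++ (bs ++ y)) z he' hd f m ≫ substMap x (y ++ c :: z) hc he g m =
      substMap x (y ++ (as ++ z)) hf' hd' g m ≫ substMap (x ++ b :: y) z hc' hf f m := by
  rw [substMap_prefix x (bs ++ y) z (List.append_assoc bs y _).symm (List.append_assoc bs y _).symm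
      he' hd f m (by simp [hd', fold_append]) (by simp [he, fold_append]),
    substMap_prefix bs y z rfl rfl _ _ f m (by simp [fold_append]) (by simp [fold_append]),
    substMap_prefix x (b :: y) z rfl rfl hc' hf f m (by simp [hf', fold_append])
      (by simp [hc, fold_append]), substMap_cons]
  simp only [substMap.eq_1 x (y ++ c :: z), substMap.eq_1 x (y ++ (as ++ z)), Category.assoc,
    eqToHom_trans_assoc, eqToHom_refl, Category.id_comp, foldMap_comp, foldMap_eqToHom]
  rw [← Category.assoc (foldMap x (foldMap bs _)), ← foldMap_comp, hat_naturality]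
  simp only [foldMap_comp, Category.assoc]

variable (V) in
/-- The multicategory of a monoidal category: a multimap `a₁, …, aₙ → b` is a map
`a₁ ⊗ (a₂ ⊗ ⋯ (aₙ ⊗ 𝟙)) → b`. -/
def toMulticategory : Multicategory.{v, u} where
  Obj := V
  Hom as b := fold as (𝟙_ V) ⟶ b
  id a := (ρ_ a).hom
  circ x y hb hd g f := substMap x y hb hd f (𝟙_ V) ≫ g
  id_circ hd f := by
    refine Eq.trans ?_ (hat_unit f)
    simp only [substMap, foldMap, eqToHom_refl, Category.comp_id, Category.id_comp]
  circ_id x y hb hd f := by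
    subst hb
    simp [substMap, hat_id, foldMap_id]
  assoc x y x' y' hc hb hg hd he he' hd' h g f := by
    rw [substMap_append x x' y y' hb hg he' hd' f (𝟙_ V)
      (by rw [hd, fold_append, fold_append]) (by rw [he, fold_append, fold_append])]
    rw [substMap, hat_substMap, substMap.eq_1 x y hc he]
    simp only [foldMap_comp, Category.assoc, eqToHom_trans_assoc, eqToHom_refl, Category.id_comp]
  comm x y z hc hc' he he' hf hf' hd hd' h g f := by
    rw [← Category.assoc, ← Category.assoc, substMap_comm x y z hc hc' he he' hf hf' hd hd' g f]

end multi

/-! ## Representability of the multicategory of a monoidal category -/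

section representable

open MonoidalCategory ShortMulticategory

variable (V : Type u) [Category.{v} V] [MonoidalCategory V]

instance substMap_isIso {V : Type u} [Category.{v} V] [MonoidalCategory V] {bs as ds : List V}
    {b : V} (x y : List V) (hb : bs = x ++ b :: y) (hd : ds = x ++ (as ++ y))
    (f : fold as (𝟙_ V) ⟶ b) [IsIso f] (m : V) : IsIso (substMap x y hb hd f m) := by
  unfold substMap; infer_instance

variable {V}

/-- Substitution of a multimap into a multimap. -/
def subst {bs as ds : List V} {b c : V} (x y : List V) (hb : bs = x ++ b :: y)
    (hd : ds = x ++ (as ++ y)) (g : fold bs (𝟙_ V) ⟶ c) (f : fold as (𝟙_ V) ⟶ b) :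
    fold ds (𝟙_ V) ⟶ c := substMap x y hb hd f (𝟙_ V) ≫ g

theorem subst_bijective {bs as ds : List V} {b : V} (x y : List V) (hb : bs = x ++ b :: y)
    (hd : ds = x ++ (as ++ y)) (f : fold as (𝟙_ V) ⟶ b) [hf : IsIso f] (z : V) :
    Function.Bijective fun g : fold bs (𝟙_ V) ⟶ z => subst x y hb hd g f :=
  ⟨fun g g' h => (cancel_epi (substMap x y hb hd f (𝟙_ V))).1 h,
    fun g => ⟨inv (substMap x y hb hd f (𝟙_ V)) ≫ g, by simp [subst]⟩⟩

variable (V) in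
theorem multiRepresentable_toMulticategory : multiRepresentable (toMulticategory V) := by
  intro (as : List V)
  refine ⟨fold (V := V) as (𝟙_ V), 𝟙 (fold (V := V) as (𝟙_ V)), ?_, ?_⟩
  · exact fun z => subst_bijective (V := V) [] [] rfl (List.append_nil as).symm
      (𝟙 (fold as (𝟙_ V))) z
  · exact fun x y z => subst_bijective (V := V) x y rfl rfl (𝟙 (fold as (𝟙_ V))) z

/-- The tensor product, as a binary multimap. -/
def binaryMap (a b : V) : fold [a, b] (𝟙_ V) ⟶ a ⊗ b := a ◁ (ρ_ b).hom

instance isIso_binaryMap (a b : V) : IsIso (binaryMap a b) := by unfold binaryMap; infer_instance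

/-- A map, as a unary multimap. -/
def unaryMap {a b : V} (f : a ⟶ b) : fold [a] (𝟙_ V) ⟶ b := (ρ_ a).hom ≫ f

theorem hat_binaryMap (a b m : V) : hat (binaryMap a b) m = (α_ a b m).inv := by
  simp [hat, binaryMap]

theorem hat_unaryMap {a b : V} (f : a ⟶ b) (m : V) : hat (unaryMap f) m = f ▷ m := by
  rw [unaryMap, hat_comp, hat_id]; exact Category.id_comp _

theorem hat_nullary (m : V) : hat (as := []) (𝟙 (𝟙_ V)) m = (λ_ m).inv := by
  simp [hat]

theorem subst_unaryMap_unaryMap {a b c : V} (f : a ⟶ b) (g : b ⟶ c) :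
    subst [] [] rfl rfl (unaryMap g) (unaryMap f) = unaryMap (f ≫ g) := by
  rw [subst, substMap_nil, hat_unaryMap]
  simp [unaryMap]

theorem subst_tensorHom {a b c d : V} (f : a ⟶ b) (g : c ⟶ d) :
    subst (ds := [a, c]) [] [] rfl rfl (unaryMap (f ⊗ₘ g)) (binaryMap a c) =
      subst [a] [] rfl rfl (subst (ds := [a, d]) [] [d] rfl rfl (binaryMap b d) (unaryMap f))
        (unaryMap g) := by
  simp only [subst, substMap_cons, substMap_nil, hat_unaryMap, hat_binaryMap]
  simp [unaryMap, binaryMap, tensorHom_def']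

theorem subst_associator (a b c : V) :
    subst (ds := [a, b, c]) [] [c] rfl rfl
        (subst (ds := [a ⊗ b, c]) [] [] rfl rfl (unaryMap (α_ a b c).hom) (binaryMap (a ⊗ b) c))
        (binaryMap a b) =
      subst [a] [] rfl rfl (binaryMap a (b ⊗ c)) (binaryMap b c) := by
  simp only [subst, substMap_cons, substMap_nil, hat_binaryMap]
  simp only [unaryMap, binaryMap, fold, eqToHom_refl, Category.id_comp]
  monoidal

theorem subst_leftUnitor (a : V) :
    subst (as := []) (ds := [a]) [] [a] rfl rfl
        (subst (ds := [𝟙_ V, a]) [] [] rfl rfl (unaryMap (λ_ a).hom) (binaryMap (𝟙_ V) a))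
        (𝟙 (𝟙_ V)) = (ρ_ a).hom := by
  simp only [subst, substMap_nil, hat_binaryMap, hat_nullary]
  simp only [unaryMap, fold, eqToHom_refl, Category.id_comp]
  monoidal

theorem subst_rightUnitor (a : V) :
    subst (as := []) (ds := [a]) [a] [] rfl rfl (binaryMap a (𝟙_ V)) (𝟙 (𝟙_ V)) =
      unaryMap (ρ_ a).inv := by
  simp only [subst, substMap_cons, substMap_nil, hat_nullary]
  simp [unaryMap, binaryMap]

variable (V)

/-- The tensor product as a binary map classifier, and the unit as a nullary one. -/
def tensorClassifiers : (forgetShort.obj (toMulticategory V)).Classifiers where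
  tensor a b := tensorObj (C := V) a b
  θ a b := binaryMap (V := V) a b
  isClassifier_θ a b z := subst_bijective (V := V) [] [] rfl rfl (binaryMap (V := V) a b)
    (hf := isIso_binaryMap (V := V) a b) z
  unit := 𝟙_ V
  u := 𝟙 (𝟙_ V)
  isClassifier_u z := subst_bijective (V := V) [] [] (as := []) rfl rfl (𝟙 (𝟙_ V)) z

theorem tensorClassifiers_universal : (tensorClassifiers V).Universal :=
  (tensorClassifiers V).universal
    (representable_forgetShort _ (multiRepresentable_toMulticategory V))

variable {V}

theorem tensorClassifiers_tensorHom {a b c d : V} (f : a ⟶ b) (g : c ⟶ d) :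
    (tensorClassifiers V).tensorHom (a := a) (b := b) (c := c) (d := d) (unaryMap (V := V) f)
      (unaryMap (V := V) g) = unaryMap (V := V) (f ⊗ₘ g) :=
  (tensorClassifiers V).ext₂ (((tensorClassifiers V).post_tensorHom _ _).trans
    (subst_tensorHom (V := V) f g).symm)

theorem tensorClassifiers_assoc (a b c : V) :
    Classifiers.assoc (tensorClassifiers_universal V).left a b c =
      unaryMap (V := V) (α_ a b c).hom :=
  (tensorClassifiers V).ext₂ (Classifiers.ext₂₁ (tensorClassifiers_universal V).left
    ((Classifiers.post_assoc _ _ _ _).trans (subst_associator (V := V) a b c).symm))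

theorem tensorClassifiers_lam (a : V) :
    Classifiers.lam (tensorClassifiers_universal V).left a = unaryMap (V := V) (λ_ a).hom :=
  (tensorClassifiers V).ext₂ (Classifiers.extu₂ (tensorClassifiers_universal V).left
    ((n21_post _ _ _).trans ((Classifiers.n21_lam _ _).trans (subst_leftUnitor (V := V) a).symm)))

theorem tensorClassifiers_rho (a : V) :
    (tensorClassifiers V).rho a = unaryMap (V := V) (ρ_ a).inv :=
  subst_rightUnitor (V := V) a

theorem unaryMap_id (a : V) : unaryMap (𝟙 a) = (ρ_ a).hom := Category.comp_id _

/-- The functor from a monoidal category to the category of unary multimaps. -/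
def toUnary : V ⥤ (forgetShort.obj (toMulticategory V)).Obj where
  obj a := a
  map f := unaryMap (V := V) f
  map_id a := unaryMap_id (V := V) a
  map_comp f g := (subst_unaryMap_unaryMap (V := V) f g).symm

/-- A unary multimap, as a map. -/
def ofUnaryMap {a b : V} (f : fold [a] (𝟙_ V) ⟶ b) : a ⟶ b := (ρ_ a).inv ≫ f

theorem ofUnaryMap_unaryMap {a b : V} (f : a ⟶ b) : ofUnaryMap (unaryMap f) = f :=
  (ρ_ a).inv_hom_id_assoc f

theorem unaryMap_ofUnaryMap {a b : V} (f : fold [a] (𝟙_ V) ⟶ b) : unaryMap (ofUnaryMap f) = f :=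
  (ρ_ a).hom_inv_id_assoc f

theorem ofUnaryMap_subst {a b c : V} (f : fold [a] (𝟙_ V) ⟶ b) (g : fold [b] (𝟙_ V) ⟶ c) :
    ofUnaryMap (subst [] [] rfl rfl g f) = ofUnaryMap f ≫ ofUnaryMap g := by
  conv_lhs => rw [← unaryMap_ofUnaryMap f, ← unaryMap_ofUnaryMap g]
  exact (congrArg ofUnaryMap (subst_unaryMap_unaryMap _ _)).trans (ofUnaryMap_unaryMap _)

/-- The functor from the category of unary multimaps to a monoidal category. -/
def ofUnary : (forgetShort.obj (toMulticategory V)).Obj ⥤ V where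
  obj a := a
  map {a b} f := ofUnaryMap (V := V) (a := a) (b := b) f
  map_id a := (ρ_ (show V from a)).inv_hom_id
  map_comp f g := ofUnaryMap_subst (V := V) f g

theorem ofUnaryMap_tensorHom {a b c d : V}
    (f : fold [a] (𝟙_ V) ⟶ b) (g : fold [c] (𝟙_ V) ⟶ d) :
    (ofUnaryMap f ⊗ₘ ofUnaryMap g : (a ⊗ c : V) ⟶ b ⊗ d) = ofUnaryMap (V := V)
      ((tensorClassifiers V).tensorHom (a := a) (b := b) (c := c) (d := d) f g) := by
  conv_rhs => rw [← unaryMap_ofUnaryMap f, ← unaryMap_ofUnaryMap g]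
  exact ((congrArg (ofUnaryMap (V := V)) (tensorClassifiers_tensorHom _ _)).trans
    (ofUnaryMap_unaryMap (V := V) _)).symm

variable (V : MonoidalCat.{v, u})

/-- The skew monoidal category of unary multimaps in the multicategory of a monoidal category. -/
noncomputable abbrev unarySkew : SkewMonoidalCategory.{v, u} :=
  (tensorClassifiers V.Obj).toSkew (tensorClassifiers_universal V.Obj).left

theorem strict_associativity {D : SkewMonoidalCategory.{v, u}} {a b c : D.Obj}
    {f f' : D.tensorObj (D.tensorObj a b) c ⟶ D.tensorObj a (D.tensorObj b c)} (h : f = f') :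
    D.tensorHom (𝟙 (D.tensorObj a b)) (𝟙 c) ≫ 𝟙 (D.tensorObj (D.tensorObj a b) c) ≫ f =
      f' ≫ D.tensorHom (𝟙 a) (𝟙 (D.tensorObj b c)) ≫ 𝟙 (D.tensorObj a (D.tensorObj b c)) := by
  simp [D.tensor_id, h]

theorem strict_left_unitality {D : SkewMonoidalCategory.{v, u}} {a : D.Obj}
    {f f' : D.tensorObj D.unit a ⟶ a} (h : f = f') :
    D.tensorHom (𝟙 D.unit) (𝟙 a) ≫ 𝟙 (D.tensorObj D.unit a) ≫ f = f' := by
  simp [D.tensor_id, h]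

theorem strict_right_unitality {D : SkewMonoidalCategory.{v, u}} {a : D.Obj}
    {f f' : a ⟶ D.tensorObj a D.unit} (h : f = f') :
    f ≫ D.tensorHom (𝟙 a) (𝟙 D.unit) ≫ 𝟙 (D.tensorObj a D.unit) = f' := by
  simp [D.tensor_id, h]

/-- `toUnary` as a lax monoidal functor. -/
noncomputable def toUnarySkew : SkewLaxFunctor V.toSkew (unarySkew V) where
  functor := toUnary (V := V.Obj)
  f₀ := 𝟙 (unarySkew V).unit
  f₂ a b := 𝟙 ((unarySkew V).tensorObj a b)
  f₂_naturality f g := by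
    refine (Category.comp_id _).trans (Eq.trans ?_ (Category.id_comp _).symm)
    exact @tensorClassifiers_tensorHom V.Obj V.category V.monoidal _ _ _ _ f g
  associativity a b c := strict_associativity (D := unarySkew V) (a := a) (b := b) (c := c)
    (tensorClassifiers_assoc (V := V.Obj) a b c).symm
  left_unitality a := strict_left_unitality (D := unarySkew V) (a := a)
    (tensorClassifiers_lam (V := V.Obj) a).symm
  right_unitality a := strict_right_unitality (D := unarySkew V) (a := a)
    (tensorClassifiers_rho (V := V.Obj) a)

/-- `ofUnary` as a lax monoidal functor. -/
noncomputable def ofUnarySkew : SkewLaxFunctor (unarySkew V) V.toSkew where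
  functor := ofUnary (V := V.Obj)
  f₀ := 𝟙 V.toSkew.unit
  f₂ a b := 𝟙 (V.toSkew.tensorObj a b)
  f₂_naturality f g := (Category.comp_id _).trans
    ((ofUnaryMap_tensorHom (V := V.Obj) f g).trans (Category.id_comp _).symm)
  associativity a b c := strict_associativity (D := V.toSkew) (a := a) (b := b) (c := c)
    ((congrArg (ofUnaryMap (V := V.Obj)) (tensorClassifiers_assoc (V := V.Obj) a b c)).trans
      (ofUnaryMap_unaryMap (V := V.Obj) _))
  left_unitality a := strict_left_unitality (D := V.toSkew) (a := a)
    ((congrArg (ofUnaryMap (V := V.Obj)) (tensorClassifiers_lam (V := V.Obj) a)).trans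
      (ofUnaryMap_unaryMap (V := V.Obj) _))
  right_unitality a := strict_right_unitality (D := V.toSkew) (a := a)
    ((congrArg (ofUnaryMap (V := V.Obj)) (tensorClassifiers_rho (V := V.Obj) a)).trans
      (ofUnaryMap_unaryMap (V := V.Obj) _)).symm

/-- A monoidal category is isomorphic to the category of unary multimaps. -/
noncomputable def unarySkewIso : V.toSkew ≅ unarySkew V where
  hom := toUnarySkew V
  inv := ofUnarySkew V
  hom_inv_id := SkewLaxFunctor.ext
    (CategoryTheory.Functor.hext (fun _ => rfl) fun a b f =>
      heq_of_eq (@ofUnaryMap_unaryMap V.Obj V.category V.monoidal a b f))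
    (heq_of_eq ((Category.id_comp _).trans ((ofUnary (V := V.Obj)).map_id _)))
    (heq_of_eq (funext fun a => funext fun b =>
      (Category.id_comp _).trans ((ofUnary (V := V.Obj)).map_id _)))
  inv_hom_id := SkewLaxFunctor.ext
    (CategoryTheory.Functor.hext (fun _ => rfl) fun a b f =>
      heq_of_eq (@unaryMap_ofUnaryMap V.Obj V.category V.monoidal a b f))
    (heq_of_eq ((Category.id_comp _).trans ((toUnary (V := V.Obj)).map_id _)))
    (heq_of_eq (funext fun a => funext fun b =>
      (Category.id_comp _).trans ((toUnary (V := V.Obj)).map_id _)))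

end representable

/-! ## The equivalences -/

section equivalences

open ShortMulticategory

/-- Independence of the choice of classifiers. -/
noncomputable def changeClassifiers {C : ShortMulticategory.{v, u}} (cl dl : C.Classifiers)
    (hc : cl.Universal) (hd : dl.Universal) : cl.toMonoidalCat hc ≅ dl.toMonoidalCat hd where
  hom := SkewLaxFunctor.toMonoidal (toLax (𝟙 C) hc.left hd.left) _ _ _ _ _ _
  inv := SkewLaxFunctor.toMonoidal (toLax (𝟙 C) hd.left hc.left) _ _ _ _ _ _
  hom_inv_id := by
    have h : SkewLaxFunctor.comp (toLax (𝟙 C) hc.left hd.left) (toLax (𝟙 C) hd.left hc.left) =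
        𝟙 (cl.toSkew hc.left) :=
      ((toLax_comp (𝟙 C) (𝟙 C) _ _ _).symm.trans
        (congrArg (fun F => toLax F hc.left hc.left) (Category.comp_id (𝟙 C)))).trans (toLax_id _)
    exact congrArg (fun G => SkewLaxFunctor.toMonoidal G (Classifiers.isIso_assoc hc)
      (Classifiers.isIso_lam hc.left) (Classifiers.isIso_rho hc) (Classifiers.isIso_assoc hc)
      (Classifiers.isIso_lam hc.left) (Classifiers.isIso_rho hc)) h
  inv_hom_id := by
    have h : SkewLaxFunctor.comp (toLax (𝟙 C) hd.left hc.left) (toLax (𝟙 C) hc.left hd.left) =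
        𝟙 (dl.toSkew hd.left) :=
      ((toLax_comp (𝟙 C) (𝟙 C) _ _ _).symm.trans
        (congrArg (fun F => toLax F hd.left hd.left) (Category.comp_id (𝟙 C)))).trans (toLax_id _)
    exact congrArg (fun G => SkewLaxFunctor.toMonoidal G (Classifiers.isIso_assoc hd)
      (Classifiers.isIso_lam hd.left) (Classifiers.isIso_rho hd) (Classifiers.isIso_assoc hd)
      (Classifiers.isIso_lam hd.left) (Classifiers.isIso_rho hd)) h

theorem changeClassifiers_naturality {C D : ShortMulticategory.{v, u}} (F : C ⟶ D)
    {cl cl' : C.Classifiers} {dl dl' : D.Classifiers} (hc : cl.Universal) (hc' : cl'.Universal)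
    (hd : dl.Universal) (hd' : dl'.Universal) :
    SkewLaxFunctor.comp (toLax F hc.left hd.left) (toLax (𝟙 D) hd.left hd'.left) =
      SkewLaxFunctor.comp (toLax (𝟙 C) hc.left hc'.left) (toLax F hc'.left hd'.left) :=
  (toLax_comp F (𝟙 D) _ _ _).symm.trans ((congrArg (fun F => toLax F hc.left hd'.left)
    ((Category.comp_id F).trans (Category.id_comp F).symm)).trans (toLax_comp (𝟙 C) F _ _ _))

variable (χ : ∀ C : ShortMultiLR.{v, u}, C.obj.Classifiers)
  (τ : ∀ M : MultiRep.{v, u}, M.obj.Classifiers)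

/-- The triangle commutes up to isomorphism for arbitrary choices of classifiers. -/
noncomputable def functorTRepIso : functorTRep τ ≅ forgetRep ⋙ functorKRep χ :=
  NatIso.ofComponents
    (fun M => changeClassifiers (τ M).toShort (χ (repInclusion.obj (forgetRep.obj M)))
      ((τ M).universal M.property) ((χ _).universal (forgetRep.obj M).property))
    fun {M N} F => by
      have hM := (τ M).universal M.property
      have hN := (χ (repInclusion.obj (forgetRep.obj N))).universal (forgetRep.obj N).property
      have h := changeClassifiers_naturality (forgetShort.map F.hom) hM
        ((χ (repInclusion.obj (forgetRep.obj M))).universal (forgetRep.obj M).property)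
        ((τ N).universal N.property) hN
      exact congrArg (fun G => SkewLaxFunctor.toMonoidal G (Classifiers.isIso_assoc hM)
        (Classifiers.isIso_lam hM.left) (Classifiers.isIso_rho hM) (Classifiers.isIso_assoc hN)
        (Classifiers.isIso_lam hN.left) (Classifiers.isIso_rho hN)) h

/-- The representable multicategory of a monoidal category. -/
def toMultiRep (V : MonoidalCat.{v, u}) : MultiRep.{v, u} :=
  ⟨toMulticategory V.Obj, multiRepresentable_toMulticategory V.Obj⟩

/-- A monoidal category is recovered from its multicategory. -/
noncomputable def functorKRepObjIso (V : MonoidalCat.{v, u}) :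
    (functorKRep χ).obj (forgetRep.obj (toMultiRep V)) ≅ V :=
  changeClassifiers _ (tensorClassifiers V.Obj)
      ((χ _).universal (forgetRep.obj (toMultiRep V)).property) (tensorClassifiers_universal V.Obj) ≪≫
    monoidalInclusion.preimageIso (ObjectProperty.isoMk _ (unarySkewIso V).symm)

instance functorKRep_essSurj : (functorKRep χ).EssSurj :=
  ⟨fun V => ⟨forgetRep.obj (toMultiRep V), ⟨functorKRepObjIso χ V⟩⟩⟩

instance functorKRep_isEquivalence : (functorKRep χ).IsEquivalence where

theorem forgetRep_essSurj (χ : ∀ C : ShortMultiLR.{v, u}, C.obj.Classifiers) :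
     forgetRep.{v, u}.EssSurj :=
  ⟨fun C => ⟨toMultiRep ((functorKRep χ).obj C),
    ⟨(functorKRep χ).preimageIso (functorKRepObjIso χ ((functorKRep χ).obj C))⟩⟩⟩

theorem forgetRep_isEquivalence : forgetRep.{v, u}.IsEquivalence :=
  haveI := forgetRep_essSurj fun C : ShortMultiLR.{v, u} => C.property.choose
  { }

theorem functorTRep_isEquivalence : (functorTRep τ).IsEquivalence :=
  haveI := forgetRep_isEquivalence.{v, u}
  Functor.isEquivalence_of_iso
    (functorTRepIso (fun C : ShortMultiLR.{v, u} => C.property.choose) τ).symm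

end equivalences

end RepMult

theorem mainTheorem2
    (χ : ∀ C : ShortMultiLR.{v, u}, C.obj.Classifiers)
    (τ : ∀ M : MultiRep.{v, u}, M.obj.Classifiers) :
    -- `K` restricts to `K_rep`, and `K C` is monoidal exactly when `C` is representable
    functorKRep χ ⋙ monoidalInclusion = repInclusion ⋙ functorK χ ∧
    (∀ C : ShortMultiLR.{v, u}, representable C.obj ↔
      (∀ a b c, IsIso (((functorK χ).obj C).obj.α a b c)) ∧
        ∀ a, IsIso (((functorK χ).obj C).obj.rho a)) ∧
    -- `K_rep`, `U_rep` and `T_rep` are equivalences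
    (functorKRep χ).IsEquivalence ∧
    forgetRep.{v, u}.IsEquivalence ∧
    (functorTRep τ).IsEquivalence ∧
    -- the triangle commutes: up to isomorphism for arbitrary choices of classifiers,
    -- and strictly if `T_rep` and `K_rep` use the same classifiers
    Nonempty (functorTRep τ ≅ forgetRep ⋙ functorKRep χ) ∧
    functorTRep (fun M => .ofShort (χ (repInclusion.obj (forgetRep.obj M)))) =
      forgetRep ⋙ functorKRep χ :=
  ⟨functorKRep_comp χ, representable_iff χ, functorKRep_isEquivalence χ, forgetRep_isEquivalence,
    functorTRep_isEquivalence τ, ⟨functorTRepIso χ τ⟩, functorTRep_eq χ⟩
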